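/- Let $\kappa,\tau\in\mathbb{R}$ with $\kappa-4\tau^2\neq 0$, and let $\mathbb{E}(\kappa,\tau)$ be the simply connected homogeneous Riemannian $3$-manifold with unit Killing field $\xi$ given by the following models: - if $\kappa\le 0$: $\{(x,y,z)\in\mathbb{R}^3:\lambda(x,y)>0\}$, where $\lambda(x,y)=\bigl(1+\tfrac{\kappa}{4}(x^2+y^2)\bigr)^{-1}$, with the metric $\lambda^2(dx^2+dy^2)+\bigl(dz+\lambda\tau(y\,dx-x\,dy)\bigr)^2$ and $\xi=\partial_z$; - if $\kappa>0$ and $\tau=0$: the Riemannian product $\mathbb{S}^2(\kappa)\times\mathbb{R}$, where $\mathbb{S}^2(\kappa)\subset\mathbb{R}^3$ is the round sphere of radius $1/\sqrt{\kappa}$, with $\xi$ the unit field tangent to the factor $\mathbb{R}$; - if $\kappa>0$ and $\tau\ne0$: the Berger sphere $\{(z,w)\in\mathbb{C}^2:|z|^2+|w|^2=1\}$ with the metric $\tfrac{4}{\kappa}\bigl[\langle X,Y\rangle+\tfrac{16\tau^2}{\kappa^2}\bigl(\tfrac{4\tau^2}{\kappa}-1\bigr)\langle X,\xi\rangle\langle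 Y,\xi\rangle\bigr]$, where $\xi_{(z,w)}=\tfrac{\kappa}{4\tau}(iz,iw)$ and $\langle\cdot,\cdot\rangle$ is the usual inner product of $\mathbb{C}^2\equiv\mathbb{R}^4$. Let $\gamma:\mathbb{R}\to\mathbb{E}(\kappa,\tau)$ be a geodesic that is not vertical, i.e. not everywhere tangent to $\xi$ (in particular, $\gamma$ is not constant). Then there is a unique $1$-parameter group $\{T_t\}_{t\in\mathbb{R}}$ of isometries of $\mathbb{E}(\kappa,\tau)$ such that $T_t(\gamma(s))=\gamma(t+s)$ for all $t,s\in\mathbb{R}$. Here a $1$-parameter group of isometries is a homomorphism $t\mapsto T_t$ from $(\mathbb{R},+)$ to the isometry group such that $(t,p)\mapsto T_t(p)$ is smooth; uniqueness holds even among all homomorphisms from $(\mathbb{R},+)$ to the isometry group, with no regularity assumed in $t$. -/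

import Mathlib

open scoped ContDiff

noncomputable section

namespace EKappaTau

/-- The data of a Riemannian manifold given as a submanifold `carrier` of a real normed space `V`,
with a metric tensor (the value of `metric p` on the tangent space at `p`, for `p ∈ carrier`, is
the only thing that matters) and a distinguished vector field `killing` on it. -/
structure SpaceData where
  V : Type
  [normedAddCommGroup : NormedAddCommGroup V]
  [normedSpace : NormedSpace ℝ V]
  carrier : Set V
  metric : V → V → V → ℝ
  killing : V → V

attribute [instance] SpaceData.normedAddCommGroup SpaceData.normedSpace

/-! ### The spaces `𝔼(κ, τ)` -/

/-- `λ_κ(x, y) = 1 / (1 + κ/4 (x² + y²))`. -/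
def conformalFactor (κ x y : ℝ) : ℝ := 1 / (1 + κ / 4 * (x ^ 2 + y ^ 2))

/-- The one-form `dz + λ_κ τ (y dx - x dy)` at the point `p = (x, y, z)`, evaluated at `v`. -/
def cartanForm (κ τ : ℝ) (p v : ℝ × ℝ × ℝ) : ℝ :=
  v.2.2 + conformalFactor κ p.1 p.2.1 * τ * (p.2.1 * v.1 - p.1 * v.2.1)

/-- The Cartan model: `{(x, y, z) : λ_κ(x, y) > 0}` with the metric
`λ_κ² (dx² + dy²) + (dz + λ_κ τ (y dx - x dy))²` and the vector field `ξ = ∂_z`. -/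
def cartanModel (κ τ : ℝ) : SpaceData where
  V := ℝ × ℝ × ℝ
  carrier := {p | 0 < conformalFactor κ p.1 p.2.1}
  metric p v w :=
    conformalFactor κ p.1 p.2.1 ^ 2 * (v.1 * w.1 + v.2.1 * w.2.1)
      + cartanForm κ τ p v * cartanForm κ τ p w
  killing _ := (0, 0, 1)

/-- The Riemannian product `𝕊²(κ) × ℝ`, where `𝕊²(κ) ⊆ ℝ³` is the round sphere of radius
`1/√κ` (`κ > 0`), with the vector field `ξ = ∂_h` tangent to the factor `ℝ`. -/
def sphereProduct (κ : ℝ) : SpaceData where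
  V := EuclideanSpace ℝ (Fin 3) × ℝ
  carrier := {p | ‖p.1‖ ^ 2 = 1 / κ}
  metric _ v w := inner ℝ v.1 w.1 + v.2 * w.2
  killing _ := (0, 1)

/-- The usual real inner product of `ℂ² ≡ ℝ⁴`. -/
def complexPlaneInner (v w : ℂ × ℂ) : ℝ :=
  (starRingEnd ℂ v.1 * w.1 + starRingEnd ℂ v.2 * w.2).re

/-- The vector field `ξ_{(z, w)} = κ/(4τ) (iz, iw)` on `ℂ²`. -/
def hopfField (κ τ : ℝ) (p : ℂ × ℂ) : ℂ × ℂ :=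
  (κ / (4 * τ)) • (Complex.I * p.1, Complex.I * p.2)

/-- The Berger sphere (`κ > 0`, `τ ≠ 0`): the unit sphere `|z|² + |w|² = 1` of `ℂ²` with the metric
`4/κ (⟨X, Y⟩ + 16τ²/κ² (4τ²/κ - 1) ⟨X, ξ⟩⟨Y, ξ⟩)`. -/
def bergerSphere (κ τ : ℝ) : SpaceData where
  V := ℂ × ℂ
  carrier := {p | ‖p.1‖ ^ 2 + ‖p.2‖ ^ 2 = 1}
  metric p v w :=
    4 / κ * (complexPlaneInner v w
      + 16 * τ ^ 2 / κ ^ 2 * (4 * τ ^ 2 / κ - 1)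
        * (complexPlaneInner v (hopfField κ τ p) * complexPlaneInner w (hopfField κ τ p)))
  killing := hopfField κ τ

open Classical in
/-- The simply connected homogeneous space `𝔼(κ, τ)`: the Cartan model if `κ ≤ 0`,
`𝕊²(κ) × ℝ` if `κ > 0` and `τ = 0`, and a Berger sphere if `κ > 0` and `τ ≠ 0`.
In each case `killing` is the unit Killing field `ξ` of the Killing submersion onto `𝕄²(κ)`. -/
def space (κ τ : ℝ) : SpaceData :=
  if κ ≤ 0 then cartanModel κ τ
  else if τ = 0 then sphereProduct κ
  else bergerSphere κ τ

/-! ### Curves, geodesics and isometries -/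

/-- A map defined on a subset `A` of a normed space is smooth if it is locally the restriction of
a smooth map defined on an open subset of the ambient space. -/
def IsSmoothMap {V W : Type} [NormedAddCommGroup V] [NormedSpace ℝ V]
    [NormedAddCommGroup W] [NormedSpace ℝ W] (A : Set V) (f : A → W) : Prop :=
  ∀ p : A, ∃ U : Set V, IsOpen U ∧ (p : V) ∈ U ∧
    ∃ F : V → W, ContDiffOn ℝ ∞ F U ∧ ∀ q : A, (q : V) ∈ U → F q = f q

namespace SpaceData

variable (M : SpaceData)

/-- Smooth curves `ℝ → M`. -/
def IsSmoothCurve (c : ℝ → M.carrier) : Prop :=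
  ContDiff ℝ ∞ (fun t => (c t : M.V))

/-- The velocity vector `c'(t)`. -/
def velocity (c : ℝ → M.carrier) (t : ℝ) : M.V :=
  deriv (fun s => (c s : M.V)) t

/-- The vector `w` is tangent to `M` at `p`: it is the velocity of a smooth curve in `M` at `p`. -/
def IsTangent (p : M.carrier) (w : M.V) : Prop :=
  ∃ c : ℝ → M.carrier, M.IsSmoothCurve c ∧ c 0 = p ∧ M.velocity c 0 = w

/-- Geodesics `ℝ → M` (with an affine parameter): smooth solutions of the geodesic equation. It is
written here in covector form, as the Euler-Lagrange equation of the energy `½ ∫ ⟨γ', γ'⟩`: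
for every `w` tangent to `M` at `γ(t)`,
`d/ds ⟨γ'(s), w⟩_{γ(s)} = ½ D_w (p ↦ ⟨γ'(t), γ'(t)⟩_p)` at `s = t` and `p = γ(t)`.
On an open subset of `ℝⁿ` this says `g_{kj} (γ''ʲ + Γʲ_{il} γ'ⁱ γ'ˡ) = 0`; if the metric is the
restriction of a constant inner product, it says that `γ''` is normal to `M`. -/
def IsGeodesic (γ : ℝ → M.carrier) : Prop :=
  M.IsSmoothCurve γ ∧ ∀ (t : ℝ) (w : M.V), M.IsTangent (γ t) w →
    deriv (fun s => M.metric (γ s) (M.velocity γ s) w) t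
      = 1 / 2 * fderiv ℝ (fun p => M.metric p (M.velocity γ t) (M.velocity γ t)) (γ t) w

/-- A curve is vertical if it is everywhere tangent to the Killing field `ξ`, that is, if it
stays in one fiber of the Killing submersion. -/
def IsVertical (γ : ℝ → M.carrier) : Prop :=
  ∀ t : ℝ, ∃ a : ℝ, M.velocity γ t = a • M.killing (γ t)

/-- Isometries of `M`: diffeomorphisms that preserve the metric tensor, that is, the lengths of
the velocity vectors of all smooth curves. -/
structure IsIsometry (φ : Equiv.Perm M.carrier) : Prop where
  smooth : IsSmoothMap M.carrier (fun p => (φ p : M.V))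
  smooth_symm : IsSmoothMap M.carrier (fun p => (φ.symm p : M.V))
  metric_eq : ∀ c : ℝ → M.carrier, M.IsSmoothCurve c → ∀ t : ℝ,
    M.metric (φ (c t)) (M.velocity (fun s => φ (c s)) t) (M.velocity (fun s => φ (c s)) t)
      = M.metric (c t) (M.velocity c t) (M.velocity c t)

/-- A homomorphism `t ↦ T_t` from `(ℝ, +)` to the group of isometries of `M`. -/
structure IsIsometryHom (T : ℝ → Equiv.Perm M.carrier) : Prop where
  isometry : ∀ t : ℝ, M.IsIsometry (T t)
  map_add : ∀ s t : ℝ, T (s + t) = T s * T t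

/-- The map `(t, p) ↦ T_t(p)` is smooth. -/
def IsSmoothFamily (T : ℝ → Equiv.Perm M.carrier) : Prop :=
  IsSmoothMap ((Set.univ : Set ℝ) ×ˢ M.carrier)
    (fun x => (T x.1.1 ⟨x.1.2, x.2.2⟩ : M.V))

/-- A `1`-parameter group of isometries of `M`: a homomorphism `t ↦ T_t` from `(ℝ, +)` to the
isometry group such that `(t, p) ↦ T_t(p)` is smooth. -/
def IsOneParameterGroup (T : ℝ → Equiv.Perm M.carrier) : Prop :=
  M.IsIsometryHom T ∧ M.IsSmoothFamily T

end SpaceData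

end EKappaTau

end

/-!
Existence. In each model a geodesic is an orbit of an explicit `1`-parameter group of isometries.
Noether's theorem gives the geodesic enough constants of motion to determine a Killing field `X`
with `γ' = X ∘ γ`; then `γ` moves along itself under the flow of `X`.
* In `𝕊²(κ) × ℝ` the field is a constant skew endomorphism of `ℝ³` together with a vertical
  translation (`sphereProduct_exists_oneParameterGroup`).
* In a Berger sphere, `⟨γ', iγ⟩` is constant, and so is the skew-Hermitian endomorphism built from
  `γ` and `γ'` that maps `γ` to `γ'` (`bergerSphere_exists_oneParameterGroup`). In both cases the
  flow is an exponential of matrices.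
* In the Cartan model with `κ ≤ 0` the momenta of the vertical translations, of the rotations and
  of the lifted transvections of the base are the coefficients of the Killing field
  (`cartanModel_exists_integralCurve`). Its flow is written down explicitly: a `1`-parameter group
  of Möbius transformations of the base with a correction of the vertical coordinate that restores
  the connection form (`cartanModel_exists_oneParameterGroup_of_integralCurve`).

Uniqueness. Around every point there is a chart (`IsometricChart`) in which the metric is the same
`rotMetric κ τ`, whose first derivatives vanish at the origin. Two facts about local isometries
fixing the origin of such a chart are used.
* They are determined by their derivative there (`eventually_eq_of_local_isometry`): by the
  transformation law of the Christoffel symbols, an isometry with the identity as derivative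
  satisfies a linear differential inequality along segments. By connectedness an isometry of the
  whole space that fixes a point is therefore determined by its derivative at this point.
* If `κ ≠ 4τ²` the derivative preserves the vertical line (`fderiv_vertical_of_local_isometry`). The
  derivative preserves the curvature tensor, which here is computed from the second derivatives of
  the metric only, and the planes of sectional curvature `τ²` are those containing the vertical
  direction.

Since `γ` is not vertical, an isometry fixing `γ` pointwise fixes a non-vertical tangent vector and
maps the vertical unit vector to plus or minus itself; this leaves finitely many derivatives, so the
group `G` of such isometries is finite (`finite_pointwiseStabilizer`). If `S` and `T` are two
homomorphisms with `S_t γ(s) = γ(t + s) = T_t γ(s)`, conjugation by `T_t` is an action of `ℝ` on the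
finite group `G`; as `ℝ` is divisible, the action is trivial, `t ↦ T_{-t} S_t` is a homomorphism
from `ℝ` to `G`, and this is trivial for the same reason (`eq_of_map_add_of_finite`). No regularity
in `t` is needed.
-/

set_option maxSynthPendingDepth 3

open Filter Topology

namespace EKappaTau

/-! ### Local isometries are determined by their first derivative -/

section Rigidity

variable {E : Type*} [NormedAddCommGroup E] [NormedSpace ℝ E]

/-- The derivative of the metric transformation law `g_{f(x)}(Df u, Df v) = g_x(u, v)`. -/
theorem fderiv_transformation_law {g : E → E →L[ℝ] E →L[ℝ] ℝ} {f : E → E} {x : E}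
    (hg : DifferentiableAt ℝ g (f x)) (hgx : DifferentiableAt ℝ g x)
    (hf : DifferentiableAt ℝ f x)
    (hP : DifferentiableAt ℝ (fderiv ℝ f) x)
    (h : ∀ᶠ y in 𝓝 x, ∀ u v, g (f y) (fderiv ℝ f y u) (fderiv ℝ f y v) = g y u v)
    (w u v : E) :
    fderiv ℝ g (f x) (fderiv ℝ f x w) (fderiv ℝ f x u) (fderiv ℝ f x v)
      + g (f x) (fderiv ℝ (fderiv ℝ f) x w u) (fderiv ℝ f x v)
      + g (f x) (fderiv ℝ f x u) (fderiv ℝ (fderiv ℝ f) x w v)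
      = fderiv ℝ g x w u v := by
  have h1 : HasFDerivAt (fun y => g (f y)) ((fderiv ℝ g (f x)).comp (fderiv ℝ f x)) x :=
    HasFDerivAt.comp x (g := g) hg.hasFDerivAt hf.hasFDerivAt
  have hPu := hP.hasFDerivAt.clm_apply (hasFDerivAt_const u x)
  have hPv := hP.hasFDerivAt.clm_apply (hasFDerivAt_const v x)
  have h2 := (h1.clm_apply hPu).clm_apply hPv
  have h3 := (hgx.hasFDerivAt.clm_apply (hasFDerivAt_const u x)).clm_apply
    (hasFDerivAt_const v x)
  have h4 := h2.congr_of_eventuallyEq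
    (f₁ := fun y => g y u v) (h.mono fun y hy => (hy u v).symm)
  have h5 := congrArg (fun T : E →L[ℝ] ℝ => T w) (h4.unique h3)
  simp at h5
  linarith

/-- The Koszul formula for the second derivative of a local isometry. -/
theorem koszul_formula {g : E → E →L[ℝ] E →L[ℝ] ℝ} {f : E → E} {x : E}
    (hg : DifferentiableAt ℝ g (f x)) (hgx : DifferentiableAt ℝ g x)
    (hf : ContDiffAt ℝ 2 f x)
    (hsymm : ∀ u v, g (f x) u v = g (f x) v u)
    (h : ∀ᶠ y in 𝓝 x, ∀ u v, g (f y) (fderiv ℝ f y u) (fderiv ℝ f y v) = g y u v)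
    (w u v : E) :
    2 * g (f x) (fderiv ℝ (fderiv ℝ f) x w u) (fderiv ℝ f x v) =
      (fderiv ℝ g x w u v + fderiv ℝ g x u w v - fderiv ℝ g x v w u)
      - (fderiv ℝ g (f x) (fderiv ℝ f x w) (fderiv ℝ f x u) (fderiv ℝ f x v)
        + fderiv ℝ g (f x) (fderiv ℝ f x u) (fderiv ℝ f x w) (fderiv ℝ f x v)
        - fderiv ℝ g (f x) (fderiv ℝ f x v) (fderiv ℝ f x w) (fderiv ℝ f x u)) := by
  have hfd : DifferentiableAt ℝ f x := hf.differentiableAt (by simp)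
  have hP : DifferentiableAt ℝ (fderiv ℝ f) x :=
    (hf.fderiv_right (m := 1) (by norm_num)).differentiableAt (by simp)
  have hs : IsSymmSndFDerivAt ℝ f x := hf.isSymmSndFDerivAt (by simp)
  have e1 := fderiv_transformation_law hg hgx hfd hP h w u v
  have e2 := fderiv_transformation_law hg hgx hfd hP h u w v
  have e3 := fderiv_transformation_law hg hgx hfd hP h v w u
  rw [hs.eq u w] at e2
  rw [hs.eq v w, hs.eq v u] at e3
  have s1 := hsymm (fderiv ℝ f x u) (fderiv ℝ (fderiv ℝ f) x w v)
  have s2 := hsymm (fderiv ℝ f x w) (fderiv ℝ (fderiv ℝ f) x u v)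
  linarith

theorem abs_apply₃_le (T : E →L[ℝ] E →L[ℝ] E →L[ℝ] ℝ) (a b c : E) :
    |T a b c| ≤ ‖T‖ * ‖a‖ * ‖b‖ * ‖c‖ := by
  have h1 := (T a b).le_opNorm c
  have h2 := (T a).le_opNorm b
  have h3 := T.le_opNorm a
  rw [Real.norm_eq_abs] at h1
  calc |T a b c| ≤ ‖T a b‖ * ‖c‖ := h1
    _ ≤ (‖T a‖ * ‖b‖) * ‖c‖ := by gcongr
    _ ≤ _ := by gcongr

theorem abs_apply₂_le (T : E →L[ℝ] E →L[ℝ] ℝ) (a b : E) : |T a b| ≤ ‖T‖ * ‖a‖ * ‖b‖ := by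
  have h1 := (T a).le_opNorm b
  have h2 := T.le_opNorm a
  rw [Real.norm_eq_abs] at h1
  calc |T a b| ≤ ‖T a‖ * ‖b‖ := h1
    _ ≤ _ := by gcongr

/-- A trilinear form changes by `O(‖T - T'‖ + ‖Q - 1‖)` when it is replaced by `T'` and its
arguments are moved by an endomorphism `Q` of norm at most `2`. -/
theorem abs_trilinear_sub_le (T T' : E →L[ℝ] E →L[ℝ] E →L[ℝ] ℝ) (Q : E →L[ℝ] E)
    {K ε₁ ε₂ : ℝ} (hT : ‖T'‖ ≤ K) (hQ : ‖Q‖ ≤ 2)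
    (h1 : ‖T - T'‖ ≤ ε₁) (h2 : ‖Q - 1‖ ≤ ε₂) (a b c : E) :
    |T a b c - T' (Q a) (Q b) (Q c)| ≤ (ε₁ + 7 * K * ε₂) * ‖a‖ * ‖b‖ * ‖c‖ := by
  have hK : 0 ≤ K := (norm_nonneg _).trans hT
  have he2 : 0 ≤ ε₂ := (norm_nonneg _).trans h2
  have hd : ∀ a : E, ‖Q a - a‖ ≤ ε₂ * ‖a‖ := fun a => by
    have := (Q - 1).le_opNorm a
    calc ‖Q a - a‖ = ‖(Q - 1) a‖ := by simp
      _ ≤ ‖Q - 1‖ * ‖a‖ := this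
      _ ≤ _ := by gcongr
  have hq : ∀ a : E, ‖Q a‖ ≤ 2 * ‖a‖ := fun a => (Q.le_opNorm a).trans (by gcongr)
  have key : T a b c - T' (Q a) (Q b) (Q c) =
      (T - T') a b c - T' (Q a - a) (Q b) (Q c) - T' a (Q b - b) (Q c)
        - T' a b (Q c - c) := by
    simp; ring
  have b1 : |(T - T') a b c| ≤ ε₁ * ‖a‖ * ‖b‖ * ‖c‖ :=
    (abs_apply₃_le _ a b c).trans (by gcongr)
  have b2 : |T' (Q a - a) (Q b) (Q c)| ≤ K * (ε₂ * ‖a‖) * (2 * ‖b‖) * (2 * ‖c‖) :=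
    (abs_apply₃_le _ _ _ _).trans (by gcongr <;> first | exact hd _ | exact hq _)
  have b3 : |T' a (Q b - b) (Q c)| ≤ K * ‖a‖ * (ε₂ * ‖b‖) * (2 * ‖c‖) :=
    (abs_apply₃_le _ _ _ _).trans (by gcongr <;> first | exact hd _ | exact hq _)
  have b4 : |T' a b (Q c - c)| ≤ K * ‖a‖ * ‖b‖ * (ε₂ * ‖c‖) :=
    (abs_apply₃_le _ _ _ _).trans (by gcongr; exact hd _)
  rw [key]
  rw [abs_le] at b1 b2 b3 b4 ⊢
  constructor <;> linarith [b1.1, b2.1, b3.1, b4.1, b1.2, b2.2, b3.2, b4.2]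

/-- A metric that is coercive at `x₀` stays coercive near `x₀`, also if one argument is moved by
an endomorphism near the identity. -/
theorem coercive_perturb {g₀ g₁ : E →L[ℝ] E →L[ℝ] ℝ} {Q : E →L[ℝ] E} {c : ℝ}
    (hcoer : ∀ u, c * ‖u‖ ^ 2 ≤ g₀ u u) (h1 : ‖g₁ - g₀‖ ≤ c / 4)
    (h2 : ‖g₁‖ * ‖Q - 1‖ ≤ c / 4) (a : E) : c / 2 * ‖a‖ ^ 2 ≤ g₁ a (Q a) := by
  have key : g₁ a (Q a) = g₀ a a + (g₁ - g₀) a a + g₁ a ((Q - 1) a) := by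
    simp
  have b1 : |(g₁ - g₀) a a| ≤ c / 4 * ‖a‖ ^ 2 := by
    calc _ ≤ ‖g₁ - g₀‖ * ‖a‖ * ‖a‖ := abs_apply₂_le _ a a
      _ ≤ c / 4 * ‖a‖ * ‖a‖ := by gcongr
      _ = _ := by ring
  have b2 : |g₁ a ((Q - 1) a)| ≤ c / 4 * ‖a‖ ^ 2 := by
    calc _ ≤ ‖g₁‖ * ‖a‖ * ‖(Q - 1) a‖ := abs_apply₂_le _ _ _
      _ ≤ ‖g₁‖ * ‖a‖ * (‖Q - 1‖ * ‖a‖) := by gcongr; exact (Q - 1).le_opNorm a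
      _ = (‖g₁‖ * ‖Q - 1‖) * ‖a‖ ^ 2 := by ring
      _ ≤ _ := by gcongr
  rw [key]
  linarith [hcoer a, (abs_le.1 b1).1, (abs_le.1 b2).1]

/-- Near a fixed point with trivial differential, the second derivative of a local isometry is
controlled by the distance of its `1`-jet to that of the identity. -/
theorem exists_bound_second_derivative {g : E → E →L[ℝ] E →L[ℝ] ℝ} {f : E → E} {x₀ : E} {c : ℝ}
    (hg : ContDiffAt ℝ ∞ g x₀) (hsymm : ∀ᶠ y in 𝓝 x₀, ∀ u v, g y u v = g y v u)
    (hc : 0 < c) (hcoer : ∀ u, c * ‖u‖ ^ 2 ≤ g x₀ u u)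
    (hf : ContDiffAt ℝ ∞ f x₀)
    (h : ∀ᶠ x in 𝓝 x₀, ∀ u v, g (f x) (fderiv ℝ f x u) (fderiv ℝ f x v) = g x u v)
    (hfx : f x₀ = x₀) (hDf : fderiv ℝ f x₀ = 1) :
    ∃ K, 0 ≤ K ∧ ∀ᶠ x in 𝓝 x₀,
      ‖fderiv ℝ (fderiv ℝ f) x‖ ≤ K * (‖f x - x‖ + ‖fderiv ℝ f x - 1‖) := by
  have hB : ContDiffAt ℝ 1 (fderiv ℝ g) x₀ := hg.fderiv_right (by norm_cast)
  have hP : ContDiffAt ℝ 1 (fderiv ℝ f) x₀ := hf.fderiv_right (by norm_cast)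
  obtain ⟨K₁, t, ht, hlip⟩ := hB.exists_lipschitzOnWith
  have hfc : Tendsto f (𝓝 x₀) (𝓝 x₀) := by simpa [hfx] using hf.continuousAt.tendsto
  have hPc : Tendsto (fderiv ℝ f) (𝓝 x₀) (𝓝 1) := by
    simpa [hDf] using hP.continuousAt.tendsto
  set K₀ := ‖fderiv ℝ g x₀‖ + 1
  set G₀ := ‖g x₀‖ + 1
  have hG₀ : 0 < G₀ := by positivity
  have hBb : ∀ᶠ y in 𝓝 x₀, ‖fderiv ℝ g y‖ ≤ K₀ :=
    hB.continuousAt.norm.eventually_le_const (lt_add_one _)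
  have hgb : ∀ᶠ y in 𝓝 x₀, ‖g y‖ ≤ G₀ :=
    hg.continuousAt.norm.eventually_le_const (lt_add_one _)
  have hgn : ∀ᶠ y in 𝓝 x₀, ‖g y - g x₀‖ ≤ c / 4 := by
    have : Tendsto (fun y => ‖g y - g x₀‖) (𝓝 x₀) (𝓝 0) := by
      simpa using (hg.continuousAt.sub (continuousAt_const (y := g x₀))).norm.tendsto
    exact this.eventually_le_const (by positivity)
  have hQ : ∀ᶠ x in 𝓝 x₀, ‖fderiv ℝ f x - 1‖ ≤ min 1 (c / 4 / G₀) := by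
    have : Tendsto (fun x => ‖fderiv ℝ f x - 1‖) (𝓝 x₀) (𝓝 0) := by
      simpa using (hPc.sub (tendsto_const_nhds (x := (1 : E →L[ℝ] E)))).norm
    exact this.eventually_le_const (by positivity)
  have hgd : ∀ᶠ y in 𝓝 x₀, DifferentiableAt ℝ g y :=
    ((hg.of_le (m := 1) (by norm_cast)).eventually (by simp)).mono
      fun y hy => hy.differentiableAt (by simp)
  have hfd : ∀ᶠ y in 𝓝 x₀, ContDiffAt ℝ 2 f y :=
    (hf.of_le (m := 2) (by norm_cast)).eventually (by simp)
  refine ⟨3 * ((K₁ : ℝ) + 7 * K₀) / c, by positivity, ?_⟩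
  filter_upwards [hfc.eventually hBb, hfc.eventually hgb, hfc.eventually hgn, hQ, hgd,
    hfc.eventually hgd, hfd, h.eventually_nhds, hfc.eventually hsymm, ht, hfc ht]
    with x x1 x2 x3 x4 x5 x6 x7 x8 x9 x10 x11
  set P := fderiv ℝ f x
  have hP1 : ‖P - 1‖ ≤ 1 := x4.trans (min_le_left _ _)
  have hP2 : ‖P‖ ≤ 2 := by
    have h1 : ‖(1 : E →L[ℝ] E)‖ ≤ 1 := ContinuousLinearMap.norm_id_le
    calc ‖P‖ = ‖(P - 1) + 1‖ := by simp
      _ ≤ ‖P - 1‖ + ‖(1 : E →L[ℝ] E)‖ := norm_add_le _ _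
      _ ≤ 2 := by linarith
  have hdist : ‖fderiv ℝ g x - fderiv ℝ g (f x)‖ ≤ K₁ * ‖f x - x‖ := by
    have := hlip.dist_le_mul x x10 (f x) x11
    rwa [dist_eq_norm, dist_eq_norm, norm_sub_rev x] at this
  have hco : ∀ a, c / 2 * ‖a‖ ^ 2 ≤ g (f x) a (P a) := by
    refine coercive_perturb hcoer x3 ?_
    calc ‖g (f x)‖ * ‖P - 1‖ ≤ G₀ * (c / 4 / G₀) :=
          mul_le_mul x2 (x4.trans (min_le_right _ _)) (norm_nonneg _) hG₀.le
      _ = c / 4 := by field_simp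
  set e := ‖f x - x‖ + ‖P - 1‖
  have he1 : ‖f x - x‖ ≤ e := le_add_of_nonneg_right (norm_nonneg _)
  have he2 : ‖P - 1‖ ≤ e := le_add_of_nonneg_left (norm_nonneg _)
  have he : 0 ≤ e := by positivity
  refine ContinuousLinearMap.opNorm_le_bound _ (by positivity) fun d => ?_
  refine ContinuousLinearMap.opNorm_le_bound _ (by positivity) fun u => ?_
  set a := fderiv ℝ (fderiv ℝ f) x d u
  have hk := koszul_formula x6 x5 x7 x9 x8 d u a
  have hb : ∀ p q r : E, |fderiv ℝ g x p q r - fderiv ℝ g (f x) (P p) (P q) (P r)|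
      ≤ ((K₁ + 7 * K₀) * e) * ‖p‖ * ‖q‖ * ‖r‖ := by
    intro p q r
    refine (abs_trilinear_sub_le _ _ P x1 hP2 hdist le_rfl p q r).trans ?_
    gcongr
    calc (K₁ : ℝ) * ‖f x - x‖ + 7 * K₀ * ‖P - 1‖ ≤ K₁ * e + 7 * K₀ * e := by gcongr
      _ = _ := by ring
  have h1 := (abs_le.1 (hb d u a)).2
  have h2 := (abs_le.1 (hb u d a)).2
  have h3 := (abs_le.1 (hb a d u)).1
  have h4 := hco a
  have h5 : c * ‖a‖ * ‖a‖ ≤ (3 * (K₁ + 7 * K₀) * e * ‖d‖ * ‖u‖) * ‖a‖ := by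
    change 2 * g (f x) a (P a) = _ at hk
    linarith
  rcases (norm_nonneg a).eq_or_lt with h0 | h0
  · rw [← h0]; positivity
  · have h6 := le_of_mul_le_mul_right h5 h0
    calc ‖a‖ = c * ‖a‖ / c := by field_simp
      _ ≤ (3 * (K₁ + 7 * K₀) * e * ‖d‖ * ‖u‖) / c := by gcongr
      _ = _ := by ring

/-- **Rigidity**: a local isometry with the `1`-jet of the identity at `x₀` is the identity
near `x₀`. Along rays from `x₀`, the difference of the `1`-jets satisfies a linear differential
inequality, so that Grönwall's inequality applies. -/
theorem eventually_eq_of_local_isometry {g : E → E →L[ℝ] E →L[ℝ] ℝ} {f : E → E} {x₀ : E} {c : ℝ}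
    (hg : ContDiffAt ℝ ∞ g x₀) (hsymm : ∀ᶠ y in 𝓝 x₀, ∀ u v, g y u v = g y v u)
    (hc : 0 < c) (hcoer : ∀ u, c * ‖u‖ ^ 2 ≤ g x₀ u u)
    (hf : ContDiffAt ℝ ∞ f x₀)
    (h : ∀ᶠ x in 𝓝 x₀, ∀ u v, g (f x) (fderiv ℝ f x u) (fderiv ℝ f x v) = g x u v)
    (hfx : f x₀ = x₀) (hDf : fderiv ℝ f x₀ = 1) :
    ∀ᶠ x in 𝓝 x₀, f x = x := by
  obtain ⟨K, hK, hbound⟩ := exists_bound_second_derivative hg hsymm hc hcoer hf h hfx hDf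
  have hfd : ∀ᶠ y in 𝓝 x₀, ContDiffAt ℝ 2 f y :=
    (hf.of_le (m := 2) (by norm_cast)).eventually (by simp)
  obtain ⟨r, hr, hball⟩ := Metric.eventually_nhds_iff_ball.1 (hbound.and hfd)
  filter_upwards [Metric.ball_mem_nhds x₀ hr] with x hx
  set d := x - x₀
  have hmem : ∀ s ∈ Set.Icc (0 : ℝ) 1, x₀ + s • d ∈ Metric.ball x₀ r := by
    intro s hs
    rw [mem_ball_iff_norm] at hx ⊢
    have : ‖s • d‖ ≤ 1 * ‖d‖ := by
      rw [norm_smul, Real.norm_of_nonneg hs.1]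
      gcongr
      exact hs.2
    simpa using lt_of_le_of_lt this (by simpa using hx)
  set Y : ℝ → E × (E →L[ℝ] E) := fun s =>
    (f (x₀ + s • d) - (x₀ + s • d), fderiv ℝ f (x₀ + s • d) - 1)
  set Y' : ℝ → E × (E →L[ℝ] E) := fun s =>
    (fderiv ℝ f (x₀ + s • d) d - d, fderiv ℝ (fderiv ℝ f) (x₀ + s • d) d)
  have hline : ∀ s : ℝ, HasDerivAt (fun s : ℝ => x₀ + s • d) d s := fun s => by
    simpa using ((hasDerivAt_id s).smul_const d).const_add x₀
  have hY : ∀ s ∈ Set.Icc (0 : ℝ) 1, HasDerivAt Y (Y' s) s := by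
    intro s hs
    have h2 := (hball _ (hmem s hs)).2
    have h3 : DifferentiableAt ℝ (fderiv ℝ f) (x₀ + s • d) :=
      (h2.fderiv_right (m := 1) (by norm_num)).differentiableAt (by simp)
    exact (((h2.differentiableAt (by simp)).hasFDerivAt.comp_hasDerivAt s (hline s)).sub
      (hline s)).prodMk ((h3.hasFDerivAt.comp_hasDerivAt s (hline s)).sub_const 1)
  have hgr := norm_le_gronwallBound_of_norm_deriv_right_le (f := Y) (f' := Y') (δ := 0)
    (K := max ‖d‖ (2 * K * ‖d‖)) (ε := 0) (a := 0) (b := 1)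
    (fun s hs => (hY s hs).continuousAt.continuousWithinAt)
    (fun s hs => (hY s (Set.Ico_subset_Icc_self hs)).hasDerivWithinAt)
    (by simp [Y, hfx, hDf])
    (by
      intro s hs
      have h1 := (hball _ (hmem s (Set.Ico_subset_Icc_self hs))).1
      have n1 : ‖f (x₀ + s • d) - (x₀ + s • d)‖ ≤ ‖Y s‖ := norm_fst_le (Y s)
      have n2 : ‖fderiv ℝ f (x₀ + s • d) - 1‖ ≤ ‖Y s‖ := norm_snd_le (Y s)
      rw [add_zero]
      refine max_le ?_ ?_
      · calc ‖fderiv ℝ f (x₀ + s • d) d - d‖ = ‖(fderiv ℝ f (x₀ + s • d) - 1) d‖ := by simp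
          _ ≤ ‖fderiv ℝ f (x₀ + s • d) - 1‖ * ‖d‖ := ContinuousLinearMap.le_opNorm _ _
          _ ≤ ‖Y s‖ * ‖d‖ := by gcongr
          _ = ‖d‖ * ‖Y s‖ := mul_comm _ _
          _ ≤ _ := by gcongr; exact le_max_left _ _
      · calc ‖fderiv ℝ (fderiv ℝ f) (x₀ + s • d) d‖
            ≤ ‖fderiv ℝ (fderiv ℝ f) (x₀ + s • d)‖ * ‖d‖ := ContinuousLinearMap.le_opNorm _ _
          _ ≤ (K * (‖Y s‖ + ‖Y s‖)) * ‖d‖ := by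
            gcongr
            exact h1.trans (by gcongr)
          _ = (2 * K * ‖d‖) * ‖Y s‖ := by ring
          _ ≤ _ := by gcongr; exact le_max_right _ _)
    1 (by simp)
  have h0 : Y 1 = 0 := by
    simpa [gronwallBound_ε0] using hgr
  have h1 : f (x₀ + (1 : ℝ) • d) - (x₀ + (1 : ℝ) • d) = 0 := congrArg Prod.fst h0
  simpa [d, sub_eq_zero] using h1

end Rigidity

/-! ### Curvature at a point where the metric is stationary -/

section Curvature

variable {E : Type*} [NormedAddCommGroup E] [NormedSpace ℝ E]

/-- If the first derivatives of the metric vanish at a fixed point of a local isometry `f`, then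
so does the second derivative of `f`. -/
theorem fderiv_fderiv_eq_zero_of_local_isometry {g : E → E →L[ℝ] E →L[ℝ] ℝ} {f : E → E} {c : ℝ}
    (hg : ContDiffAt ℝ ∞ g 0) (hsymm : ∀ᶠ y in 𝓝 0, ∀ u v, g y u v = g y v u)
    (hc : 0 < c) (hcoer : ∀ u, c * ‖u‖ ^ 2 ≤ g 0 u u)
    (hf : ContDiffAt ℝ ∞ f 0)
    (h : ∀ᶠ x in 𝓝 0, ∀ u v, g (f x) (fderiv ℝ f x u) (fderiv ℝ f x v) = g x u v)
    (hfx : f 0 = 0) (hg1 : fderiv ℝ g 0 = 0) (hL : Function.Surjective (fderiv ℝ f 0)) :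
    fderiv ℝ (fderiv ℝ f) 0 = 0 := by
  have hgd : DifferentiableAt ℝ g 0 := hg.differentiableAt (by simp)
  ext w u
  obtain ⟨v, hv⟩ := hL (fderiv ℝ (fderiv ℝ f) 0 w u)
  have hk := koszul_formula (by rwa [hfx]) hgd (hf.of_le (by norm_cast))
    (by rw [hfx]; exact hsymm.self_of_nhds) h w u v
  rw [hfx, hg1, hv] at hk
  simp at hk
  have h2 := hcoer (fderiv ℝ (fderiv ℝ f) 0 w u)
  rw [hk] at h2
  have h3 : ‖fderiv ℝ (fderiv ℝ f) 0 w u‖ ^ 2 ≤ 0 := by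
    by_contra! h4
    linarith [mul_pos hc h4]
  have h4 : ‖fderiv ℝ (fderiv ℝ f) 0 w u‖ = 0 := by
    have := sq_nonneg ‖fderiv ℝ (fderiv ℝ f) 0 w u‖
    exact pow_eq_zero_iff (two_ne_zero) |>.1 (le_antisymm h3 this)
  simpa using h4

/-- The second-order part of the metric transformation law at a fixed point where the first
derivatives of the metric vanish. -/
theorem second_order_transformation_law {g : E → E →L[ℝ] E →L[ℝ] ℝ} {f : E → E}
    (hg : ContDiffAt ℝ ∞ g 0) (hf : ContDiffAt ℝ ∞ f 0)
    (h : ∀ᶠ x in 𝓝 0, ∀ u v, g (f x) (fderiv ℝ f x u) (fderiv ℝ f x v) = g x u v)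
    (hfx : f 0 = 0) (hg1 : fderiv ℝ g 0 = 0) (hf2 : fderiv ℝ (fderiv ℝ f) 0 = 0)
    (w' w u v : E) :
    fderiv ℝ (fderiv ℝ g) 0 (fderiv ℝ f 0 w') (fderiv ℝ f 0 w) (fderiv ℝ f 0 u) (fderiv ℝ f 0 v)
      + g 0 (fderiv ℝ (fderiv ℝ (fderiv ℝ f)) 0 w' w u) (fderiv ℝ f 0 v)
      + g 0 (fderiv ℝ f 0 u) (fderiv ℝ (fderiv ℝ (fderiv ℝ f)) 0 w' w v)
      = fderiv ℝ (fderiv ℝ g) 0 w' w u v := by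
  have hfc : Tendsto f (𝓝 0) (𝓝 0) := by simpa [hfx] using hf.continuousAt.tendsto
  have hg2 : ∀ᶠ x in 𝓝 (0 : E), ContDiffAt ℝ 2 g x :=
    (hg.of_le (m := 2) (by norm_cast)).eventually (by simp)
  have hf3 : ∀ᶠ x in 𝓝 (0 : E), ContDiffAt ℝ 3 f x :=
    (hf.of_le (m := 3) (by norm_cast)).eventually (by simp)
  have hlaw : ∀ᶠ x in 𝓝 (0 : E),
      fderiv ℝ g (f x) (fderiv ℝ f x w) (fderiv ℝ f x u) (fderiv ℝ f x v)
      + g (f x) (fderiv ℝ (fderiv ℝ f) x w u) (fderiv ℝ f x v)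
      + g (f x) (fderiv ℝ f x u) (fderiv ℝ (fderiv ℝ f) x w v)
      = fderiv ℝ g x w u v := by
    filter_upwards [hg2, hfc.eventually hg2, hf3, h.eventually_nhds] with x h1 h2 h3 h4
    exact fderiv_transformation_law (h2.differentiableAt (by simp))
      (h1.differentiableAt (by simp)) (h3.differentiableAt (by simp))
      ((h3.fderiv_right (m := 1) (by norm_num)).differentiableAt (by simp)) h4 w u v
  have df : HasFDerivAt f (fderiv ℝ f 0) 0 := (hf.differentiableAt (by simp)).hasFDerivAt
  have hP : ContDiffAt ℝ ∞ (fderiv ℝ f) 0 := hf.fderiv_right (by norm_cast)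
  have dP : HasFDerivAt (fderiv ℝ f) (fderiv ℝ (fderiv ℝ f) 0) 0 :=
    (hP.differentiableAt (by simp)).hasFDerivAt
  have hD : ContDiffAt ℝ ∞ (fderiv ℝ (fderiv ℝ f)) 0 := hP.fderiv_right (by norm_cast)
  have dD : HasFDerivAt (fderiv ℝ (fderiv ℝ f)) (fderiv ℝ (fderiv ℝ (fderiv ℝ f)) 0) 0 :=
    (hD.differentiableAt (by simp)).hasFDerivAt
  have dg : HasFDerivAt g (fderiv ℝ g 0) (f 0) := by
    rw [hfx]; exact (hg.differentiableAt (by simp)).hasFDerivAt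
  have dB : HasFDerivAt (fderiv ℝ g) (fderiv ℝ (fderiv ℝ g) 0) 0 :=
    ((hg.fderiv_right (m := 1) (by norm_cast)).differentiableAt (by simp)).hasFDerivAt
  have dgf : HasFDerivAt (fun x => g (f x)) ((fderiv ℝ g 0).comp (fderiv ℝ f 0)) 0 :=
    HasFDerivAt.comp 0 (g := g) dg df
  have dBf : HasFDerivAt (fun x => fderiv ℝ g (f x))
      ((fderiv ℝ (fderiv ℝ g) 0).comp (fderiv ℝ f 0)) 0 :=
    HasFDerivAt.comp 0 (g := fderiv ℝ g) (by rwa [hfx]) df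
  have cst : ∀ a : E, HasFDerivAt (fun _ : E => a) (0 : E →L[ℝ] E) 0 :=
    fun a => hasFDerivAt_const a 0
  have dPa : ∀ a : E, HasFDerivAt (fun x => fderiv ℝ f x a) (0 : E →L[ℝ] E) 0 := by
    intro a
    convert dP.clm_apply (cst a) using 1
    rw [hf2]; ext; simp
  have dDa := fun a b : E => ((dD.clm_apply (cst a)).clm_apply (cst b))
  have t1 := ((dBf.clm_apply (dPa w)).clm_apply (dPa u)).clm_apply (dPa v)
  have t2 := (dgf.clm_apply (dDa w u)).clm_apply (dPa v)
  have t3 := (dgf.clm_apply (dPa u)).clm_apply (dDa w v)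
  have r := ((dB.clm_apply (cst w)).clm_apply (cst u)).clm_apply (cst v)
  have l := ((t1.add t2).add t3).congr_of_eventuallyEq
    (f₁ := fun x => fderiv ℝ g x w u v) (hlaw.mono fun x hx => hx.symm)
  have e := congrArg (fun T : E →L[ℝ] ℝ => T w') (l.unique r)
  simp [hg1, hf2, hfx] at e
  linarith

/-- The quadratic form `a ∧ b ↦ -2 ⟨R(a, b) b, a⟩` of the curvature at a point where the first
derivatives of the metric vanish. -/
noncomputable def curvatureForm (g : E → E →L[ℝ] E →L[ℝ] ℝ) (a b : E) : ℝ :=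
  fderiv ℝ (fderiv ℝ g) 0 a a b b + fderiv ℝ (fderiv ℝ g) 0 b b a a
    - 2 * fderiv ℝ (fderiv ℝ g) 0 a b a b

/-- Local isometries preserve the curvature: the third derivatives of `f` cancel out in the
combination of second derivatives of the metric that makes up the curvature. -/
theorem curvatureForm_local_isometry {g : E → E →L[ℝ] E →L[ℝ] ℝ} {f : E → E} {c : ℝ}
    (hg : ContDiffAt ℝ ∞ g 0) (hsymm : ∀ᶠ y in 𝓝 0, ∀ u v, g y u v = g y v u)
    (hc : 0 < c) (hcoer : ∀ u, c * ‖u‖ ^ 2 ≤ g 0 u u)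
    (hf : ContDiffAt ℝ ∞ f 0)
    (h : ∀ᶠ x in 𝓝 0, ∀ u v, g (f x) (fderiv ℝ f x u) (fderiv ℝ f x v) = g x u v)
    (hfx : f 0 = 0) (hg1 : fderiv ℝ g 0 = 0) (hL : Function.Surjective (fderiv ℝ f 0)) (a b : E) :
    curvatureForm g (fderiv ℝ f 0 a) (fderiv ℝ f 0 b) = curvatureForm g a b := by
  have hf2 := fderiv_fderiv_eq_zero_of_local_isometry hg hsymm hc hcoer hf h hfx hg1 hL
  have law := second_order_transformation_law hg hf h hfx hg1 hf2
  have hP : ContDiffAt ℝ ∞ (fderiv ℝ f) 0 := hf.fderiv_right (by norm_cast)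
  have hD : ContDiffAt ℝ ∞ (fderiv ℝ (fderiv ℝ f)) 0 := hP.fderiv_right (by norm_cast)
  have s1 : ∀ w' w, fderiv ℝ (fderiv ℝ (fderiv ℝ f)) 0 w' w
      = fderiv ℝ (fderiv ℝ (fderiv ℝ f)) 0 w w' :=
    fun w' w => (hP.isSymmSndFDerivAt (by simp; norm_cast)).eq w' w
  have s2 : ∀ w' w u, fderiv ℝ (fderiv ℝ (fderiv ℝ f)) 0 w' w u
      = fderiv ℝ (fderiv ℝ (fderiv ℝ f)) 0 w' u w := by
    intro w' w u
    have hs : ∀ᶠ x in 𝓝 (0 : E), fderiv ℝ (fderiv ℝ f) x w u = fderiv ℝ (fderiv ℝ f) x u w := by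
      filter_upwards [(hf.of_le (m := 2) (by norm_cast)).eventually (by simp)] with x hx
      exact (hx.isSymmSndFDerivAt (by simp)).eq w u
    have cst : ∀ a : E, HasFDerivAt (fun _ : E => a) (0 : E →L[ℝ] E) 0 :=
      fun a => hasFDerivAt_const a 0
    have dD := (hD.differentiableAt (by simp)).hasFDerivAt
    have d1 := (dD.clm_apply (cst w)).clm_apply (cst u)
    have d2 := ((dD.clm_apply (cst u)).clm_apply (cst w)).congr_of_eventuallyEq hs
    have e := congrArg (fun T : E →L[ℝ] E => T w') (d1.unique d2)
    simpa using e
  have y0 := hsymm.self_of_nhds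
  have l1 := law a a b b
  have l2 := law b b a a
  have l3 := law a b a b
  rw [y0 (fderiv ℝ f 0 b)] at l1
  rw [y0 (fderiv ℝ f 0 a)] at l2
  rw [s2 a b a, s1 a b, s2 b a b, y0 (fderiv ℝ f 0 a) (fderiv ℝ (fderiv ℝ (fderiv ℝ f)) 0 b b a)]
    at l3
  unfold curvatureForm
  linarith

theorem curvatureForm_eq {g : E → E →L[ℝ] E →L[ℝ] ℝ} (hg : ContDiffAt ℝ ∞ g 0)
    (a b : E) : curvatureForm g a b =
      fderiv ℝ (fderiv ℝ g) 0 a a b b + fderiv ℝ (fderiv ℝ g) 0 b b a a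
      - (fderiv ℝ (fderiv ℝ g) 0 (a + b) (a + b) a b - fderiv ℝ (fderiv ℝ g) 0 a a a b
        - fderiv ℝ (fderiv ℝ g) 0 b b a b) := by
  have hs : fderiv ℝ (fderiv ℝ g) 0 b a = fderiv ℝ (fderiv ℝ g) 0 a b :=
    (hg.isSymmSndFDerivAt (by simp; norm_cast)).eq b a
  simp only [curvatureForm, map_add, add_apply, hs]
  ring

/-- If `g(ta)(u, v) = C + t² H(t)`, then the first derivative of the metric along `a` vanishes
at `0`, and the second one is `2 H(0)`. -/
theorem derivatives_of_taylor {g : E → E →L[ℝ] E →L[ℝ] ℝ} (hg : ContDiffAt ℝ ∞ g 0) (a u v : E)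
    {C : ℝ} {H : ℝ → ℝ} (hH : ContDiffAt ℝ 2 H 0)
    (h : ∀ᶠ t in 𝓝 (0 : ℝ), g (t • a) u v = C + t ^ 2 * H t) :
    fderiv ℝ g 0 a u v = 0 ∧ fderiv ℝ (fderiv ℝ g) 0 a a u v = 2 * H 0 := by
  have hline : ∀ t : ℝ, HasDerivAt (fun t : ℝ => t • a) a t := fun t => by
    simpa using (hasDerivAt_id t).smul_const a
  have htend : Tendsto (fun t : ℝ => t • a) (𝓝 0) (𝓝 0) := by
    simpa using (hline 0).continuousAt.tendsto
  have h1 : ∀ᶠ t in 𝓝 (0 : ℝ), HasDerivAt (fun t : ℝ => g (t • a) u v)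
      (fderiv ℝ g (t • a) a u v) t := by
    have : ∀ᶠ x in 𝓝 (0 : E), ContDiffAt ℝ 1 g x :=
      (hg.of_le (m := 1) (by norm_cast)).eventually (by simp)
    filter_upwards [htend.eventually this] with t ht
    have d := HasFDerivAt.comp_hasDerivAt t
      (ht.differentiableAt (by simp)).hasFDerivAt (hline t)
    have := (d.clm_apply (hasDerivAt_const t u)).clm_apply (hasDerivAt_const t v)
    simpa using this
  have h2 : HasDerivAt (fun t : ℝ => fderiv ℝ g (t • a) a u v)
      (fderiv ℝ (fderiv ℝ g) 0 a a u v) 0 := by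
    have hB : DifferentiableAt ℝ (fderiv ℝ g) ((0 : ℝ) • a) := by
      rw [zero_smul]
      exact (hg.fderiv_right (m := 1) (by norm_cast)).differentiableAt (by simp)
    have d := hB.hasFDerivAt.comp_hasDerivAt (0 : ℝ) (hline 0)
    have := ((d.clm_apply (hasDerivAt_const 0 a)).clm_apply (hasDerivAt_const 0 u)).clm_apply
      (hasDerivAt_const 0 v)
    simpa using this
  have hH1 : ∀ᶠ t in 𝓝 (0 : ℝ), HasDerivAt H (deriv H t) t := by
    filter_upwards [hH.eventually (by simp)] with t ht
    exact (ht.differentiableAt (by simp)).hasDerivAt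
  have h3 : ∀ᶠ t in 𝓝 (0 : ℝ), fderiv ℝ g (t • a) a u v = t * (2 * H t + t * deriv H t) := by
    filter_upwards [h1, hH1, h.eventually_nhds] with t t1 t2 t3
    have d := (((hasDerivAt_id t).pow 2).mul t2).const_add C
    have e := t1.unique (d.congr_of_eventuallyEq t3)
    rw [e]
    simp
    ring
  have hHd : ContinuousAt (deriv H) 0 := by
    have := (ContDiffAt.fderiv_right (m := 1) hH (by norm_num)).continuousAt
    exact (this.clm_apply (continuousAt_const (y := (1 : ℝ))))
  have h4 : HasDerivAt (fun t : ℝ => t * (2 * H t + t * deriv H t)) (2 * H 0) 0 := by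
    rw [hasDerivAt_iff_tendsto_slope]
    have hc : Tendsto (fun t : ℝ => 2 * H t + t * deriv H t) (𝓝 0) (𝓝 (2 * H 0)) := by
      have : ContinuousAt (fun t : ℝ => 2 * H t + t * deriv H t) 0 :=
        (continuousAt_const.mul hH.continuousAt).add (continuousAt_id.mul hHd)
      simpa using this.tendsto
    refine (hc.mono_left nhdsWithin_le_nhds).congr' ?_
    filter_upwards [self_mem_nhdsWithin] with t ht
    have ht : t ≠ 0 := ht
    simp [slope_def_field]
    field_simp
  refine ⟨by simpa using h3.self_of_nhds, ?_⟩
  exact h2.unique (h4.congr_of_eventuallyEq h3)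

end Curvature

/-! ### The metric of `𝔼(κ, τ)` in twisted coordinates and its curvature -/

section RotatingMetric

/-- The first coordinate of `ℝ × ℝ × ℝ`. -/
noncomputable def coordX : ℝ × ℝ × ℝ →L[ℝ] ℝ := ContinuousLinearMap.fst ℝ ℝ (ℝ × ℝ)

/-- The second coordinate of `ℝ × ℝ × ℝ`. -/
noncomputable def coordY : ℝ × ℝ × ℝ →L[ℝ] ℝ :=
  (ContinuousLinearMap.fst ℝ ℝ ℝ).comp (ContinuousLinearMap.snd ℝ ℝ (ℝ × ℝ))

/-- The third coordinate of `ℝ × ℝ × ℝ`. -/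
noncomputable def coordZ : ℝ × ℝ × ℝ →L[ℝ] ℝ :=
  (ContinuousLinearMap.snd ℝ ℝ ℝ).comp (ContinuousLinearMap.snd ℝ ℝ (ℝ × ℝ))

@[simp] theorem coordX_apply (p : ℝ × ℝ × ℝ) : coordX p = p.1 := rfl
@[simp] theorem coordY_apply (p : ℝ × ℝ × ℝ) : coordY p = p.2.1 := rfl
@[simp] theorem coordZ_apply (p : ℝ × ℝ × ℝ) : coordZ p = p.2.2 := rfl

/-- The tensor square of a covector. -/
noncomputable def covectorSq {E : Type*} [NormedAddCommGroup E] [NormedSpace ℝ E]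
    (α : E →L[ℝ] ℝ) : E →L[ℝ] E →L[ℝ] ℝ := α.smulRight α

@[simp] theorem covectorSq_apply {E : Type*} [NormedAddCommGroup E] [NormedSpace ℝ E]
    (α : E →L[ℝ] ℝ) (u v : E) : covectorSq α u v = α u * α v := rfl

/-- The metric of `𝔼(κ, τ)` in the coordinates `(W, z)` in which the point `(w, z)` of the Cartan
model is `w = exp(iτz) W`. The first derivatives of this metric vanish at the origin. -/
noncomputable def rotMetric (κ τ : ℝ) (p : ℝ × ℝ × ℝ) : ℝ × ℝ × ℝ →L[ℝ] ℝ × ℝ × ℝ →L[ℝ] ℝ :=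
  conformalFactor κ p.1 p.2.1 ^ 2 • (covectorSq (coordX - (τ * p.2.1) • coordZ)
    + covectorSq (coordY + (τ * p.1) • coordZ))
  + covectorSq ((1 - conformalFactor κ p.1 p.2.1 * τ ^ 2 * (p.1 ^ 2 + p.2.1 ^ 2)) • coordZ
    + (conformalFactor κ p.1 p.2.1 * τ) • (p.2.1 • coordX - p.1 • coordY))

theorem rotMetric_apply (κ τ : ℝ) (p u v : ℝ × ℝ × ℝ) : rotMetric κ τ p u v =
    conformalFactor κ p.1 p.2.1 ^ 2 * ((u.1 - τ * p.2.1 * u.2.2) * (v.1 - τ * p.2.1 * v.2.2)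
      + (u.2.1 + τ * p.1 * u.2.2) * (v.2.1 + τ * p.1 * v.2.2))
    + ((1 - conformalFactor κ p.1 p.2.1 * τ ^ 2 * (p.1 ^ 2 + p.2.1 ^ 2)) * u.2.2
        + conformalFactor κ p.1 p.2.1 * τ * (p.2.1 * u.1 - p.1 * u.2.1))
      * ((1 - conformalFactor κ p.1 p.2.1 * τ ^ 2 * (p.1 ^ 2 + p.2.1 ^ 2)) * v.2.2
        + conformalFactor κ p.1 p.2.1 * τ * (p.2.1 * v.1 - p.1 * v.2.1)) := by
  simp [rotMetric]
  ring

theorem rotMetric_comm (κ τ : ℝ) (p u v : ℝ × ℝ × ℝ) :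
    rotMetric κ τ p u v = rotMetric κ τ p v u := by
  simp only [rotMetric_apply]; ring

theorem rotMetric_zero (κ τ : ℝ) (u v : ℝ × ℝ × ℝ) :
    rotMetric κ τ 0 u v = u.1 * v.1 + u.2.1 * v.2.1 + u.2.2 * v.2.2 := by
  simp [rotMetric_apply, conformalFactor]

theorem rotMetric_zero_coercive (κ τ : ℝ) (u : ℝ × ℝ × ℝ) :
    1 * ‖u‖ ^ 2 ≤ rotMetric κ τ 0 u u := by
  rw [rotMetric_zero, one_mul]
  have h : ‖u‖ = max |u.1| (max |u.2.1| |u.2.2|) := rfl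
  have h1 := sq_abs u.1
  have h2 := sq_abs u.2.1
  have h3 := sq_abs u.2.2
  rw [h]
  rcases max_choice |u.1| (max |u.2.1| |u.2.2|) with e | e
  · rw [e]; nlinarith [sq_nonneg u.2.1, sq_nonneg u.2.2]
  · rw [e]
    rcases max_choice |u.2.1| |u.2.2| with e | e
    · rw [e]; nlinarith [sq_nonneg u.1, sq_nonneg u.2.2]
    · rw [e]; nlinarith [sq_nonneg u.1, sq_nonneg u.2.1]

theorem contDiffAt_conformalFactor {κ : ℝ} {p : ℝ × ℝ × ℝ}
    (hp : 1 + κ / 4 * (p.1 ^ 2 + p.2.1 ^ 2) ≠ 0) :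
    ContDiffAt ℝ ∞ (fun p : ℝ × ℝ × ℝ => conformalFactor κ p.1 p.2.1) p := by
  unfold conformalFactor
  exact contDiffAt_const.div (by fun_prop) hp

theorem contDiffAt_covectorSq {E F : Type*} [NormedAddCommGroup E] [NormedSpace ℝ E]
    [NormedAddCommGroup F] [NormedSpace ℝ F] {α : F → E →L[ℝ] ℝ} {p : F}
    (h : ContDiffAt ℝ ∞ α p) : ContDiffAt ℝ ∞ (fun q => covectorSq (α q)) p :=
  h.smulRight h

theorem contDiffAt_rotMetric {κ τ : ℝ} {p : ℝ × ℝ × ℝ}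
    (hp : 1 + κ / 4 * (p.1 ^ 2 + p.2.1 ^ 2) ≠ 0) :
    ContDiffAt ℝ ∞ (rotMetric κ τ) p := by
  have h := contDiffAt_conformalFactor hp
  unfold rotMetric
  refine ((h.pow 2).smul ((contDiffAt_covectorSq ?_).add (contDiffAt_covectorSq ?_))).add
    (contDiffAt_covectorSq ?_)
  · fun_prop
  · fun_prop
  · fun_prop

/-- Taylor expansion of the metric along a ray from the origin. -/
theorem rotMetric_derivatives (κ τ : ℝ) (a u v : ℝ × ℝ × ℝ) :
    fderiv ℝ (rotMetric κ τ) 0 a u v = 0 ∧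
    fderiv ℝ (fderiv ℝ (rotMetric κ τ)) 0 a a u v =
      2 * (-(κ / 2) * (a.1 ^ 2 + a.2.1 ^ 2) * (u.1 * v.1 + u.2.1 * v.2.1)
        - τ ^ 2 * (a.1 ^ 2 + a.2.1 ^ 2) * u.2.2 * v.2.2
        + τ ^ 2 * (a.2.1 * u.1 - a.1 * u.2.1) * (a.2.1 * v.1 - a.1 * v.2.1)) := by
  set ρ := a.1 ^ 2 + a.2.1 ^ 2 with hρ
  set l : ℝ → ℝ := fun t => 1 / (1 + κ / 4 * (t ^ 2 * ρ)) with hl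
  set A := a.2.1 * u.1 - a.1 * u.2.1 with hA
  set B := a.2.1 * v.1 - a.1 * v.2.1 with hB
  set H : ℝ → ℝ := fun t =>
    -(l t * κ / 4 * ρ) * (1 + l t) * (u.1 * v.1 + u.2.1 * v.2.1)
    + τ * t * l t * (l t * κ / 4 * ρ) * (u.2.2 * B + v.2.2 * A)
    + l t ^ 2 * τ ^ 2 * ρ * u.2.2 * v.2.2
    + u.2.2 * v.2.2 * (-2 * l t * τ ^ 2 * ρ + l t ^ 2 * τ ^ 4 * t ^ 2 * ρ ^ 2)
    - l t * τ ^ 2 * ρ * (l t * τ * t) * (u.2.2 * B + v.2.2 * A)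
    + l t ^ 2 * τ ^ 2 * A * B with hH
  have hlc : ContDiffAt ℝ 2 l 0 := by
    refine contDiffAt_const.div (by fun_prop) (by simp)
  have hHc : ContDiffAt ℝ 2 H 0 := by fun_prop
  have hne : ∀ᶠ t in 𝓝 (0 : ℝ), 1 + κ / 4 * (t ^ 2 * ρ) ≠ 0 := by
    have : ContinuousAt (fun t : ℝ => 1 + κ / 4 * (t ^ 2 * ρ)) 0 := by fun_prop
    exact this.eventually_ne (by simp)
  have hg : ContDiffAt ℝ ∞ (rotMetric κ τ) 0 := contDiffAt_rotMetric (by simp)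
  have key := derivatives_of_taylor hg a u v hHc
    (C := u.1 * v.1 + u.2.1 * v.2.1 + u.2.2 * v.2.2) ?_
  · refine ⟨key.1, key.2.trans ?_⟩
    simp [hH, hl]
    ring
  · filter_upwards [hne] with t ht
    have e : conformalFactor κ (t • a).1 (t • a).2.1 = l t := by
      simp only [conformalFactor, hl, Prod.smul_fst, Prod.smul_snd, smul_eq_mul, hρ]
      congr 2; ring
    have hl1 : l t * (1 + κ / 4 * (t ^ 2 * ρ)) = 1 := by
      simp only [hl]; exact one_div_mul_cancel ht
    rw [rotMetric_apply, e]
    simp only [hH, Prod.smul_fst, Prod.smul_snd, smul_eq_mul]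
    generalize l t = m at hl1
    rw [hA, hB]
    rw [hρ] at hl1 ⊢
    have hm : m * κ / 4 * (a.1 ^ 2 + a.2.1 ^ 2) * t ^ 2 = 1 - m := by linarith
    linear_combination ((1 + m) * (u.1 * v.1 + u.2.1 * v.2.1) - τ * t * m *
      (u.2.2 * (a.2.1 * v.1 - a.1 * v.2.1) + v.2.2 * (a.2.1 * u.1 - a.1 * u.2.1))) * hm

theorem fderiv_rotMetric_zero (κ τ : ℝ) : fderiv ℝ (rotMetric κ τ) 0 = 0 := by
  refine ContinuousLinearMap.ext fun a => ContinuousLinearMap.ext fun u =>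
    ContinuousLinearMap.ext fun v => ?_
  exact (rotMetric_derivatives κ τ a u v).1

/-- The curvature of `𝔼(κ, τ)`: a plane with unit normal `n` has sectional curvature
`τ² + (κ - 4τ²) ⟨n, ξ⟩²`. -/
theorem curvatureForm_rotMetric (κ τ : ℝ) (a b : ℝ × ℝ × ℝ) :
    curvatureForm (rotMetric κ τ) a b =
      -2 * ((κ - 4 * τ ^ 2) * (a.1 * b.2.1 - a.2.1 * b.1) ^ 2
        + τ ^ 2 * ((a.1 ^ 2 + a.2.1 ^ 2 + a.2.2 ^ 2) * (b.1 ^ 2 + b.2.1 ^ 2 + b.2.2 ^ 2)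
          - (a.1 * b.1 + a.2.1 * b.2.1 + a.2.2 * b.2.2) ^ 2)) := by
  rw [curvatureForm_eq (contDiffAt_rotMetric (by simp))]
  simp only [(rotMetric_derivatives κ τ _ _ _).2, Prod.fst_add, Prod.snd_add]
  ring

/-- Local isometries of `𝔼(κ, τ)`, `κ ≠ 4τ²`, preserve the vertical direction: the planes that
contain it are those of sectional curvature `τ²`. -/
theorem fderiv_vertical_of_local_isometry {κ τ : ℝ} (hκτ : κ - 4 * τ ^ 2 ≠ 0)
    {f : ℝ × ℝ × ℝ → ℝ × ℝ × ℝ} (hf : ContDiffAt ℝ ∞ f 0)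
    (h : ∀ᶠ x in 𝓝 0, ∀ u v,
      rotMetric κ τ (f x) (fderiv ℝ f x u) (fderiv ℝ f x v) = rotMetric κ τ x u v)
    (hfx : f 0 = 0) :
    fderiv ℝ f 0 (0, 0, 1) = (0, 0, 1) ∨ fderiv ℝ f 0 (0, 0, 1) = (0, 0, -1) := by
  have h0 := h.self_of_nhds
  simp only [hfx, rotMetric_zero] at h0
  have hinj : Function.Injective (fderiv ℝ f 0) := by
    rw [injective_iff_map_eq_zero]
    intro a ha
    have := h0 a a
    rw [ha] at this
    simp at this
    have e1 : a.1 = 0 := by nlinarith [sq_nonneg a.1, sq_nonneg a.2.1, sq_nonneg a.2.2]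
    have e2 : a.2.1 = 0 := by nlinarith [sq_nonneg a.1, sq_nonneg a.2.1, sq_nonneg a.2.2]
    have e3 : a.2.2 = 0 := by nlinarith [sq_nonneg a.1, sq_nonneg a.2.1, sq_nonneg a.2.2]
    exact Prod.ext e1 (Prod.ext e2 e3)
  have hsurj : Function.Surjective (fderiv ℝ f 0) :=
    (LinearMap.injective_iff_surjective (f := (fderiv ℝ f 0).toLinearMap)).1 hinj
  have hR := curvatureForm_local_isometry (contDiffAt_rotMetric (by simp))
    (Eventually.of_forall fun y => rotMetric_comm κ τ y) one_pos (rotMetric_zero_coercive κ τ)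
    hf h hfx (fderiv_rotMetric_zero κ τ) hsurj
  simp only [curvatureForm_rotMetric] at hR
  set n := fderiv ℝ f 0 (0, 0, 1) with hn
  have hD : ∀ b : ℝ × ℝ × ℝ, n.1 * b.2.1 - n.2.1 * b.1 = 0 := by
    intro b
    obtain ⟨c, rfl⟩ := hsurj b
    have r := hR (0, 0, 1) c
    have g1 := h0 (0, 0, 1) (0, 0, 1)
    have g2 := h0 (0, 0, 1) c
    have g3 := h0 c c
    rw [← hn] at r g1 g2
    set d := fderiv ℝ f 0 c
    simp only [zero_mul, zero_add, sub_self, mul_one, one_mul] at g1 g2 r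
    have e1 : n.1 ^ 2 + n.2.1 ^ 2 + n.2.2 ^ 2 = 1 := by linarith
    have e3 : d.1 ^ 2 + d.2.1 ^ 2 + d.2.2 ^ 2 = c.1 ^ 2 + c.2.1 ^ 2 + c.2.2 ^ 2 := by linarith
    rw [e1, e3, g2] at r
    have : (κ - 4 * τ ^ 2) * (n.1 * d.2.1 - n.2.1 * d.1) ^ 2 = 0 := by linarith
    exact pow_eq_zero_iff two_ne_zero |>.1 ((mul_eq_zero.1 this).resolve_left hκτ)
  have n1 : n.1 = 0 := by simpa using hD (0, 1, 0)
  have n2 : n.2.1 = 0 := by simpa using hD (1, 0, 0)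
  have g1 := h0 (0, 0, 1) (0, 0, 1)
  rw [← hn, n1, n2] at g1
  simp at g1
  rcases mul_self_eq_one_iff.1 g1 with e | e
  · exact Or.inl (Prod.ext n1 (Prod.ext n2 e))
  · exact Or.inr (Prod.ext n1 (Prod.ext n2 e))

end RotatingMetric

/-! ### Isometries, stabilizers and homomorphisms into finite groups -/

section Isometries

/-- A smooth curve in an open set with prescribed initial point and velocity. -/
theorem exists_smooth_curve_of_isOpen {E : Type*} [NormedAddCommGroup E] [NormedSpace ℝ E]
    {s : Set E} (hs : IsOpen s) {x : E} (hx : x ∈ s) (u : E) :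
    ∃ k : ℝ → E, ContDiff ℝ ∞ k ∧ k 0 = x ∧ HasDerivAt k u 0 ∧ ∀ t, k t ∈ s := by
  obtain ⟨r, hr, hball⟩ := Metric.isOpen_iff.1 hs x hx
  set ε := r / (‖u‖ + 1) with hε
  have hε0 : 0 < ε := by positivity
  -- The bounded reparametrization `ε sin(t/ε)` of the line keeps the curve in the ball.
  refine ⟨fun t => x + (ε * Real.sin (t / ε)) • u, by fun_prop, by simp, ?_, fun t => hball ?_⟩
  · have h1 : HasDerivAt (fun t : ℝ => ε * Real.sin (t / ε)) 1 0 := by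
      have := ((hasDerivAt_id (0 : ℝ)).div_const ε).sin.const_mul ε
      simpa [hε0.ne'] using this
    simpa using (h1.smul_const u).const_add x
  · rw [mem_ball_iff_norm, add_sub_cancel_left, norm_smul]
    have : ‖ε * Real.sin (t / ε)‖ ≤ ε := by
      rw [norm_mul, Real.norm_of_nonneg hε0.le, Real.norm_eq_abs]
      exact mul_le_of_le_one_right hε0.le (Real.abs_sin_le_one _)
    calc _ ≤ ε * ‖u‖ := by gcongr
      _ < ε * (‖u‖ + 1) := by gcongr; linarith
      _ = r := by rw [hε]; field_simp

namespace IsSmoothMap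

variable {V W : Type} [NormedAddCommGroup V] [NormedSpace ℝ V] [NormedAddCommGroup W]
  [NormedSpace ℝ W] {A : Set V} {f : A → W}

theorem continuous (hf : IsSmoothMap A f) : Continuous f := by
  rw [continuous_iff_continuousAt]
  intro p
  obtain ⟨U, hU, hp, F, hF, hFf⟩ := hf p
  have h1 : ContinuousAt (fun q : A => F q) p :=
    (hF.continuousOn.continuousAt (hU.mem_nhds hp)).comp continuous_subtype_val.continuousAt
  refine h1.congr ?_
  filter_upwards [continuous_subtype_val.continuousAt (hU.mem_nhds hp)] with q hq
  exact hFf q hq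

theorem contDiff_comp (hf : IsSmoothMap A f) {c : ℝ → A} (hc : ContDiff ℝ ∞ fun t => (c t : V)) :
    ContDiff ℝ ∞ fun t => f (c t) := by
  rw [contDiff_iff_contDiffAt]
  intro t
  obtain ⟨U, hU, hp, F, hF, hFf⟩ := hf (c t)
  have h1 : ContDiffAt ℝ ∞ (fun s => F (c s)) t :=
    ContDiffAt.comp t (hF.contDiffAt (hU.mem_nhds hp)) hc.contDiffAt
  refine h1.congr_of_eventuallyEq ?_
  filter_upwards [hc.continuous.continuousAt (hU.mem_nhds hp)] with s hs
  exact (hFf _ hs).symm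

theorem comp {φ ψ : A → A} (hφ : IsSmoothMap A fun p => (φ p : V))
    (hψ : IsSmoothMap A fun p => (ψ p : V)) : IsSmoothMap A fun p => (φ (ψ p) : V) := by
  intro p
  obtain ⟨U, hU, hp, F, hF, hFf⟩ := hψ p
  obtain ⟨U', hU', hp', F', hF', hFf'⟩ := hφ (ψ p)
  refine ⟨U ∩ F ⁻¹' U', hF.continuousOn.isOpen_inter_preimage hU hU', ⟨hp, ?_⟩, F' ∘ F,
    hF'.comp (hF.mono Set.inter_subset_left) fun x hx => hx.2, ?_⟩
  · simpa [hFf p hp] using hp'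
  · rintro q ⟨hq, hq'⟩
    have e := hFf q hq
    rw [Set.mem_preimage, e] at hq'
    simp [e, hFf' _ hq']

end IsSmoothMap

namespace SpaceData

variable {M : SpaceData}

theorem IsIsometry.one : M.IsIsometry 1 where
  smooth _ := ⟨Set.univ, isOpen_univ, trivial, id, contDiffOn_id, fun _ _ => rfl⟩
  smooth_symm _ := ⟨Set.univ, isOpen_univ, trivial, id, contDiffOn_id, fun _ _ => rfl⟩
  metric_eq _ _ _ := rfl

theorem IsIsometry.mul {φ ψ : Equiv.Perm M.carrier} (hφ : M.IsIsometry φ) (hψ : M.IsIsometry ψ) :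
    M.IsIsometry (φ * ψ) where
  smooth := hφ.smooth.comp hψ.smooth
  smooth_symm := hψ.smooth_symm.comp hφ.smooth_symm
  metric_eq c hc t :=
    (hφ.metric_eq (fun s => ψ (c s)) (hψ.smooth.contDiff_comp hc) t).trans (hψ.metric_eq c hc t)

theorem IsIsometry.inv {φ : Equiv.Perm M.carrier} (hφ : M.IsIsometry φ) :
    M.IsIsometry φ⁻¹ where
  smooth := hφ.smooth_symm
  smooth_symm := hφ.smooth
  metric_eq c hc t := by
    have := hφ.metric_eq (fun s => φ⁻¹ (c s)) (hφ.smooth_symm.contDiff_comp hc) t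
    have h : ∀ q, φ (φ⁻¹ q) = q := φ.apply_symm_apply
    simp only [h] at this
    exact this.symm

variable (M) in
/-- The isometries that fix every point of a curve. -/
def pointwiseStabilizer (γ : ℝ → M.carrier) : Subgroup (Equiv.Perm M.carrier) where
  carrier := {φ | M.IsIsometry φ ∧ ∀ s, φ (γ s) = γ s}
  one_mem' := ⟨IsIsometry.one, fun _ => rfl⟩
  mul_mem' := fun ha hb => ⟨ha.1.mul hb.1, fun s => by simp [ha.2, hb.2]⟩
  inv_mem' := fun ha => ⟨ha.1.inv, fun s => (Equiv.symm_apply_eq _).2 (ha.2 s).symm⟩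

end SpaceData

/-- Since `ℝ` is divisible, it has no nontrivial finite quotients. -/
theorem eq_one_of_map_add_of_finite {Q : Type*} [Group Q] [Finite Q] {c : ℝ → Q}
    (h : ∀ s t, c (s + t) = c s * c t) (t : ℝ) : c t = 1 := by
  have h0 : c 0 = 1 := by simpa using h 0 0
  have hn : ∀ (n : ℕ) (s : ℝ), c (n * s) = c s ^ n := by
    intro n s
    induction n with
    | zero => simp [h0]
    | succ n ih => rw [pow_succ, ← ih, ← h]; congr 1; push_cast; ring
  have hpos : (Nat.card Q : ℝ) ≠ 0 := by exact_mod_cast Nat.card_pos.ne'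
  have := hn (Nat.card Q) (t / Nat.card Q)
  rwa [pow_card_eq_one', mul_div_cancel₀ _ hpos] at this

/-- Two homomorphisms `ℝ → H` that agree modulo a finite subgroup normalized by one of them
are equal. -/
theorem eq_of_map_add_of_finite {H : Type*} [Group H] (G : Subgroup H) [Finite G] {S T : ℝ → H}
    (hS : ∀ s t, S (s + t) = S s * S t) (hT : ∀ s t, T (s + t) = T s * T t)
    (hST : ∀ t, (T t)⁻¹ * S t ∈ G) (hconj : ∀ t, ∀ g ∈ G, T t * g * (T t)⁻¹ ∈ G) : S = T := by
  have h0 : T 0 = 1 := by simpa using hT 0 0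
  have hneg : ∀ t, T (-t) = (T t)⁻¹ := fun t => by
    rw [eq_inv_iff_mul_eq_one, ← hT, neg_add_cancel, h0]
  let c : ℝ → Equiv.Perm G := fun t =>
    { toFun := fun g => ⟨T t * g * (T t)⁻¹, hconj t g g.2⟩
      invFun := fun g => ⟨T (-t) * g * (T (-t))⁻¹, hconj (-t) g g.2⟩
      left_inv := fun g => by simp [hneg, mul_assoc]
      right_inv := fun g => by simp [hneg, mul_assoc] }
  have hc : ∀ s t, c (s + t) = c s * c t := fun s t => by
    ext g; simp [c, hT, mul_assoc]
  have hcomm : ∀ t, ∀ g ∈ G, T t * g = g * T t := by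
    intro t g hg
    have e := congrArg (fun σ : Equiv.Perm G => ((σ ⟨g, hg⟩ : G) : H))
      (eq_one_of_map_add_of_finite hc t)
    simpa [c, mul_inv_eq_iff_eq_mul] using e
  let d : ℝ → G := fun t => ⟨(T t)⁻¹ * S t, hST t⟩
  have hd : ∀ s t, d (s + t) = d s * d t := by
    intro s t
    ext
    have e : (T t)⁻¹ * ((T s)⁻¹ * S s) = ((T s)⁻¹ * S s) * (T t)⁻¹ :=
      (show Commute (T t) ((T s)⁻¹ * S s) from hcomm t _ (hST s)).inv_left
    calc (T (s + t))⁻¹ * S (s + t) = ((T t)⁻¹ * ((T s)⁻¹ * S s)) * S t := by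
          rw [hT, hS, mul_inv_rev]; simp only [mul_assoc]
      _ = ((T s)⁻¹ * S s) * ((T t)⁻¹ * S t) := by rw [e]; simp only [mul_assoc]
  funext t
  have e := congrArg (fun g : G => (g : H)) (eq_one_of_map_add_of_finite hd t)
  simpa [d, inv_mul_eq_one, eq_comm] using e

end Isometries

/-! ### Charts, finiteness of the stabilizer and uniqueness -/

section Charts

/-- A chart of `M` centered at `p`, with a smooth left inverse on an open subset of the ambient
space, that is an isometry from an open set with the metric `rotMetric κ τ` and maps the vertical
direction at the origin to that of `M`. -/
structure IsometricChart (M : SpaceData) (κ τ : ℝ) (p : M.V) where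
  toFun : ℝ × ℝ × ℝ → M.V
  invFun : M.V → ℝ × ℝ × ℝ
  source : Set (ℝ × ℝ × ℝ)
  target : Set M.V
  isOpen_source : IsOpen source
  isOpen_target : IsOpen target
  zero_mem : 0 ∈ source
  map_zero : toFun 0 = p
  contDiffOn_toFun : ContDiffOn ℝ ∞ toFun source
  contDiffOn_invFun : ContDiffOn ℝ ∞ invFun target
  map_source : ∀ x ∈ source, toFun x ∈ M.carrier ∧ toFun x ∈ target
  left_inv : ∀ x ∈ source, invFun (toFun x) = x
  map_target : ∀ q ∈ M.carrier, q ∈ target → invFun q ∈ source ∧ toFun (invFun q) = q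
  isometric : ∀ x ∈ source, ∀ u,
    M.metric (toFun x) (fderiv ℝ toFun x u) (fderiv ℝ toFun x u) = rotMetric κ τ x u u
  vertical : ∃ c : ℝ, fderiv ℝ toFun 0 (0, 0, 1) = c • M.killing p

open Classical in
/-- The extension by the identity of a self-map of `M` to the ambient space. -/
noncomputable def ambientExtension {M : SpaceData} (φ : M.carrier → M.carrier) (q : M.V) : M.V :=
  if h : q ∈ M.carrier then φ ⟨q, h⟩ else q

theorem ambientExtension_of_mem {M : SpaceData} (φ : M.carrier → M.carrier) (q : M.carrier) :
    ambientExtension φ q = φ q := by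
  simp [ambientExtension]

namespace IsometricChart

variable {M : SpaceData} {κ τ : ℝ} {p : M.carrier} (C : IsometricChart M κ τ p)

/-- The expression of a self-map of `M` in a chart. -/
noncomputable def localRep (φ : M.carrier → M.carrier) (x : ℝ × ℝ × ℝ) : ℝ × ℝ × ℝ :=
  C.invFun (ambientExtension φ (C.toFun x))

include C in
theorem mem_target : (p : M.V) ∈ C.target := by
  simpa [C.map_zero] using (C.map_source 0 C.zero_mem).2

theorem invFun_center : C.invFun p = 0 := by
  rw [← C.left_inv 0 C.zero_mem, C.map_zero]

theorem continuousAt_toFun : ContinuousAt C.toFun 0 :=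
  (C.contDiffOn_toFun.contDiffAt (C.isOpen_source.mem_nhds C.zero_mem)).continuousAt

theorem contDiffAt_invFun : ContDiffAt ℝ ∞ C.invFun p :=
  C.contDiffOn_invFun.contDiffAt (C.isOpen_target.mem_nhds C.mem_target)

theorem tendsto_invFun : Tendsto (fun q : M.carrier => C.invFun q) (𝓝 p) (𝓝 0) := by
  have h := C.contDiffAt_invFun.continuousAt.comp (x := p) continuous_subtype_val.continuousAt
  rwa [ContinuousAt, Function.comp_apply, C.invFun_center] at h

theorem eventually_mem_target : ∀ᶠ q : M.carrier in 𝓝 p, (q : M.V) ∈ C.target :=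
  continuous_subtype_val.continuousAt (C.isOpen_target.mem_nhds C.mem_target)

variable {φ : Equiv.Perm M.carrier}

/-- A relation between smooth self-maps near `p` holds at `C.toFun x` for `x` near `0`. -/
theorem eventually_toFun {P : M.carrier → Prop} (h : ∀ᶠ q in 𝓝 p, P q) :
    ∀ᶠ x in 𝓝 (0 : ℝ × ℝ × ℝ), ∃ q : M.carrier, (q : M.V) = C.toFun x ∧ P q := by
  obtain ⟨U, hU, hUP⟩ := (mem_nhds_subtype M.carrier p {q | P q}).1 h
  have hU' : U ∈ 𝓝 (C.toFun 0) := by rwa [C.map_zero]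
  filter_upwards [C.continuousAt_toFun hU', C.isOpen_source.mem_nhds C.zero_mem] with x hx hx'
  exact ⟨⟨C.toFun x, (C.map_source x hx').1⟩, rfl, hUP hx⟩

theorem eventually_target_of_fixed {φ : M.carrier → M.carrier}
    (hφ : IsSmoothMap M.carrier fun q => (φ q : M.V)) (hp : φ p = p) :
    ∀ᶠ q in 𝓝 p, (φ q : M.V) ∈ C.target := by
  refine hφ.continuous.continuousAt (C.isOpen_target.mem_nhds ?_)
  rw [hp]; exact C.mem_target

theorem eventually_toFun_localRep {φ : M.carrier → M.carrier}
    (hφ : IsSmoothMap M.carrier fun q => (φ q : M.V)) (hp : φ p = p) :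
    ∀ᶠ x in 𝓝 (0 : ℝ × ℝ × ℝ), C.localRep φ x ∈ C.source ∧
      ∃ q : M.carrier, (q : M.V) = C.toFun x ∧ C.toFun (C.localRep φ x) = φ q := by
  filter_upwards [C.eventually_toFun (C.eventually_target_of_fixed hφ hp)] with x ⟨q, hq, hq'⟩
  have e : C.localRep φ x = C.invFun (φ q) := by
    rw [localRep, ← hq, ambientExtension_of_mem]
  rw [e]
  have := C.map_target _ (φ q).2 hq'
  exact ⟨this.1, q, hq, this.2⟩

theorem localRep_zero {φ : M.carrier → M.carrier} (hp : φ p = p) : C.localRep φ 0 = 0 := by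
  rw [localRep, C.map_zero, ambientExtension_of_mem, hp, C.invFun_center]

theorem contDiffAt_localRep {φ : M.carrier → M.carrier}
    (hφ : IsSmoothMap M.carrier fun q => (φ q : M.V)) (hp : φ p = p) :
    ContDiffAt ℝ ∞ (C.localRep φ) 0 := by
  obtain ⟨U, hU, hpU, F, hF, hFφ⟩ := hφ p
  have hX : ContDiffAt ℝ ∞ C.toFun 0 :=
    C.contDiffOn_toFun.contDiffAt (C.isOpen_source.mem_nhds C.zero_mem)
  have hFX : ContDiffAt ℝ ∞ (fun x => F (C.toFun x)) 0 := by
    refine ContDiffAt.comp 0 ?_ hX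
    rw [C.map_zero]
    exact hF.contDiffAt (hU.mem_nhds hpU)
  have h1 : ContDiffAt ℝ ∞ (fun x => C.invFun (F (C.toFun x))) 0 := by
    refine ContDiffAt.comp 0 ?_ hFX
    rw [C.map_zero, hFφ p hpU]
    simp only [hp]
    exact C.contDiffAt_invFun
  refine h1.congr_of_eventuallyEq ?_
  have h2 : ∀ᶠ q : M.carrier in 𝓝 p, (q : M.V) ∈ U :=
    continuous_subtype_val.continuousAt (hU.mem_nhds hpU)
  filter_upwards [C.eventually_toFun h2] with x ⟨q, hq, hq'⟩
  rw [localRep, ← hq, ambientExtension_of_mem, hFφ q hq']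

theorem localRep_isometry (hφ : M.IsIsometry φ) (hp : φ p = p) :
    ∀ᶠ x in 𝓝 (0 : ℝ × ℝ × ℝ), ∀ u v, rotMetric κ τ (C.localRep φ x)
      (fderiv ℝ (C.localRep φ) x u) (fderiv ℝ (C.localRep φ) x v) = rotMetric κ τ x u v := by
  have hf : ∀ᶠ x in 𝓝 (0 : ℝ × ℝ × ℝ), ContDiffAt ℝ 1 (C.localRep φ) x :=
    ((C.contDiffAt_localRep hφ.smooth hp).of_le (m := 1) (by norm_cast)).eventually (by simp)
  filter_upwards [(C.eventually_toFun_localRep hφ.smooth hp).eventually_nhds, hf,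
    C.isOpen_source.mem_nhds C.zero_mem] with x hx hfx hxs
  have hfd : HasFDerivAt (C.localRep φ) (fderiv ℝ (C.localRep φ) x) x :=
    (hfx.differentiableAt (by simp)).hasFDerivAt
  have hXd : ∀ y ∈ C.source, HasFDerivAt C.toFun (fderiv ℝ C.toFun y) y := fun y hy =>
    ((C.contDiffOn_toFun.contDiffAt (C.isOpen_source.mem_nhds hy)).differentiableAt
      (by simp)).hasFDerivAt
  have hdiag : ∀ u, rotMetric κ τ (C.localRep φ x)
      (fderiv ℝ (C.localRep φ) x u) (fderiv ℝ (C.localRep φ) x u) = rotMetric κ τ x u u := by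
    intro u
    obtain ⟨k, hk, hk0, hkd, hks⟩ := exists_smooth_curve_of_isOpen C.isOpen_source hxs u
    let c : ℝ → M.carrier := fun t => ⟨C.toFun (k t), (C.map_source _ (hks t)).1⟩
    have hc : M.IsSmoothCurve c := by
      refine contDiff_iff_contDiffAt.2 fun t => ?_
      exact ContDiffAt.comp (g := C.toFun) (f := k) t
        (C.contDiffOn_toFun.contDiffAt (C.isOpen_source.mem_nhds (hks t))) hk.contDiffAt
    have hv : M.velocity c 0 = fderiv ℝ C.toFun x u := by
      refine HasDerivAt.deriv (HasFDerivAt.comp_hasDerivAt (f := k) (l := C.toFun) 0 ?_ hkd)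
      rw [hk0]; exact hXd x hxs
    have hkt : Tendsto k (𝓝 0) (𝓝 x) := by simpa [hk0] using hk.continuous.tendsto 0
    have hev : ∀ᶠ t in 𝓝 (0 : ℝ), (φ (c t) : M.V) = C.toFun (C.localRep φ (k t)) := by
      filter_upwards [hkt.eventually hx] with t ⟨_, q, hq, hq'⟩
      have : c t = q := Subtype.ext hq.symm
      rw [this, hq']
    have hv' : M.velocity (fun t => φ (c t)) 0
        = fderiv ℝ C.toFun (C.localRep φ x) (fderiv ℝ (C.localRep φ) x u) := by
      refine HasDerivAt.deriv (HasDerivAt.congr_of_eventuallyEq ?_ hev)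
      refine HasFDerivAt.comp_hasDerivAt (f := fun t => C.localRep φ (k t)) (l := C.toFun) 0 ?_ ?_
      · rw [hk0]; exact hXd _ hx.self_of_nhds.1
      · refine HasFDerivAt.comp_hasDerivAt (f := k) (l := C.localRep φ) 0 ?_ hkd
        rw [hk0]; exact hfd
    have e := hφ.metric_eq c hc 0
    rw [hv, hv'] at e
    have e0 : (φ (c 0) : M.V) = C.toFun (C.localRep φ x) := by
      have := hev.self_of_nhds; rwa [hk0] at this
    have e1 : (c 0 : M.V) = C.toFun x := by simp [c, hk0]
    rw [e0, e1, C.isometric _ hxs, C.isometric _ hx.self_of_nhds.1] at e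
    exact e
  intro u v
  have a1 := hdiag u
  have a2 := hdiag v
  have a3 := hdiag (u + v)
  simp only [map_add, add_apply] at a3
  rw [rotMetric_comm κ τ x v u, rotMetric_comm κ τ _ (fderiv ℝ (C.localRep φ) x v)] at a3
  linarith

theorem eventually_eq_of_fderiv_eq_one (hφ : M.IsIsometry φ) (hp : φ p = p)
    (h1 : fderiv ℝ (C.localRep φ) 0 = 1) : ∀ᶠ q in 𝓝 p, φ q = q := by
  have h := eventually_eq_of_local_isometry (contDiffAt_rotMetric (κ := κ) (τ := τ) (by simp))
    (Eventually.of_forall fun y => rotMetric_comm κ τ y) one_pos (rotMetric_zero_coercive κ τ)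
    (C.contDiffAt_localRep hφ.smooth hp) (C.localRep_isometry hφ hp) (C.localRep_zero hp) h1
  filter_upwards [C.tendsto_invFun.eventually h, C.eventually_mem_target,
    C.eventually_target_of_fixed hφ.smooth hp] with q hq hq1 hq2
  have e1 := (C.map_target q q.2 hq1).2
  rw [localRep, e1, ambientExtension_of_mem] at hq
  have e2 := (C.map_target _ (φ q).2 hq2).2
  exact Subtype.ext (by rw [← e2, hq, e1])

theorem localRep_comp {φ ψ : M.carrier → M.carrier}
    (hψ : IsSmoothMap M.carrier fun q => (ψ q : M.V)) (hp : ψ p = p) :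
    C.localRep (φ ∘ ψ) =ᶠ[𝓝 0] C.localRep φ ∘ C.localRep ψ := by
  filter_upwards [C.eventually_toFun_localRep hψ hp] with x ⟨_, q, hq, hq'⟩
  rw [Function.comp_apply, localRep, localRep, hq', ← hq, ambientExtension_of_mem,
    ambientExtension_of_mem]
  rfl

theorem fderiv_localRep_comp {φ ψ : M.carrier → M.carrier}
    (hφ : IsSmoothMap M.carrier fun q => (φ q : M.V)) (hpφ : φ p = p)
    (hψ : IsSmoothMap M.carrier fun q => (ψ q : M.V)) (hp : ψ p = p) :
    fderiv ℝ (C.localRep (φ ∘ ψ)) 0 =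
      (fderiv ℝ (C.localRep φ) 0).comp (fderiv ℝ (C.localRep ψ) 0) := by
  rw [(C.localRep_comp hψ hp).fderiv_eq, fderiv_comp, C.localRep_zero hp]
  · rw [C.localRep_zero hp]
    exact (C.contDiffAt_localRep hφ hpφ).differentiableAt (by simp)
  · exact (C.contDiffAt_localRep hψ hp).differentiableAt (by simp)

end IsometricChart

/-- An isometry that is the identity near one point is the identity: the interior of its set of
fixed points is open and closed. -/
theorem isometry_eq_one_of_eventually_eq {M : SpaceData} {κ τ : ℝ} [PreconnectedSpace M.carrier]
    (hchart : ∀ p : M.carrier, Nonempty (IsometricChart M κ τ p)) {φ : Equiv.Perm M.carrier}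
    (hφ : M.IsIsometry φ) {p : M.carrier} (hp : ∀ᶠ q in 𝓝 p, φ q = q) : φ = 1 := by
  set N : Set M.carrier := {m | ∀ᶠ q in 𝓝 m, φ q = q} with hN
  have hopen : IsOpen N := isOpen_setOfPred_eventually_nhds
  have hcont : Continuous φ :=
    Continuous.subtype_mk hφ.smooth.continuous fun q => (φ q).2
  have hclosed : IsClosed N := by
    refine isClosed_of_closure_subset fun m hm => ?_
    have hfix : φ m = m := by
      have h1 : IsClosed {q | φ q = q} := isClosed_eq hcont continuous_id
      exact h1.closure_subset_iff.2 (fun q hq => Eventually.self_of_nhds hq) hm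
    obtain ⟨C⟩ := hchart m
    refine C.eventually_eq_of_fderiv_eq_one hφ hfix ?_
    have hZ : ∃ᶠ x in 𝓝 (0 : ℝ × ℝ × ℝ), fderiv ℝ (C.localRep φ) x = 1 := by
      refine C.tendsto_invFun.frequently ?_
      refine ((mem_closure_iff_frequently.1 hm).and_eventually C.eventually_mem_target).mono ?_
      rintro q ⟨hq, hqt⟩
      obtain ⟨hs, hX⟩ := C.map_target q q.2 hqt
      have e : C.localRep φ =ᶠ[𝓝 (C.invFun q)] id := by
        obtain ⟨U, hU, hUP⟩ := (mem_nhds_subtype M.carrier q _).1 hq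
        have hXc : ContinuousAt C.toFun (C.invFun q) :=
          (C.contDiffOn_toFun.contDiffAt (C.isOpen_source.mem_nhds hs)).continuousAt
        have hU' : U ∈ 𝓝 (C.toFun (C.invFun q)) := by rwa [hX]
        filter_upwards [hXc hU', C.isOpen_source.mem_nhds hs] with x hx hxs
        have hm := hUP (show (⟨C.toFun x, (C.map_source x hxs).1⟩ : M.carrier) ∈ _ from hx)
        have e := ambientExtension_of_mem φ ⟨C.toFun x, (C.map_source x hxs).1⟩
        rw [hm] at e
        rw [IsometricChart.localRep, e]
        exact C.left_inv x hxs
      rw [e.fderiv_eq, fderiv_id]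
      rfl
    have hfc : ContinuousAt (fderiv ℝ (C.localRep φ)) 0 :=
      ((C.contDiffAt_localRep hφ.smooth hfix).fderiv_right (m := 1) (by norm_cast)).continuousAt
    exact isClosed_singleton.mem_of_frequently_of_tendsto hZ hfc.tendsto
  have huniv : N = Set.univ := IsClopen.eq_univ ⟨hclosed, hopen⟩ ⟨p, hp⟩
  refine Equiv.ext fun q => ?_
  have h : ∀ᶠ q' in 𝓝 q, φ q' = q' := (huniv ▸ Set.mem_univ q : q ∈ N)
  exact h.self_of_nhds

/-- A linear isometry of Euclidean space that fixes `±e₃` up to sign and a vector `(a, b, c)` with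
horizontal part `(a, b) ≠ 0` maps `(-b, a, 0)` to itself up to sign. -/
theorem map_orthogonal_of_isometry {L : ℝ × ℝ × ℝ →L[ℝ] ℝ × ℝ × ℝ}
    (hL : ∀ u v, (L u).1 * (L v).1 + (L u).2.1 * (L v).2.1 + (L u).2.2 * (L v).2.2
      = u.1 * v.1 + u.2.1 * v.2.1 + u.2.2 * v.2.2)
    (h3 : L (0, 0, 1) = (0, 0, 1) ∨ L (0, 0, 1) = (0, 0, -1)) {a b c : ℝ}
    (hv : L (a, b, c) = (a, b, c)) (hab : a ^ 2 + b ^ 2 ≠ 0) :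
    L (-b, a, 0) = (-b, a, 0) ∨ L (-b, a, 0) = (b, -a, 0) := by
  set n := L (-b, a, 0) with hn
  have g1 := hL (0, 0, 1) (-b, a, 0)
  have g2 := hL (a, b, c) (-b, a, 0)
  have g3 := hL (-b, a, 0) (-b, a, 0)
  rw [← hn] at g1 g2 g3
  have n3 : n.2.2 = 0 := by
    rcases h3 with h | h <;> rw [h] at g1 <;> simp at g1 <;> exact g1
  rw [hv, n3] at g2
  rw [n3] at g3
  simp only [mul_zero, add_zero] at g2 g3
  have g2' : a * n.1 + b * n.2.1 = 0 := by linarith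
  set k := (-b * n.1 + a * n.2.1) / (a ^ 2 + b ^ 2) with hk
  have n1 : n.1 = -b * k := by
    rw [hk]; field_simp; linear_combination a * g2'
  have n2 : n.2.1 = a * k := by
    rw [hk]; field_simp; linear_combination b * g2'
  rw [n1, n2] at g3
  have hk2 : k * k = 1 := by
    have : (a ^ 2 + b ^ 2) * (k * k - 1) = 0 := by linear_combination g3
    have := (mul_eq_zero.1 this).resolve_left hab
    linarith
  rcases mul_self_eq_one_iff.1 hk2 with e | e
  · left
    exact Prod.ext (by rw [n1, e]; simp) (Prod.ext (by rw [n2, e]; simp) n3)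
  · right
    exact Prod.ext (by rw [n1, e]; simp) (Prod.ext (by rw [n2, e]; simp) n3)

theorem clm_eq_of_eq_on_frame {L L' : ℝ × ℝ × ℝ →L[ℝ] ℝ × ℝ × ℝ} {a b c : ℝ}
    (hab : a ^ 2 + b ^ 2 ≠ 0) (h1 : L (a, b, c) = L' (a, b, c))
    (h2 : L (-b, a, 0) = L' (-b, a, 0)) (h3 : L (0, 0, 1) = L' (0, 0, 1)) : L = L' := by
  refine ContinuousLinearMap.ext fun u => ?_
  have e : u = ((a * u.1 + b * u.2.1) / (a ^ 2 + b ^ 2)) • ((a, b, c) : ℝ × ℝ × ℝ)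
      + ((-b * u.1 + a * u.2.1) / (a ^ 2 + b ^ 2)) • ((-b, a, 0) : ℝ × ℝ × ℝ)
      + (u.2.2 - (a * u.1 + b * u.2.1) / (a ^ 2 + b ^ 2) * c) • ((0, 0, 1) : ℝ × ℝ × ℝ) := by
    refine Prod.ext ?_ (Prod.ext ?_ ?_)
    · simp; field_simp; ring
    · simp; field_simp; ring
    · simp
  rw [e]
  simp only [map_add, map_smul, h1, h2, h3]

/-- The group of isometries that fix a curve pointwise is finite if the curve has a non-vertical
velocity vector: the differential at such a point is determined by two signs. -/
theorem finite_pointwiseStabilizer {M : SpaceData} {κ τ : ℝ} (hκτ : κ - 4 * τ ^ 2 ≠ 0)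
    [PreconnectedSpace M.carrier]
    (hchart : ∀ p : M.carrier, Nonempty (IsometricChart M κ τ p))
    {γ : ℝ → M.carrier} (hγ : M.IsSmoothCurve γ) {t₀ : ℝ}
    (hnv : ∀ a : ℝ, M.velocity γ t₀ ≠ a • M.killing (γ t₀)) :
    Finite (M.pointwiseStabilizer γ) := by
  obtain ⟨C⟩ := hchart (γ t₀)
  have hγd : HasDerivAt (fun t => (γ t : M.V)) (M.velocity γ t₀) t₀ :=
    (hγ.differentiable (by simp) t₀).hasDerivAt
  have hYd : HasFDerivAt C.invFun (fderiv ℝ C.invFun (γ t₀)) (γ t₀) :=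
    (C.contDiffAt_invFun.differentiableAt (by simp)).hasFDerivAt
  set y : ℝ → ℝ × ℝ × ℝ := fun t => C.invFun (γ t) with hy
  set v := fderiv ℝ C.invFun (γ t₀) (M.velocity γ t₀) with hv
  have hyd : HasDerivAt y v t₀ := hYd.comp_hasDerivAt t₀ hγd
  have hy0 : y t₀ = 0 := C.invFun_center
  have hγc : ∀ᶠ t in 𝓝 t₀, (γ t : M.V) ∈ C.target :=
    hγ.continuous.continuousAt (C.isOpen_target.mem_nhds C.mem_target)
  have hXv : M.velocity γ t₀ = fderiv ℝ C.toFun 0 v := by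
    have h1 : HasFDerivAt C.toFun (fderiv ℝ C.toFun 0) (y t₀) := by
      rw [hy0]
      exact ((C.contDiffOn_toFun.contDiffAt
        (C.isOpen_source.mem_nhds C.zero_mem)).differentiableAt (by simp)).hasFDerivAt
    refine hγd.unique ((h1.comp_hasDerivAt t₀ hyd).congr_of_eventuallyEq ?_)
    filter_upwards [hγc] with t ht
    exact (C.map_target _ (γ t).2 ht).2.symm
  obtain ⟨a, b, c, hvabc⟩ : ∃ a b c, v = (a, b, c) := ⟨v.1, v.2.1, v.2.2, rfl⟩
  have hab : a ^ 2 + b ^ 2 ≠ 0 := by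
    intro h0
    have ha : a = 0 := by nlinarith [sq_nonneg a, sq_nonneg b]
    have hb : b = 0 := by nlinarith [sq_nonneg a, sq_nonneg b]
    obtain ⟨d, hd⟩ := C.vertical
    refine hnv (c * d) ?_
    have e : v = c • ((0, 0, 1) : ℝ × ℝ × ℝ) := by rw [hvabc, ha, hb]; simp
    rw [hXv, e, map_smul, hd, smul_smul]
  set D : Equiv.Perm M.carrier → ℝ × ℝ × ℝ →L[ℝ] ℝ × ℝ × ℝ :=
    fun φ => fderiv ℝ (C.localRep φ) 0 with hD
  have hDv : ∀ φ ∈ M.pointwiseStabilizer γ, D φ v = v := by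
    intro φ hφ
    have h1 : HasFDerivAt (C.localRep φ) (D φ) (y t₀) := by
      rw [hy0]
      exact ((C.contDiffAt_localRep hφ.1.smooth (hφ.2 t₀)).differentiableAt (by simp)).hasFDerivAt
    refine ((h1.comp_hasDerivAt t₀ hyd).congr_of_eventuallyEq ?_).unique hyd
    filter_upwards [hγc] with t ht
    rw [Function.comp_apply, IsometricChart.localRep, hy, (C.map_target _ (γ t).2 ht).2,
      ambientExtension_of_mem, hφ.2]
  have hDisom : ∀ φ ∈ M.pointwiseStabilizer γ, ∀ u v, (D φ u).1 * (D φ v).1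
      + (D φ u).2.1 * (D φ v).2.1 + (D φ u).2.2 * (D φ v).2.2
      = u.1 * v.1 + u.2.1 * v.2.1 + u.2.2 * v.2.2 := by
    intro φ hφ u v
    have := (C.localRep_isometry hφ.1 (hφ.2 t₀)).self_of_nhds u v
    rwa [C.localRep_zero (hφ.2 t₀), rotMetric_zero, rotMetric_zero] at this
  have hD3 : ∀ φ ∈ M.pointwiseStabilizer γ,
      D φ (0, 0, 1) = (0, 0, 1) ∨ D φ (0, 0, 1) = (0, 0, -1) := fun φ hφ =>
    fderiv_vertical_of_local_isometry hκτ (C.contDiffAt_localRep hφ.1.smooth (hφ.2 t₀))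
      (C.localRep_isometry hφ.1 (hφ.2 t₀)) (C.localRep_zero (hφ.2 t₀))
  have hDn : ∀ φ ∈ M.pointwiseStabilizer γ,
      D φ (-b, a, 0) = (-b, a, 0) ∨ D φ (-b, a, 0) = (b, -a, 0) := fun φ hφ =>
    map_orthogonal_of_isometry (hDisom φ hφ) (hD3 φ hφ) (hvabc ▸ hDv φ hφ) hab
  have hDid : fderiv ℝ (C.localRep id) 0 = 1 := by
    have : C.localRep id =ᶠ[𝓝 0] id := by
      filter_upwards [C.isOpen_source.mem_nhds C.zero_mem] with x hx
      have e := ambientExtension_of_mem id ⟨C.toFun x, (C.map_source x hx).1⟩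
      rw [IsometricChart.localRep, e]
      exact C.left_inv x hx
    rw [this.fderiv_eq, fderiv_id]; rfl
  let A : Set (ℝ × ℝ × ℝ) := {(0, 0, 1), (0, 0, -1)}
  let B : Set (ℝ × ℝ × ℝ) := {(-b, a, 0), (b, -a, 0)}
  let F : M.pointwiseStabilizer γ → A × B := fun φ =>
    (⟨D φ (0, 0, 1), hD3 φ φ.2⟩, ⟨D φ (-b, a, 0), hDn φ φ.2⟩)
  refine Finite.of_injective F fun φ ψ h => ?_
  have h1 : D φ (0, 0, 1) = D ψ (0, 0, 1) := congrArg (fun x : A × B => (x.1 : ℝ × ℝ × ℝ)) h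
  have h2 : D φ (-b, a, 0) = D ψ (-b, a, 0) := congrArg (fun x : A × B => (x.2 : ℝ × ℝ × ℝ)) h
  have hDφψ : D φ = D ψ := by
    refine clm_eq_of_eq_on_frame hab (c := c) ?_ h2 h1
    rw [← hvabc, hDv φ φ.2, hDv ψ ψ.2]
  have hmem := (ψ⁻¹ * φ).2
  have hinv := (ψ⁻¹).2
  have hcomp : ∀ χ : M.pointwiseStabilizer γ, fderiv ℝ (C.localRep ((ψ⁻¹ * χ : _) : Equiv.Perm _)) 0
      = (fderiv ℝ (C.localRep ((ψ⁻¹ : M.pointwiseStabilizer γ) : Equiv.Perm _)) 0).comp (D χ) :=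
    fun χ => C.fderiv_localRep_comp hinv.1.smooth (hinv.2 t₀) χ.2.1.smooth (χ.2.2 t₀)
  have hone : fderiv ℝ (C.localRep ((ψ⁻¹ * φ : M.pointwiseStabilizer γ) : Equiv.Perm _)) 0 = 1 := by
    rw [hcomp, hDφψ, ← hcomp, inv_mul_cancel]
    exact hDid
  have := isometry_eq_one_of_eventually_eq hchart hmem.1
    (C.eventually_eq_of_fderiv_eq_one hmem.1 (hmem.2 t₀) hone)
  have h3 : ψ⁻¹ * φ = 1 := Subtype.ext this
  exact (inv_mul_eq_one.1 h3).symm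

/-- Two homomorphisms from `ℝ` to the isometry group that translate the same non-vertical curve
along itself are equal. -/
theorem isometryHom_unique {M : SpaceData} {κ τ : ℝ} (hκτ : κ - 4 * τ ^ 2 ≠ 0)
    [PreconnectedSpace M.carrier]
    (hchart : ∀ p : M.carrier, Nonempty (IsometricChart M κ τ p))
    {γ : ℝ → M.carrier} (hγ : M.IsSmoothCurve γ) (hnv : ¬ M.IsVertical γ)
    {S T : ℝ → Equiv.Perm M.carrier} (hS : M.IsIsometryHom S) (hT : M.IsIsometryHom T)
    (hSγ : ∀ t s, S t (γ s) = γ (t + s)) (hTγ : ∀ t s, T t (γ s) = γ (t + s)) : S = T := by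
  have hnv' : ∃ t₀, ∀ a : ℝ, M.velocity γ t₀ ≠ a • M.killing (γ t₀) := by
    simpa [SpaceData.IsVertical] using hnv
  obtain ⟨t₀, ht₀⟩ := hnv'
  have := finite_pointwiseStabilizer hκτ hchart hγ ht₀
  have hinv : ∀ t s, (T t)⁻¹ (γ s) = γ (s - t) := fun t s =>
    (Equiv.symm_apply_eq _).2 (by rw [hTγ]; congr 1; ring)
  refine eq_of_map_add_of_finite (M.pointwiseStabilizer γ) hS.map_add hT.map_add
    (fun t => ⟨(hT.isometry t).inv.mul (hS.isometry t), fun s => ?_⟩)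
    (fun t g hg => ⟨((hT.isometry t).mul hg.1).mul (hT.isometry t).inv, fun s => ?_⟩)
  · rw [Equiv.Perm.mul_apply, hSγ, hinv]; congr 1; ring
  · rw [Equiv.Perm.mul_apply, Equiv.Perm.mul_apply, hinv, hg.2, hTγ]; congr 1; ring

end Charts

/-! ### Flows by isometries, and geodesics of `𝕊²(κ) × ℝ` -/

section Flows

/-- A smooth flow on a neighborhood of `M` that preserves `M` and its metric restricts to a
`1`-parameter group of isometries of `M`. -/
theorem exists_oneParameterGroup_of_flow {M : SpaceData} {Φ : ℝ → M.V → M.V} {U : Set M.V}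
    (hU : IsOpen U) (hMU : M.carrier ⊆ U)
    (hsm : ContDiffOn ℝ ∞ (fun x : ℝ × M.V => Φ x.1 x.2) (Set.univ ×ˢ U))
    (hmap : ∀ t, ∀ p ∈ M.carrier, Φ t p ∈ M.carrier)
    (h0 : ∀ p ∈ M.carrier, Φ 0 p = p)
    (hadd : ∀ s t, ∀ p ∈ M.carrier, Φ (s + t) p = Φ s (Φ t p))
    (hmet : ∀ t, ∀ c : ℝ → M.V, ContDiff ℝ ∞ c → (∀ s, c s ∈ M.carrier) → ∀ s, ∃ v',
      HasDerivAt (fun s => Φ t (c s)) v' s ∧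
        M.metric (Φ t (c s)) v' v' = M.metric (c s) (deriv c s) (deriv c s)) :
    ∃ T : ℝ → Equiv.Perm M.carrier, M.IsOneParameterGroup T ∧
      ∀ t (p : M.carrier), (T t p : M.V) = Φ t p := by
  let T : ℝ → Equiv.Perm M.carrier := fun t =>
    { toFun := fun p => ⟨Φ t p, hmap t p p.2⟩
      invFun := fun p => ⟨Φ (-t) p, hmap (-t) p p.2⟩
      left_inv := fun p => Subtype.ext <| by
        change Φ (-t) (Φ t p) = p
        rw [← hadd _ _ _ p.2, neg_add_cancel, h0 _ p.2]
      right_inv := fun p => Subtype.ext <| by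
        change Φ t (Φ (-t) p) = p
        rw [← hadd _ _ _ p.2, add_neg_cancel, h0 _ p.2] }
  have hslice : ∀ t, IsSmoothMap M.carrier (fun p => (Φ t p : M.V)) := by
    intro t p
    refine ⟨U, hU, hMU p.2, Φ t, ?_, fun _ _ => rfl⟩
    exact hsm.comp (contDiffOn_const.prodMk contDiffOn_id) fun x hx => ⟨trivial, hx⟩
  refine ⟨T, ⟨⟨fun t => ⟨hslice t, hslice (-t), fun c hc s => ?_⟩, fun s t => ?_⟩, fun x => ?_⟩,
    fun t p => rfl⟩
  · obtain ⟨v', h1, h2⟩ := hmet t (fun s => c s) hc (fun s => (c s).2) s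
    rw [← h1.deriv] at h2
    exact h2
  · exact Equiv.ext fun p => Subtype.ext (hadd s t p p.2)
  · exact ⟨Set.univ ×ˢ U, isOpen_univ.prod hU, ⟨trivial, hMU x.2.2⟩, _, hsm, fun _ _ => rfl⟩

variable {V : Type*} [NormedAddCommGroup V] [NormedSpace ℝ V] [CompleteSpace V]

theorem hasDerivAt_exp_flow (A : V →L[ℝ] V) (x : V) (t : ℝ) :
    HasDerivAt (fun s : ℝ => NormedSpace.exp (s • A) x) (A (NormedSpace.exp (t • A) x)) t := by
  have h := (hasDerivAt_exp_smul_const' (𝕂 := ℝ) A t).clm_apply (hasDerivAt_const t x)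
  simpa using h

theorem exp_flow_add (A : V →L[ℝ] V) (s t : ℝ) (x : V) :
    NormedSpace.exp ((s + t) • A) x = NormedSpace.exp (s • A) (NormedSpace.exp (t • A) x) := by
  let : NormedAlgebra ℚ (V →L[ℝ] V) := NormedAlgebra.restrictScalars ℚ ℝ _
  rw [add_smul, NormedSpace.exp_add_of_commute]
  · rfl
  · exact ((Commute.refl A).smul_left s).smul_right t

theorem contDiff_exp_flow (A : V →L[ℝ] V) :
    ContDiff ℝ ∞ fun x : ℝ × V => NormedSpace.exp (x.1 • A) x.2 := by
  have h : ContDiff ℝ ∞ (NormedSpace.exp : (V →L[ℝ] V) → V →L[ℝ] V) :=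
    contDiff_iff_contDiffAt.2 fun x => (NormedSpace.exp_analytic (𝕂 := ℝ) x).contDiffAt
  exact (h.comp (contDiff_fst.smul contDiff_const)).clm_apply contDiff_snd

/-- Solutions of `c' = A c` are orbits of the flow `exp(tA)`. -/
theorem eq_exp_flow_of_hasDerivAt {A : V →L[ℝ] V} {c : ℝ → V}
    (hc : ∀ t, HasDerivAt c (A (c t)) t) (t s : ℝ) :
    c (t + s) = NormedSpace.exp (t • A) (c s) := by
  have key : ∀ t, HasDerivAt (fun t => NormedSpace.exp ((-t) • A) (c (t + s))) 0 t := by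
    intro t
    have h1 := (hasDerivAt_exp_smul_const (𝕂 := ℝ) A (-t)).scomp t (hasDerivAt_neg t)
    have h2 := h1.clm_apply ((hc (t + s)).comp_add_const t s)
    simpa using h2
  have hconst := is_const_of_deriv_eq_zero (fun t => (key t).differentiableAt)
    (fun t => (key t).deriv) t 0
  simp only [neg_zero, zero_smul, NormedSpace.exp_zero, zero_add] at hconst
  rw [one_apply_eq_self] at hconst
  rw [← hconst, ← exp_flow_add, add_neg_cancel, zero_smul, NormedSpace.exp_zero]
  rfl

/-- The flow of an endomorphism that is skew for a bilinear form preserves this form. -/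
theorem exp_flow_preserves {A : V →L[ℝ] V} (B : V →L[ℝ] V →L[ℝ] ℝ)
    (hA : ∀ x y, B (A x) y + B x (A y) = 0) (t : ℝ) (x y : V) :
    B (NormedSpace.exp (t • A) x) (NormedSpace.exp (t • A) y) = B x y := by
  have key : ∀ t, HasDerivAt
      (fun t : ℝ => B (NormedSpace.exp (t • A) x) (NormedSpace.exp (t • A) y)) 0 t := by
    intro t
    have h := ((hasDerivAt_const t B).clm_apply (hasDerivAt_exp_flow A x t)).clm_apply
      (hasDerivAt_exp_flow A y t)
    simpa [hA] using h
  have hconst := is_const_of_deriv_eq_zero (fun t => (key t).differentiableAt)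
    (fun t => (key t).deriv) t 0
  simpa using hconst

end Flows

section SphereProduct

/-- The plane of the first three coordinates. -/
local notation "E3" => EuclideanSpace ℝ (Fin 3)

/-- The skew endomorphism `x ↦ k (⟨c, x⟩ w - ⟨w, x⟩ c)`. -/
noncomputable def skewEndo {H : Type*} [NormedAddCommGroup H] [InnerProductSpace ℝ H] (k : ℝ)
    (c w : H) : H →L[ℝ] H :=
  k • ((innerSL ℝ c).smulRight w - (innerSL ℝ w).smulRight c)

theorem skewEndo_apply {H : Type*} [NormedAddCommGroup H] [InnerProductSpace ℝ H] (k : ℝ)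
    (c w x : H) : skewEndo k c w x = k • (inner ℝ c x • w - inner ℝ w x • c) := by
  simp [skewEndo]

theorem skewEndo_skew {H : Type*} [NormedAddCommGroup H] [InnerProductSpace ℝ H] (k : ℝ)
    (c w x y : H) : innerSL ℝ (skewEndo k c w x) y + innerSL ℝ x (skewEndo k c w y) = 0 := by
  simp only [innerSL_apply_apply, skewEndo_apply, inner_smul_left, inner_smul_right,
    inner_sub_left, inner_sub_right, real_inner_comm c x, real_inner_comm w x]
  simp
  ring

theorem norm_sq_exp_skewEndo {H : Type*} [NormedAddCommGroup H] [InnerProductSpace ℝ H]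
    [CompleteSpace H] (k : ℝ) (c w x : H) (t : ℝ) :
    ‖NormedSpace.exp (t • skewEndo k c w) x‖ ^ 2 = ‖x‖ ^ 2 := by
  have h := exp_flow_preserves (innerSL ℝ) (skewEndo_skew k c w) t x x
  rwa [innerSL_apply_apply, innerSL_apply_apply, real_inner_self_eq_norm_sq,
    real_inner_self_eq_norm_sq] at h

variable {κ : ℝ}

theorem sphereProduct_isTangent (hκ : 0 < κ) {p : E3 × ℝ} (hp : p ∈ (sphereProduct κ).carrier)
    (w : E3 × ℝ)
    (hw : inner ℝ p.1 w.1 = 0) : (sphereProduct κ).IsTangent ⟨p, hp⟩ w := by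
  have hp' : ‖p.1‖ ^ 2 = 1 / κ := hp
  set A := skewEndo κ p.1 w.1 with hA
  let f : ℝ → E3 × ℝ := fun t => (NormedSpace.exp (t • A) p.1, p.2 + t * w.2)
  let c : ℝ → (sphereProduct κ).carrier :=
    fun t => ⟨f t, (norm_sq_exp_skewEndo κ _ _ _ t).trans hp'⟩
  have hf : ContDiff ℝ ∞ f :=
    ((contDiff_exp_flow A).comp (contDiff_id.prodMk contDiff_const)).prodMk (by fun_prop)
  refine ⟨c, hf, ?_, ?_⟩
  · refine Subtype.ext (Prod.ext ?_ ?_)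
    · simp [c, f]
    · simp [c, f]
  · have h1 : HasDerivAt f (A p.1, w.2) 0 := by
      refine HasDerivAt.prodMk ?_ ?_
      · simpa using hasDerivAt_exp_flow A p.1 0
      · simpa using ((hasDerivAt_id (0 : ℝ)).mul_const w.2).const_add p.2
    have h2 : A p.1 = w.1 := by
      rw [hA, skewEndo_apply, real_inner_self_eq_norm_sq, hp', real_inner_comm, hw]
      rw [zero_smul, sub_zero, smul_smul, mul_one_div_cancel hκ.ne', one_smul]
    rw [h2] at h1
    exact h1.deriv

/-- Every geodesic of `𝕊²(κ) × ℝ` is an orbit of the product of a group of rotations of the sphere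
and a group of translations. The angular momentum `c ∧ c'` is conserved. -/
theorem sphereProduct_exists_oneParameterGroup (hκ : 0 < κ) {γ : ℝ → (sphereProduct κ).carrier}
    (hγ : (sphereProduct κ).IsGeodesic γ) :
    ∃ T : ℝ → Equiv.Perm (sphereProduct κ).carrier, (sphereProduct κ).IsOneParameterGroup T ∧
      ∀ t s, T t (γ s) = γ (t + s) := by
  obtain ⟨hsm, hgeo⟩ := hγ
  let f : ℝ → E3 × ℝ := fun t => (γ t).1
  have hf : ContDiff ℝ ∞ f := hsm
  set c : ℝ → E3 := fun t => (f t).1 with hc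
  set h : ℝ → ℝ := fun t => (f t).2 with hh
  have hcs : ContDiff ℝ ∞ c := hf.fst
  have hhs : ContDiff ℝ ∞ h := hf.snd
  have hc1 : ∀ t, HasDerivAt c (deriv c t) t := fun t =>
    (hcs.differentiable (by simp) t).hasDerivAt
  have hh1 : ∀ t, HasDerivAt h (deriv h t) t := fun t =>
    (hhs.differentiable (by simp) t).hasDerivAt
  have hc2 : ∀ t, HasDerivAt (deriv c) (deriv (deriv c) t) t := fun t =>
    (((contDiff_infty_iff_deriv.1 hcs).2).differentiable (by simp) t).hasDerivAt
  have hh2 : ∀ t, HasDerivAt (deriv h) (deriv (deriv h) t) t := fun t =>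
    (((contDiff_infty_iff_deriv.1 hhs).2).differentiable (by simp) t).hasDerivAt
  have hvel : ∀ t, (sphereProduct κ).velocity γ t = (deriv c t, deriv h t) := fun t =>
    ((hc1 t).prodMk (hh1 t)).deriv
  have hnorm : ∀ t, inner ℝ (c t) (c t) = 1 / κ := fun t =>
    (real_inner_self_eq_norm_sq _).trans (γ t).2
  have horth : ∀ t, inner ℝ (c t) (deriv c t) = 0 := by
    intro t
    have h1 := (hc1 t).inner ℝ (hc1 t)
    have h2 := h1.unique ((hasDerivAt_const t (1 / κ)).congr_of_eventuallyEq
      (Eventually.of_forall hnorm))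
    rw [real_inner_comm (c t)] at h2
    linarith
  have hEL : ∀ t (w : E3 × ℝ), inner ℝ (c t) w.1 = 0 →
      inner ℝ (deriv (deriv c) t) w.1 + deriv (deriv h) t * w.2 = 0 := by
    intro t w hw
    have e := hgeo t w (sphereProduct_isTangent hκ (γ t).2 w hw)
    have e1 : (fun s => (sphereProduct κ).metric (γ s) ((sphereProduct κ).velocity γ s) w)
        = fun s => inner ℝ (deriv c s) w.1 + deriv h s * w.2 := by
      funext s; rw [hvel]; rfl
    have e2 : HasDerivAt (fun s => inner ℝ (deriv c s) w.1 + deriv h s * w.2)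
        (inner ℝ (deriv (deriv c) t) w.1 + deriv (deriv h) t * w.2) t := by
      have := ((hc2 t).inner ℝ (hasDerivAt_const t w.1)).fun_add ((hh2 t).mul_const w.2)
      simpa using this
    have e3 : fderiv ℝ (fun p => (sphereProduct κ).metric p ((sphereProduct κ).velocity γ t)
        ((sphereProduct κ).velocity γ t)) (γ t) = 0 := fderiv_const_apply _
    rw [e1, e2.deriv, e3] at e
    exact e.trans (mul_zero _)
  have hacc : ∀ t, deriv (deriv c) t = (κ * inner ℝ (c t) (deriv (deriv c) t)) • c t := by
    intro t
    set a := deriv (deriv c) t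
    have hw : inner ℝ (c t) (a - (κ * inner ℝ (c t) a) • c t) = 0 := by
      rw [inner_sub_right, inner_smul_right, hnorm, mul_comm κ, mul_assoc,
        mul_one_div_cancel hκ.ne', mul_one, sub_self]
    have e := hEL t (a - (κ * inner ℝ (c t) a) • c t, 0) hw
    simp only [mul_zero, add_zero] at e
    have e2 : inner ℝ (a - (κ * inner ℝ (c t) a) • c t) (a - (κ * inner ℝ (c t) a) • c t)
        = (0 : ℝ) := by
      rw [inner_sub_left, e, inner_smul_left, hw]; simp
    exact sub_eq_zero.1 (inner_self_eq_zero.1 e2)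
  have hh0 : ∀ t, deriv (deriv h) t = 0 := fun t => by
    have := hEL t (0, 1) (by simp)
    simpa using this
  have hhb : ∀ t, deriv h t = deriv h 0 := fun t =>
    is_const_of_deriv_eq_zero (fun t => (hh2 t).differentiableAt) hh0 t 0
  set b := deriv h 0
  set A := skewEndo κ (c 0) (deriv c 0) with hA
  have hAconst : ∀ t x, skewEndo κ (c t) (deriv c t) x = A x := by
    intro t x
    have key : ∀ t, HasDerivAt (fun t => skewEndo κ (c t) (deriv c t) x) 0 t := by
      intro t
      simp only [skewEndo_apply]
      have d1 := ((hc1 t).inner ℝ (hasDerivAt_const t x)).fun_smul (hc2 t)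
      have d2 := ((hc2 t).inner ℝ (hasDerivAt_const t x)).fun_smul (hc1 t)
      have d := (d1.fun_sub d2).fun_const_smul κ
      refine d.congr_deriv ?_
      rw [hacc t]
      simp [inner_smul_left, smul_smul]
      right
      module
    exact is_const_of_deriv_eq_zero (fun t => (key t).differentiableAt) (fun t => (key t).deriv) t 0
  have hcA : ∀ t, HasDerivAt c (A (c t)) t := by
    intro t
    refine (hc1 t).congr_deriv ?_
    rw [← hAconst t, skewEndo_apply, hnorm, real_inner_comm, horth]
    symm
    rw [zero_smul, sub_zero, smul_smul, mul_one_div_cancel hκ.ne', one_smul]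
  have hhs : ∀ t s, h (t + s) = h s + t * b := by
    intro t s
    have key : ∀ t, HasDerivAt (fun t => h (t + s) - t * b) 0 t := by
      intro t
      have := ((hh1 (t + s)).comp_add_const t s).fun_sub ((hasDerivAt_id t).mul_const b)
      rw [hhb] at this
      simpa using this
    have := is_const_of_deriv_eq_zero (fun t => (key t).differentiableAt)
      (fun t => (key t).deriv) t 0
    simp at this
    linarith
  let Φ : ℝ → E3 × ℝ → E3 × ℝ := fun t p => (NormedSpace.exp (t • A) p.1, p.2 + t * b)
  obtain ⟨T, hT, hTΦ⟩ := exists_oneParameterGroup_of_flow (M := sphereProduct κ) (Φ := Φ)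
    (U := Set.univ) isOpen_univ (Set.subset_univ _)
    (by
      have h1 : ContDiff ℝ ∞ fun x : ℝ × (E3 × ℝ) => Φ x.1 x.2 :=
        ((contDiff_exp_flow A).comp (contDiff_fst.prodMk (contDiff_fst.comp contDiff_snd))).prodMk
          (by fun_prop)
      exact h1.contDiffOn)
    (fun t p hp => (norm_sq_exp_skewEndo κ _ _ _ t).trans hp)
    (fun p _ => Prod.ext (by simp [Φ]) (by simp [Φ]))
    (fun s t p _ => Prod.ext (exp_flow_add A s t p.1) (by simp [Φ]; ring))
    (by
      intro t (k : ℝ → E3 × ℝ) hk _ s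
      have d1 : HasDerivAt (fun s => (k s).1) (deriv (fun s => (k s).1) s) s :=
        (hk.fst.differentiable (by simp) s).hasDerivAt
      have d2 : HasDerivAt (fun s => (k s).2) (deriv (fun s => (k s).2) s) s :=
        (hk.snd.differentiable (by simp) s).hasDerivAt
      have v : deriv k s = (deriv (fun s => (k s).1) s, deriv (fun s => (k s).2) s) :=
        (d1.prodMk d2).deriv
      refine ⟨_, (((NormedSpace.exp (t • A)).hasFDerivAt).comp_hasDerivAt s d1).prodMk
        (d2.add_const _), ?_⟩
      have e := exp_flow_preserves (innerSL ℝ) (skewEndo_skew κ (c 0) (deriv c 0)) t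
        (deriv (fun s => (k s).1) s) (deriv (fun s => (k s).1) s)
      have e' := congrArg (· + deriv (fun s => (k s).2) s * deriv (fun s => (k s).2) s) e
      refine Eq.trans e' ?_
      exact (congrArg (fun v : E3 × ℝ => inner ℝ v.1 v.1 + v.2 * v.2) v).symm)
  refine ⟨T, hT, fun t s => Subtype.ext ((hTΦ t (γ s)).trans ?_)⟩
  exact Prod.ext (eq_exp_flow_of_hasDerivAt hcA t s).symm (hhs t s).symm

end SphereProduct

/-! ### Charts of `𝕊²(κ) × ℝ` -/

theorem hasFDerivAt_conformalFactor {κ : ℝ} {p : ℝ × ℝ × ℝ}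
    (hp : 1 + κ / 4 * (p.1 ^ 2 + p.2.1 ^ 2) ≠ 0) :
    HasFDerivAt (fun p : ℝ × ℝ × ℝ => conformalFactor κ p.1 p.2.1)
      (-(conformalFactor κ p.1 p.2.1 ^ 2 * (κ / 2)) • (p.1 • coordX + p.2.1 • coordY)) p := by
  have hx : HasFDerivAt (fun p : ℝ × ℝ × ℝ => p.1) coordX p := coordX.hasFDerivAt
  have hy : HasFDerivAt (fun p : ℝ × ℝ × ℝ => p.2.1) coordY p := coordY.hasFDerivAt
  have h := ((((hx.pow 2).add (hy.pow 2)).const_mul (κ / 4)).const_add 1)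
  have h2 := (hasDerivAt_inv hp).comp_hasFDerivAt p h
  have e : (fun p : ℝ × ℝ × ℝ => conformalFactor κ p.1 p.2.1) =
      (fun y : ℝ => y⁻¹) ∘ fun p : ℝ × ℝ × ℝ => 1 + κ / 4 * (p.1 ^ 2 + p.2.1 ^ 2) := by
    funext p; simp [conformalFactor]
  rw [e]
  refine h2.congr_fderiv ?_
  ext <;> simp [conformalFactor] <;> ring

theorem conformalFactor_mul {κ x y : ℝ} (h : 1 + κ / 4 * (x ^ 2 + y ^ 2) ≠ 0) :
    conformalFactor κ x y * (1 + κ / 4 * (x ^ 2 + y ^ 2)) = 1 :=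
  one_div_mul_cancel h

section SphereProductCharts

local notation "E3" => EuclideanSpace ℝ (Fin 3)

variable {κ : ℝ}

theorem one_add_pos_of_pos (hκ : 0 < κ) (x y : ℝ) : 0 < 1 + κ / 4 * (x ^ 2 + y ^ 2) := by
  positivity

/-- Completion of a nonzero vector of `ℝ³` to an orthogonal basis with two unit vectors. -/
theorem exists_orthogonal_frame (hκ : 0 < κ) {c : E3} (hc : ‖c‖ ^ 2 = 1 / κ) :
    ∃ e₁ e₂ : E3, inner ℝ e₁ e₁ = (1 : ℝ) ∧ inner ℝ e₂ e₂ = (1 : ℝ) ∧ inner ℝ e₁ e₂ = (0 : ℝ) ∧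
      inner ℝ e₁ c = (0 : ℝ) ∧ inner ℝ e₂ c = (0 : ℝ) ∧
      ∀ q : E3, q = (inner ℝ e₁ q : ℝ) • e₁ + (inner ℝ e₂ q : ℝ) • e₂
        + (κ * inner ℝ c q : ℝ) • c := by
  have hs : √κ * √κ = κ := Real.mul_self_sqrt hκ.le
  have hn : ‖√κ • c‖ = 1 := by
    have : ‖√κ • c‖ ^ 2 = 1 := by
      rw [norm_smul, mul_pow, hc, Real.norm_of_nonneg (Real.sqrt_nonneg _), pow_two, hs,
        mul_one_div_cancel hκ.ne']
    exact (pow_eq_one_iff_of_nonneg (norm_nonneg _) two_ne_zero).1 this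
  have ho : Orthonormal ℝ (Set.domRestrict {(0 : Fin 3)} fun _ => √κ • c) :=
    ⟨fun _ => hn, fun i j hij => (hij (Subsingleton.elim i j)).elim⟩
  obtain ⟨b, hb⟩ := ho.exists_orthonormalBasis_extension_of_card_eq (by simp)
  have hb0 : b 0 = √κ • c := hb 0 rfl
  have hi := orthonormal_iff_ite.1 b.orthonormal
  have hsp : √κ ≠ 0 := (Real.sqrt_pos.2 hκ).ne'
  have hc0 : ∀ q : E3, inner ℝ (b 0) q = √κ * inner ℝ c q := fun q => by
    rw [hb0, inner_smul_left]; simp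
  have hcz : ∀ i, i ≠ 0 → inner ℝ (b i) c = (0 : ℝ) := by
    intro i hi0
    have h1 := hi 0 i
    rw [hc0, if_neg (Ne.symm hi0)] at h1
    rw [real_inner_comm]
    exact (mul_eq_zero.1 h1).resolve_left hsp
  refine ⟨b 1, b 2, by simp, by simp, by simp [hi], hcz 1 (by simp), hcz 2 (by simp),
    fun q => ?_⟩
  have h := b.sum_repr' q
  rw [Fin.sum_univ_three, hc0, hb0, smul_smul] at h
  rw [mul_right_comm, hs] at h
  exact h.symm.trans (by abel)

/-- Inverse stereographic projection times the identity. -/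
theorem sphereProduct_isometricChart (hκ : 0 < κ) (p : (sphereProduct κ).carrier) :
    Nonempty (IsometricChart (sphereProduct κ) κ 0 (p : (sphereProduct κ).V)) := by
  obtain ⟨⟨c, h⟩, (hp : ‖c‖ ^ 2 = 1 / κ)⟩ := p
  obtain ⟨e₁, e₂, h11, h22, h12, h1c, h2c, hexp⟩ := exists_orthogonal_frame hκ hp
  have h21 : inner ℝ e₂ e₁ = (0 : ℝ) := by rw [real_inner_comm, h12]
  have hc1 : inner ℝ c e₁ = (0 : ℝ) := by rw [real_inner_comm, h1c]
  have hc2 : inner ℝ c e₂ = (0 : ℝ) := by rw [real_inner_comm, h2c]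
  have hcc : inner ℝ c c = 1 / κ := by rw [real_inner_self_eq_norm_sq, hp]
  have hsq : ∀ a b d : ℝ, inner ℝ (a • e₁ + b • e₂ + d • c) (a • e₁ + b • e₂ + d • c)
      = a ^ 2 + b ^ 2 + d ^ 2 / κ := by
    intro a b d
    simp only [inner_add_left, inner_add_right, inner_smul_left, inner_smul_right, h11, h22, h12,
      h21, h1c, h2c, hc1, hc2, hcc]
    simp
    ring
  let l : ℝ × ℝ × ℝ → ℝ := fun p => conformalFactor κ p.1 p.2.1
  have hl : ∀ p, l p * (1 + κ / 4 * (p.1 ^ 2 + p.2.1 ^ 2)) = 1 := fun p =>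
    conformalFactor_mul (one_add_pos_of_pos hκ _ _).ne'
  have hlpos : ∀ p, 0 < l p := fun p => one_div_pos.2 (one_add_pos_of_pos hκ _ _)
  let X : ℝ × ℝ × ℝ → E3 × ℝ := fun p =>
    ((l p * p.1) • e₁ + (l p * p.2.1) • e₂ + (2 * l p - 1) • c, h + p.2.2)
  let Y : E3 × ℝ → ℝ × ℝ × ℝ := fun q =>
    (2 * inner ℝ e₁ q.1 / (1 + κ * inner ℝ c q.1), 2 * inner ℝ e₂ q.1 / (1 + κ * inner ℝ c q.1),
      q.2 - h)
  let O : Set (E3 × ℝ) := {q | 1 + κ * inner ℝ c q.1 ≠ 0}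
  have hlc : ContDiff ℝ ∞ l := contDiff_iff_contDiffAt.2 fun p =>
    contDiffAt_conformalFactor (one_add_pos_of_pos hκ _ _).ne'
  have hXc : ContDiff ℝ ∞ X := by
    refine ContDiff.prodMk ?_ (by fun_prop)
    exact (((hlc.mul contDiff_fst).smul contDiff_const).add
      ((hlc.mul (contDiff_fst.comp contDiff_snd)).smul contDiff_const)).add
      (((contDiff_const.mul hlc).sub contDiff_const).smul contDiff_const)
  have hin : ∀ p, inner ℝ e₁ (X p).1 = l p * p.1 ∧ inner ℝ e₂ (X p).1 = l p * p.2.1 ∧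
      κ * inner ℝ c (X p).1 = 2 * l p - 1 := by
    intro p
    simp only [X, inner_add_right, inner_smul_right, h11, h22, h12, h21, h1c, h2c, hc1, hc2, hcc]
    refine ⟨by ring, by ring, by field_simp; ring⟩
  have hO : IsOpen O := by
    have : Continuous fun q : E3 × ℝ => 1 + κ * inner ℝ c q.1 := by fun_prop
    exact isOpen_ne_fun this continuous_const
  have hYc : ContDiffOn ℝ ∞ Y O := by
    refine ContDiffOn.prodMk ?_ (ContDiffOn.prodMk ?_ ?_)
    · exact (contDiff_const.mul (contDiff_const.inner ℝ contDiff_fst)).contDiffOn.div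
        (contDiff_const.add (contDiff_const.mul (contDiff_const.inner ℝ contDiff_fst))).contDiffOn
        fun q hq => hq
    · exact (contDiff_const.mul (contDiff_const.inner ℝ contDiff_fst)).contDiffOn.div
        (contDiff_const.add (contDiff_const.mul (contDiff_const.inner ℝ contDiff_fst))).contDiffOn
        fun q hq => hq
    · fun_prop
  have hXd : ∀ p u, fderiv ℝ X p u =
      (((-(l p ^ 2 * (κ / 2)) * (p.1 * u.1 + p.2.1 * u.2.1)) * p.1 + l p * u.1) • e₁
        + ((-(l p ^ 2 * (κ / 2)) * (p.1 * u.1 + p.2.1 * u.2.1)) * p.2.1 + l p * u.2.1) • e₂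
        + (2 * (-(l p ^ 2 * (κ / 2)) * (p.1 * u.1 + p.2.1 * u.2.1))) • c, u.2.2) := by
    intro p u
    have dl : HasFDerivAt l _ p := hasFDerivAt_conformalFactor (one_add_pos_of_pos hκ _ _).ne'
    have hx : HasFDerivAt (fun p : ℝ × ℝ × ℝ => p.1) coordX p := coordX.hasFDerivAt
    have hy : HasFDerivAt (fun p : ℝ × ℝ × ℝ => p.2.1) coordY p := coordY.hasFDerivAt
    have hz : HasFDerivAt (fun p : ℝ × ℝ × ℝ => p.2.2) coordZ p := coordZ.hasFDerivAt
    have d := (((((dl.mul hx).smul_const e₁).add ((dl.mul hy).smul_const e₂)).add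
      (((dl.const_mul 2).sub_const 1).smul_const c)).prodMk (hz.const_add h))
    have d' : HasFDerivAt X _ p := d
    rw [d'.fderiv]
    refine Prod.ext ?_ ?_
    · simp [l]
      module
    · simp
  refine ⟨{ toFun := X, invFun := Y, source := Set.univ, target := O
            isOpen_source := isOpen_univ, isOpen_target := hO
            zero_mem := trivial
            map_zero := ?_
            contDiffOn_toFun := hXc.contDiffOn
            contDiffOn_invFun := hYc
            map_source := ?_
            left_inv := ?_
            map_target := ?_
            isometric := ?_
            vertical := ?_ }⟩
  · refine Prod.ext ?_ ?_
    · simp [X, l, conformalFactor]; norm_num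
    · simp [X]
  · intro x _
    refine ⟨?_, ?_⟩
    · change ‖(X x).1‖ ^ 2 = 1 / κ
      rw [← real_inner_self_eq_norm_sq, hsq]
      have := hl x
      field_simp
      linear_combination (4 * l x) * this
    · change 1 + κ * inner ℝ c (X x).1 ≠ 0
      rw [(hin x).2.2]
      have := hlpos x
      linarith
  · intro x _
    have hx := (hlpos x).ne'
    refine Prod.ext ?_ (Prod.ext ?_ ?_)
    · simp only [Y, (hin x).1, (hin x).2.2]
      field_simp
      ring
    · simp only [Y, (hin x).2.1, (hin x).2.2]
      field_simp
      ring
    · simp [Y, X]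
  · intro q (hq : ‖q.1‖ ^ 2 = 1 / κ) (hqO : 1 + κ * inner ℝ c q.1 ≠ 0)
    refine ⟨trivial, ?_⟩
    have h1 := hsq (inner ℝ e₁ q.1) (inner ℝ e₂ q.1) (κ * inner ℝ c q.1)
    rw [← hexp q.1, real_inner_self_eq_norm_sq, hq] at h1
    have hlY : l (Y q) = (1 + κ * inner ℝ c q.1) / 2 := by
      have h2 := hl (Y q)
      have h3 : 1 + κ / 4 * ((Y q).1 ^ 2 + (Y q).2.1 ^ 2) = 2 / (1 + κ * inner ℝ c q.1) := by
        simp only [Y]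
        field_simp
        field_simp at h1
        linear_combination (-4 : ℝ) * h1
      rw [h3] at h2
      field_simp at h2
      linarith
    refine Prod.ext ?_ ?_
    · change (l (Y q) * (Y q).1) • e₁ + (l (Y q) * (Y q).2.1) • e₂ + (2 * l (Y q) - 1) • c = q.1
      have x1 : l (Y q) * (Y q).1 = inner ℝ e₁ q.1 := by rw [hlY]; simp only [Y]; field_simp
      have x2 : l (Y q) * (Y q).2.1 = inner ℝ e₂ q.1 := by rw [hlY]; simp only [Y]; field_simp
      have x3 : 2 * l (Y q) - 1 = κ * inner ℝ c q.1 := by rw [hlY]; ring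
      rw [x1, x2, x3]
      exact (hexp q.1).symm
    · simp [X, Y]
  · intro p _ u
    change inner ℝ (fderiv ℝ X p u).1 (fderiv ℝ X p u).1
      + (fderiv ℝ X p u).2 * (fderiv ℝ X p u).2 = _
    rw [hXd, rotMetric_apply, hsq]
    have hlp := hl p
    change _ = l p ^ 2 * _ + _
    generalize l p = g at hlp
    have e : (2 * (-(g ^ 2 * (κ / 2)) * (p.1 * u.1 + p.2.1 * u.2.1))) ^ 2 / κ
        = κ * (g ^ 2 * (p.1 * u.1 + p.2.1 * u.2.1)) ^ 2 := by field_simp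
    rw [e]
    linear_combination (κ * (p.1 * u.1 + p.2.1 * u.2.1) ^ 2 * g ^ 3) * hlp
  · refine ⟨1, ?_⟩
    change fderiv ℝ X 0 (0, 0, 1) = (1 : ℝ) • ((0, 1) : E3 × ℝ)
    rw [hXd]
    refine Prod.ext ?_ ?_
    · simp
    · simp

theorem sphereProduct_preconnectedSpace (hκ : 0 < κ) :
    PreconnectedSpace (sphereProduct κ).carrier := by
  apply isPreconnected_iff_preconnectedSpace.1
  have h1 : IsPreconnected (Metric.sphere (0 : E3) (√(1 / κ)) ×ˢ (Set.univ : Set ℝ)) :=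
    (isPreconnected_sphere (by simp [← Module.finrank_eq_rank]) _ _).prod isPreconnected_univ
  refine (?_ : (sphereProduct κ).carrier = _) ▸ h1
  refine Set.ext fun (q : E3 × ℝ) => ?_
  change ‖q.1‖ ^ 2 = 1 / κ ↔ q.1 ∈ Metric.sphere (0 : E3) (√(1 / κ)) ∧ True
  rw [and_true, mem_sphere_zero_iff_norm, eq_comm (b := √(1 / κ)),
    Real.sqrt_eq_iff_eq_sq (by positivity) (norm_nonneg _), eq_comm]

end SphereProductCharts

/-! ### Geodesics of the Berger spheres -/

section BergerSphere

/-- The real inner product of `ℂ²` as a continuous bilinear form. -/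
noncomputable def planeForm : ℂ × ℂ →L[ℝ] ℂ × ℂ →L[ℝ] ℝ :=
  covectorSq (Complex.reCLM.comp (ContinuousLinearMap.fst ℝ ℂ ℂ))
    + covectorSq (Complex.imCLM.comp (ContinuousLinearMap.fst ℝ ℂ ℂ))
    + covectorSq (Complex.reCLM.comp (ContinuousLinearMap.snd ℝ ℂ ℂ))
    + covectorSq (Complex.imCLM.comp (ContinuousLinearMap.snd ℝ ℂ ℂ))

theorem planeForm_apply (v w : ℂ × ℂ) : planeForm v w =
    v.1.re * w.1.re + v.1.im * w.1.im + v.2.re * w.2.re + v.2.im * w.2.im := by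
  simp [planeForm]

theorem complexPlaneInner_eq (v w : ℂ × ℂ) : complexPlaneInner v w = planeForm v w := by
  simp [planeForm_apply, complexPlaneInner]
  ring

/-- Multiplication by `i` on `ℂ²`. -/
noncomputable def mulI : ℂ × ℂ →L[ℝ] ℂ × ℂ :=
  (ContinuousLinearMap.lsmul ℝ ℂ Complex.I : ℂ × ℂ →L[ℝ] ℂ × ℂ)

theorem mulI_apply (v : ℂ × ℂ) : mulI v = (Complex.I * v.1, Complex.I * v.2) := rfl

theorem planeForm_comm (v w : ℂ × ℂ) : planeForm v w = planeForm w v := by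
  simp only [planeForm_apply]; ring

theorem planeForm_mulI_left (v w : ℂ × ℂ) : planeForm (mulI v) w = -planeForm v (mulI w) := by
  simp [planeForm_apply, mulI_apply]; ring

theorem mulI_mulI (v : ℂ × ℂ) : mulI (mulI v) = -v := by
  simp [mulI_apply, ← mul_assoc, Prod.ext_iff]

theorem planeForm_mulI_self (v : ℂ × ℂ) : planeForm v (mulI v) = 0 := by
  simp [planeForm_apply, mulI_apply]; ring

theorem planeForm_mulI_mulI (v w : ℂ × ℂ) : planeForm (mulI v) (mulI w) = planeForm v w := by
  rw [planeForm_mulI_left, mulI_mulI, map_neg, neg_neg]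

theorem planeForm_self_eq (v : ℂ × ℂ) : planeForm v v = ‖v.1‖ ^ 2 + ‖v.2‖ ^ 2 := by
  rw [planeForm_apply, Complex.sq_norm, Complex.sq_norm, Complex.normSq_apply,
    Complex.normSq_apply]
  ring

theorem eq_zero_of_planeForm_self {v : ℂ × ℂ} (h : planeForm v v = 0) : v = 0 := by
  rw [planeForm_self_eq] at h
  have h1 : ‖v.1‖ = 0 := by nlinarith [sq_nonneg ‖v.1‖, sq_nonneg ‖v.2‖]
  have h2 : ‖v.2‖ = 0 := by nlinarith [sq_nonneg ‖v.1‖, sq_nonneg ‖v.2‖]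
  exact Prod.ext (norm_eq_zero.1 h1) (norm_eq_zero.1 h2)

variable {κ τ : ℝ}

theorem mem_bergerSphere {p : ℂ × ℂ} : p ∈ (bergerSphere κ τ).carrier ↔ planeForm p p = 1 := by
  rw [planeForm_self_eq]; rfl

theorem bergerSphere_metric_eq (hκ : κ ≠ 0) (hτ : τ ≠ 0) (p v w : ℂ × ℂ) :
    (bergerSphere κ τ).metric p v w = 4 / κ * (planeForm v w
      + (4 * τ ^ 2 / κ - 1) * (planeForm v (mulI p) * planeForm w (mulI p))) := by
  have e : ∀ v, complexPlaneInner v (hopfField κ τ p) = κ / (4 * τ) * planeForm v (mulI p) := by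
    intro v
    rw [complexPlaneInner_eq, hopfField, map_smul, smul_eq_mul, mulI_apply]
  change 4 / κ * (complexPlaneInner v w + 16 * τ ^ 2 / κ ^ 2 * (4 * τ ^ 2 / κ - 1)
    * (complexPlaneInner v (hopfField κ τ p) * complexPlaneInner w (hopfField κ τ p))) = _
  rw [e, e, complexPlaneInner_eq]
  field_simp
  ring

/-- The skew endomorphism `x ↦ ⟨c, x⟩ w - ⟨w, x⟩ c` of `ℂ² ≡ ℝ⁴`. -/
noncomputable def planeSkew (c w : ℂ × ℂ) : ℂ × ℂ →L[ℝ] ℂ × ℂ :=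
  (planeForm c).smulRight w - (planeForm w).smulRight c

theorem planeSkew_apply (c w x : ℂ × ℂ) :
    planeSkew c w x = planeForm c x • w - planeForm w x • c := by
  simp [planeSkew]

theorem planeSkew_skew (c w x y : ℂ × ℂ) :
    planeForm (planeSkew c w x) y + planeForm x (planeSkew c w y) = 0 := by
  simp only [planeSkew_apply, map_sub, map_smul, sub_apply, smul_apply, smul_eq_mul,
    planeForm_comm x c, planeForm_comm x w]
  ring

theorem bergerSphere_isTangent {p : ℂ × ℂ} (hp : p ∈ (bergerSphere κ τ).carrier)
    {w : ℂ × ℂ} (hw : planeForm p w = 0) : (bergerSphere κ τ).IsTangent ⟨p, hp⟩ w := by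
  have hp' := mem_bergerSphere.1 hp
  set A := planeSkew p w with hA
  let f : ℝ → ℂ × ℂ := fun t => NormedSpace.exp (t • A) p
  let c : ℝ → (bergerSphere κ τ).carrier := fun t => ⟨f t, mem_bergerSphere.2
    ((exp_flow_preserves planeForm (planeSkew_skew p w) t p p).trans hp')⟩
  have hf : ContDiff ℝ ∞ f :=
    (contDiff_exp_flow A).comp (contDiff_id.prodMk contDiff_const)
  refine ⟨c, hf, Subtype.ext (by simp [c, f]; rfl), ?_⟩
  have h1 : HasDerivAt f (A p) 0 := by simpa using hasDerivAt_exp_flow A p 0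
  have h2 : A p = w := by
    rw [hA, planeSkew_apply, hp', planeForm_comm, hw, one_smul, zero_smul, sub_zero]
  rw [h2] at h1
  exact h1.deriv

/-- The skew-Hermitian endomorphism `x ↦ (γ^* x) q - (q^* x) γ - s i x` of `ℂ²`, where `γ^* x` is
the Hermitian product. -/
noncomputable def planeUnitary (c q : ℂ × ℂ) (s : ℝ) : ℂ × ℂ →L[ℝ] ℂ × ℂ :=
  planeSkew c q + planeSkew (mulI c) (mulI q) - s • mulI

theorem planeUnitary_apply (c q : ℂ × ℂ) (s : ℝ) (x : ℂ × ℂ) :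
    planeUnitary c q s x = planeForm c x • q - planeForm q x • c
      + (planeForm (mulI c) x • mulI q - planeForm (mulI q) x • mulI c) - s • mulI x := by
  simp [planeUnitary, planeSkew_apply]

theorem planeUnitary_skew (c q : ℂ × ℂ) (s : ℝ) (x y : ℂ × ℂ) :
    planeForm (planeUnitary c q s x) y + planeForm x (planeUnitary c q s y) = 0 := by
  have h1 := planeSkew_skew c q x y
  have h2 := planeSkew_skew (mulI c) (mulI q) x y
  have h3 := planeForm_mulI_left x y
  simp only [planeUnitary, map_sub, map_add, map_smul, sub_apply, add_apply, smul_apply,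
    smul_eq_mul, h3]
  linear_combination h1 + h2

theorem planeUnitary_mulI (c q : ℂ × ℂ) (s : ℝ) (x : ℂ × ℂ) :
    planeUnitary c q s (mulI x) = mulI (planeUnitary c q s x) := by
  simp only [planeUnitary_apply, map_sub, map_add, map_smul, mulI_mulI,
    planeForm_mulI_left _ (mulI x), planeForm_mulI_left _ x, map_neg]
  module

/-- Geodesics of the Berger sphere: the angle `u = ⟨γ', iγ⟩` with the Hopf field is constant, and
`γ'' = μ γ - 2 δ u i γ'` with `δ = 4τ²/κ - 1`. -/
theorem bergerSphere_geodesic_equation (hκ : 0 < κ) (hτ : τ ≠ 0) {f : ℝ → ℂ × ℂ}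
    (hf : ∀ t, f t ∈ (bergerSphere κ τ).carrier) (hsm : ContDiff ℝ ∞ f)
    (hgeo : (bergerSphere κ τ).IsGeodesic fun t => ⟨f t, hf t⟩) (t : ℝ) :
    planeForm (deriv (deriv f) t) (mulI (f t)) = 0 ∧
    ∃ μ : ℝ, deriv (deriv f) t = μ • f t
      - (2 * (4 * τ ^ 2 / κ - 1) * planeForm (deriv f t) (mulI (f t))) • mulI (deriv f t) := by
  set δ := 4 * τ ^ 2 / κ - 1 with hδ
  have hδ1 : 1 + δ ≠ 0 := by
    rw [hδ, add_sub_cancel]; positivity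
  have d1 : ∀ t, HasDerivAt f (deriv f t) t := fun t =>
    (hsm.differentiable (by simp) t).hasDerivAt
  have d2 : ∀ t, HasDerivAt (deriv f) (deriv (deriv f) t) t := fun t =>
    (((contDiff_infty_iff_deriv.1 hsm).2).differentiable (by simp) t).hasDerivAt
  have hff : planeForm (f t) (f t) = 1 := mem_bergerSphere.1 (hf t)
  have horth : planeForm (f t) (deriv f t) = 0 := by
    have h1 := ((hasDerivAt_const t planeForm).clm_apply (d1 t)).clm_apply (d1 t)
    have h2 := h1.unique ((hasDerivAt_const t (1 : ℝ)).congr_of_eventuallyEq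
      (Eventually.of_forall fun s => mem_bergerSphere.1 (hf s)))
    simp [planeForm_comm (deriv f t)] at h2
    linarith
  set a := deriv (deriv f) t
  set v := deriv f t
  set p := f t
  set u := planeForm v (mulI p)
  have hEL : ∀ w, planeForm p w = 0 →
      planeForm (a + (δ * planeForm a (mulI p)) • mulI p + (2 * δ * u) • mulI v) w = 0 := by
    intro w hw
    set m : ℂ × ℂ → ℂ × ℂ → ℂ × ℂ → ℝ := (bergerSphere κ τ).metric with hm
    have hmet : m = fun p v w => 4 / κ * (planeForm v w
        + δ * (planeForm v (mulI p) * planeForm w (mulI p))) := by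
      funext p v w
      exact bergerSphere_metric_eq hκ.ne' hτ p v w
    have e : deriv (fun s => m (f s) (deriv f s) w) t
        = 1 / 2 * fderiv ℝ (fun p => m p v v) p w :=
      hgeo.2 t w (bergerSphere_isTangent (hf t) hw)
    have e1 : HasDerivAt (fun s => m (f s) (deriv f s) w)
        (4 / κ * (planeForm a w + δ * (planeForm a (mulI p) * planeForm w (mulI p)
          + u * planeForm w (mulI v)))) t := by
      simp only [hmet]
      have c1 := ((hasDerivAt_const t planeForm).clm_apply (d2 t)).clm_apply
        (hasDerivAt_const t w)
      have c0 := (hasDerivAt_const t mulI).clm_apply (d1 t)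
      have c2 := ((hasDerivAt_const t planeForm).clm_apply (d2 t)).clm_apply c0
      have c3 := (hasDerivAt_const t (planeForm w)).clm_apply c0
      have c := (c1.fun_add ((c2.fun_mul c3).const_mul δ)).const_mul (4 / κ)
      refine c.congr_deriv ?_
      simp [planeForm_mulI_self]
      left; ring
    have e2 : HasFDerivAt (fun p => m p v v)
        ((4 / κ * δ * (2 * u)) • ((planeForm v).comp mulI)) p := by
      simp only [hmet]
      have c0 : HasFDerivAt (fun p => planeForm v (mulI p)) ((planeForm v).comp mulI) p :=
        ((planeForm v).comp mulI).hasFDerivAt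
      have c := (((c0.fun_mul c0).const_mul δ).const_add (planeForm v v)).const_mul (4 / κ)
      refine c.congr_fderiv ?_
      ext1 <;> ext <;> simp <;> ring
    rw [e1.deriv, e2.fderiv] at e
    have e' : 4 / κ * (planeForm a w + δ * (planeForm a (mulI p) * planeForm w (mulI p)
          + u * planeForm w (mulI v))) = 1 / 2 * ((4 / κ * δ * (2 * u)) * planeForm v (mulI w)) := e
    have hk : 4 / κ ≠ 0 := by positivity
    have e'' := mul_left_cancel₀ hk (e'.trans
      (show _ = 4 / κ * (δ * u * planeForm v (mulI w)) by ring))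
    have s1 : planeForm v (mulI w) = -planeForm (mulI v) w := by
      rw [planeForm_mulI_left, neg_neg]
    simp only [map_add, map_smul, add_apply, smul_apply, smul_eq_mul]
    rw [s1, planeForm_comm w (mulI v), planeForm_comm w (mulI p)] at e''
    linear_combination e''
  have hu : planeForm a (mulI p) = 0 := by
    have h := hEL (mulI p) (planeForm_mulI_self p)
    simp only [map_add, map_smul, add_apply, smul_apply, smul_eq_mul, planeForm_mulI_mulI, hff,
      planeForm_comm v p, horth] at h
    have : (1 + δ) * planeForm a (mulI p) = 0 := by linear_combination h
    exact (mul_eq_zero.1 this).resolve_left hδ1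
  refine ⟨hu, planeForm p (a + (2 * δ * u) • mulI v), ?_⟩
  rw [hu, mul_zero, zero_smul, add_zero] at hEL
  set Z := a + (2 * δ * u) • mulI v with hZ
  have h1 : planeForm p (Z - planeForm p Z • p) = 0 := by
    rw [map_sub, map_smul, hff]; simp
  have h2 : planeForm (Z - planeForm p Z • p) (Z - planeForm p Z • p) = 0 := by
    have h3 := hEL _ h1
    simp only [map_sub, map_smul, sub_apply, smul_apply, smul_eq_mul] at h1 h3 ⊢
    linear_combination h3 - planeForm p Z * h1
  have h3 := sub_eq_zero.1 (eq_zero_of_planeForm_self h2)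
  rw [← h3, hZ]
  simp

/-- Every geodesic of a Berger sphere is an orbit of a `1`-parameter subgroup of `U(2)`. -/
theorem bergerSphere_exists_oneParameterGroup (hκ : 0 < κ) (hτ : τ ≠ 0)
    {γ : ℝ → (bergerSphere κ τ).carrier} (hγ : (bergerSphere κ τ).IsGeodesic γ) :
    ∃ T : ℝ → Equiv.Perm (bergerSphere κ τ).carrier,
      (bergerSphere κ τ).IsOneParameterGroup T ∧ ∀ t s, T t (γ s) = γ (t + s) := by
  let f : ℝ → ℂ × ℂ := fun t => (γ t).1
  have hfm : ∀ t, f t ∈ (bergerSphere κ τ).carrier := fun t => (γ t).2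
  have hsm : ContDiff ℝ ∞ f := hγ.1
  have heq := bergerSphere_geodesic_equation hκ hτ hfm hsm hγ
  set δ := 4 * τ ^ 2 / κ - 1 with hδ
  have d1 : ∀ t, HasDerivAt f (deriv f t) t := fun t =>
    (hsm.differentiable (by simp) t).hasDerivAt
  have d2 : ∀ t, HasDerivAt (deriv f) (deriv (deriv f) t) t := fun t =>
    (((contDiff_infty_iff_deriv.1 hsm).2).differentiable (by simp) t).hasDerivAt
  have hff : ∀ t, planeForm (f t) (f t) = 1 := fun t => mem_bergerSphere.1 (hfm t)
  have horth : ∀ t, planeForm (f t) (deriv f t) = 0 := by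
    intro t
    have h1 := ((hasDerivAt_const t planeForm).clm_apply (d1 t)).clm_apply (d1 t)
    have h2 := h1.unique ((hasDerivAt_const t (1 : ℝ)).congr_of_eventuallyEq
      (Eventually.of_forall hff))
    simp [planeForm_comm (deriv f t)] at h2
    linarith
  have hJ : ∀ t, HasDerivAt (fun t => mulI (f t)) (mulI (deriv f t)) t := fun t => by
    simpa using (hasDerivAt_const t mulI).clm_apply (d1 t)
  have hu : ∀ t, planeForm (deriv f t) (mulI (f t)) = planeForm (deriv f 0) (mulI (f 0)) := by
    have key : ∀ t, HasDerivAt (fun t => planeForm (deriv f t) (mulI (f t))) 0 t := by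
      intro t
      have h := ((hasDerivAt_const t planeForm).clm_apply (d2 t)).clm_apply (hJ t)
      refine h.congr_deriv ?_
      simp [(heq t).1, planeForm_mulI_self]
    exact fun t => is_const_of_deriv_eq_zero (fun t => (key t).differentiableAt)
      (fun t => (key t).deriv) t 0
  set u := planeForm (deriv f 0) (mulI (f 0))
  set q : ℝ → ℂ × ℂ := fun t => deriv f t + (δ * u) • mulI (f t) with hq
  have hqd : ∀ t, HasDerivAt q (deriv (deriv f) t + (δ * u) • mulI (deriv f t)) t := fun t =>
    (d2 t).fun_add ((hJ t).const_smul (δ * u))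
  set A := planeUnitary (f 0) (q 0) ((1 + 2 * δ) * u) with hA
  have hAconst : ∀ t x, planeUnitary (f t) (q t) ((1 + 2 * δ) * u) x = A x := by
    intro t x
    have key : ∀ t, HasDerivAt (fun t => planeUnitary (f t) (q t) ((1 + 2 * δ) * u) x) 0 t := by
      intro t
      simp only [planeUnitary_apply]
      have hJq : HasDerivAt (fun t => mulI (q t))
          (mulI (deriv (deriv f) t + (δ * u) • mulI (deriv f t))) t := by
        simpa using (hasDerivAt_const t mulI).clm_apply (hqd t)
      have pf : ∀ {g : ℝ → ℂ × ℂ} {g' : ℂ × ℂ}, HasDerivAt g g' t →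
          HasDerivAt (fun t => planeForm (g t) x) (planeForm g' x) t := by
        intro g g' hg
        simpa using ((hasDerivAt_const t planeForm).clm_apply hg).clm_apply (hasDerivAt_const t x)
      have d := ((((pf (d1 t)).fun_smul (hqd t)).fun_sub ((pf (hqd t)).fun_smul (d1 t))).fun_add
        (((pf (hJ t)).fun_smul hJq).fun_sub ((pf hJq).fun_smul (hJ t)))).sub_const
        (((1 + 2 * δ) * u) • mulI x)
      refine d.congr_deriv ?_
      obtain ⟨μ, hμ⟩ := (heq t).2
      rw [hu] at hμ
      simp only [hq, hμ, map_add, map_sub, map_smul, map_neg, mulI_mulI, add_apply, sub_apply,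
        smul_apply, neg_apply, smul_eq_mul]
      module
    exact is_const_of_deriv_eq_zero (fun t => (key t).differentiableAt) (fun t => (key t).deriv) t 0
  have hfA : ∀ t, HasDerivAt f (A (f t)) t := by
    intro t
    refine (d1 t).congr_deriv ?_
    rw [← hAconst t, planeUnitary_apply]
    simp only [hq, map_add, map_smul, mulI_mulI, add_apply, smul_apply, hff, smul_eq_mul,
      planeForm_comm (deriv f t) (f t), horth, planeForm_mulI_left _ (f t), planeForm_mulI_self,
      hu, map_neg, neg_apply]
    module
  have hflowJ : ∀ (t : ℝ) (x : ℂ × ℂ), NormedSpace.exp (t • A) (mulI x)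
      = mulI (NormedSpace.exp (t • A) x) := by
    intro t x
    have h := eq_exp_flow_of_hasDerivAt (A := A)
      (c := fun t => mulI (NormedSpace.exp (t • A) x)) (fun t => by
        have := (hasDerivAt_const t mulI).clm_apply (hasDerivAt_exp_flow A x t)
        refine this.congr_deriv ?_
        simp [hA, planeUnitary_mulI]) t 0
    simpa using h.symm
  have hflowB := exp_flow_preserves planeForm (planeUnitary_skew (f 0) (q 0) ((1 + 2 * δ) * u))
  obtain ⟨T, hT, hTΦ⟩ := exists_oneParameterGroup_of_flow (M := bergerSphere κ τ)
    (Φ := fun (t : ℝ) (p : ℂ × ℂ) => NormedSpace.exp (t • A) p)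
    (U := Set.univ) isOpen_univ (Set.subset_univ _) (contDiff_exp_flow A).contDiffOn
    (fun t p hp => mem_bergerSphere.2 ((hflowB t p p).trans (mem_bergerSphere.1 hp)))
    (fun p _ => by rw [zero_smul, NormedSpace.exp_zero]; rfl)
    (fun s t p _ => exp_flow_add A s t p)
    (by
      intro t (k : ℝ → ℂ × ℂ) hk _ s
      have d : HasDerivAt k (deriv k s) s := (hk.differentiable (by simp) s).hasDerivAt
      refine ⟨_, ((NormedSpace.exp (t • A)).hasFDerivAt).comp_hasDerivAt s d, ?_⟩
      refine (bergerSphere_metric_eq hκ.ne' hτ _ _ _).trans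
        (Eq.trans ?_ (bergerSphere_metric_eq hκ.ne' hτ _ _ _).symm)
      rw [← hflowJ, hflowB, hflowB]
      rfl)
  exact ⟨T, hT, fun t s => Subtype.ext ((hTΦ t (γ s)).trans
    (eq_exp_flow_of_hasDerivAt hfA t s).symm)⟩

theorem bergerSphere_preconnectedSpace : PreconnectedSpace (bergerSphere κ τ).carrier := by
  apply isPreconnected_iff_preconnectedSpace.1
  have h1 : IsPreconnected (Metric.sphere (0 : WithLp 2 (ℂ × ℂ)) 1) :=
    isPreconnected_sphere (by
      rw [← Module.finrank_eq_rank, (WithLp.linearEquiv 2 ℝ (ℂ × ℂ)).finrank_eq]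
      simp) _ _
  have h2 := h1.image (WithLp.ofLp (p := 2)) (WithLp.prod_continuous_ofLp 2 ℂ ℂ).continuousOn
  refine (?_ : (bergerSphere κ τ).carrier = _) ▸ h2
  refine Set.ext fun (q : ℂ × ℂ) => ?_
  change ‖q.1‖ ^ 2 + ‖q.2‖ ^ 2 = 1 ↔ _
  constructor
  · intro h
    refine ⟨WithLp.toLp 2 q, ?_, rfl⟩
    rw [mem_sphere_zero_iff_norm, WithLp.prod_norm_eq_of_L2]
    simp [h]
  · rintro ⟨x, hx, rfl⟩
    rw [mem_sphere_zero_iff_norm, WithLp.prod_norm_eq_of_L2, Real.sqrt_eq_one] at hx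
    exact hx

end BergerSphere

/-! ### Charts of the Berger spheres -/

section BergerCharts

/-- The complex-linear map `(α, β) ↦ α p + β p'` of `ℂ²`, where `p' = (-p̄₂, p̄₁)` is orthogonal
to `p`. -/
noncomputable def unitaryFrame (p : ℂ × ℂ) : ℂ × ℂ →L[ℝ] ℂ × ℂ :=
  (p.1 • ContinuousLinearMap.fst ℝ ℂ ℂ - starRingEnd ℂ p.2 • ContinuousLinearMap.snd ℝ ℂ ℂ).prod
    (p.2 • ContinuousLinearMap.fst ℝ ℂ ℂ + starRingEnd ℂ p.1 • ContinuousLinearMap.snd ℝ ℂ ℂ)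

theorem unitaryFrame_apply (p a : ℂ × ℂ) : unitaryFrame p a =
    (p.1 * a.1 - starRingEnd ℂ p.2 * a.2, p.2 * a.1 + starRingEnd ℂ p.1 * a.2) := by
  simp [unitaryFrame]

theorem unitaryFrame_mulI (p a : ℂ × ℂ) : unitaryFrame p (mulI a) = mulI (unitaryFrame p a) := by
  simp only [unitaryFrame_apply, mulI_apply]
  refine Prod.ext ?_ ?_ <;> simp <;> ring

theorem planeForm_unitaryFrame {p : ℂ × ℂ} (hp : planeForm p p = 1) (a b : ℂ × ℂ) :
    planeForm (unitaryFrame p a) (unitaryFrame p b) = planeForm a b := by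
  simp only [unitaryFrame_apply, planeForm_apply] at hp ⊢
  simp only [Complex.sub_re, Complex.sub_im, Complex.add_re, Complex.add_im, Complex.mul_re,
    Complex.mul_im, Complex.conj_re, Complex.conj_im]
  linear_combination (a.1.re * b.1.re + a.1.im * b.1.im + a.2.re * b.2.re + a.2.im * b.2.im) * hp

/-- The inverse of `unitaryFrame p` for `|p| = 1`. -/
noncomputable def unitaryFrameInv (p : ℂ × ℂ) : ℂ × ℂ →L[ℝ] ℂ × ℂ :=
  (starRingEnd ℂ p.1 • ContinuousLinearMap.fst ℝ ℂ ℂ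
      + starRingEnd ℂ p.2 • ContinuousLinearMap.snd ℝ ℂ ℂ).prod
    (p.1 • ContinuousLinearMap.snd ℝ ℂ ℂ - p.2 • ContinuousLinearMap.fst ℝ ℂ ℂ)

theorem unitaryFrameInv_apply (p q : ℂ × ℂ) : unitaryFrameInv p q =
    (starRingEnd ℂ p.1 * q.1 + starRingEnd ℂ p.2 * q.2, p.1 * q.2 - p.2 * q.1) := by
  simp [unitaryFrameInv]

theorem conj_mul_self_add_eq_one {p : ℂ × ℂ} (hp : planeForm p p = 1) :
    starRingEnd ℂ p.1 * p.1 + starRingEnd ℂ p.2 * p.2 = 1 := by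
  rw [planeForm_apply] at hp
  refine Complex.ext ?_ ?_
  · simp; linarith
  · simp; ring

theorem unitaryFrameInv_unitaryFrame {p : ℂ × ℂ} (hp : planeForm p p = 1) (a : ℂ × ℂ) :
    unitaryFrameInv p (unitaryFrame p a) = a := by
  have h := conj_mul_self_add_eq_one hp
  rw [unitaryFrame_apply, unitaryFrameInv_apply]
  refine Prod.ext ?_ ?_
  · linear_combination a.1 * h
  · linear_combination a.2 * h

theorem unitaryFrame_unitaryFrameInv {p : ℂ × ℂ} (hp : planeForm p p = 1) (q : ℂ × ℂ) :
    unitaryFrame p (unitaryFrameInv p q) = q := by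
  have h := conj_mul_self_add_eq_one hp
  rw [unitaryFrame_apply, unitaryFrameInv_apply]
  refine Prod.ext ?_ ?_
  · linear_combination q.1 * h
  · linear_combination q.2 * h

theorem planeForm_phase (θ₁ θ₂ : ℝ) (a b : ℂ × ℂ) :
    planeForm (Complex.exp (θ₁ * Complex.I) * a.1, Complex.exp (θ₂ * Complex.I) * a.2)
      (Complex.exp (θ₁ * Complex.I) * b.1, Complex.exp (θ₂ * Complex.I) * b.2)
      = planeForm a b := by
  simp only [planeForm_apply, Complex.mul_re, Complex.mul_im, Complex.exp_ofReal_mul_I_re,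
    Complex.exp_ofReal_mul_I_im]
  linear_combination (a.1.re * b.1.re + a.1.im * b.1.im) * Real.sin_sq_add_cos_sq θ₁
    + (a.2.re * b.2.re + a.2.im * b.2.im) * Real.sin_sq_add_cos_sq θ₂

/-- The chart of `𝕊³` around `(1, 0)` whose base coordinate is (a multiple of) the affine
coordinate `β/α` of `ℂℙ¹` and whose vertical coordinate is the phase of `α`. -/
noncomputable def bergerParam (κ τ : ℝ) (x : ℝ × ℝ × ℝ) : ℂ × ℂ :=
  (Complex.exp (((-κ / (4 * τ) * x.2.2 : ℝ) : ℂ) * Complex.I)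
      * ((√(conformalFactor κ x.1 x.2.1) : ℝ) : ℂ),
    Complex.exp ((((-κ / (4 * τ) + τ) * x.2.2 : ℝ) : ℂ) * Complex.I)
      * (((√κ / 2 * √(conformalFactor κ x.1 x.2.1) : ℝ) : ℂ) * (x.1 + x.2.1 * Complex.I)))

variable {κ τ : ℝ}

theorem conformalFactor_pos (hκ : 0 < κ) (x y : ℝ) : 0 < conformalFactor κ x y :=
  one_div_pos.2 (one_add_pos_of_pos hκ _ _)

theorem contDiff_sqrt_conformalFactor (hκ : 0 < κ) :
    ContDiff ℝ ∞ fun x : ℝ × ℝ × ℝ => √(conformalFactor κ x.1 x.2.1) :=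
  contDiff_iff_contDiffAt.2 fun _ =>
    (contDiffAt_conformalFactor (one_add_pos_of_pos hκ _ _).ne').sqrt
      (conformalFactor_pos hκ _ _).ne'

theorem contDiff_bergerParam (hκ : 0 < κ) : ContDiff ℝ ∞ (bergerParam κ τ) := by
  have h := contDiff_sqrt_conformalFactor hκ
  have hc : ∀ {g : ℝ × ℝ × ℝ → ℝ}, ContDiff ℝ ∞ g → ContDiff ℝ ∞ fun x => ((g x : ℝ) : ℂ) :=
    fun hg => Complex.ofRealCLM.contDiff.comp hg
  have hx : ContDiff ℝ ∞ fun x : ℝ × ℝ × ℝ => (x.1 : ℂ) + x.2.1 * Complex.I :=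
    (hc contDiff_fst).add ((hc (contDiff_fst.comp contDiff_snd)).mul contDiff_const)
  unfold bergerParam
  refine ContDiff.prodMk ?_ ?_
  · exact (((hc (by fun_prop)).mul contDiff_const).cexp).mul (hc h)
  · exact (((hc (by fun_prop)).mul contDiff_const).cexp).mul
      ((hc (contDiff_const.mul h)).mul hx)

theorem fderiv_bergerParam (hκ : 0 < κ) (x u : ℝ × ℝ × ℝ) :
    fderiv ℝ (bergerParam κ τ) x u =
    (Complex.exp (((-κ / (4 * τ) * x.2.2 : ℝ) : ℂ) * Complex.I)
        * (((-√(conformalFactor κ x.1 x.2.1) ^ 3 * (κ / 4) * (x.1 * u.1 + x.2.1 * u.2.1) : ℝ) : ℂ)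
          + ((√(conformalFactor κ x.1 x.2.1) * (-κ / (4 * τ) * u.2.2) : ℝ) : ℂ) * Complex.I),
      Complex.exp ((((-κ / (4 * τ) + τ) * x.2.2 : ℝ) : ℂ) * Complex.I) *
        (((√κ / 2 * (-√(conformalFactor κ x.1 x.2.1) ^ 3 * (κ / 4)
            * (x.1 * u.1 + x.2.1 * u.2.1)) : ℝ) : ℂ) * (x.1 + x.2.1 * Complex.I)
          + ((√κ / 2 * √(conformalFactor κ x.1 x.2.1) : ℝ) : ℂ)
            * ((u.1 + u.2.1 * Complex.I) + (((-κ / (4 * τ) + τ) * u.2.2 : ℝ) : ℂ) * Complex.I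
              * (x.1 + x.2.1 * Complex.I)))) := by
  have hl := conformalFactor_pos hκ x.1 x.2.1
  have hX : HasFDerivAt (bergerParam κ τ) (fderiv ℝ (bergerParam κ τ) x) (x + (0 : ℝ) • u) := by
    rw [zero_smul, add_zero]
    exact ((contDiff_bergerParam hκ).differentiable (by simp) x).hasFDerivAt
  have hline : HasDerivAt (fun t : ℝ => x + t • u) u 0 := by
    simpa using ((hasDerivAt_id (0 : ℝ)).smul_const u).const_add x
  have dX := hX.comp_hasDerivAt 0 hline
  have d1 : HasDerivAt (fun t : ℝ => (x + t • u).1) u.1 0 := by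
    simpa using ((hasDerivAt_id (0 : ℝ)).mul_const u.1).const_add x.1
  have d2 : HasDerivAt (fun t : ℝ => (x + t • u).2.1) u.2.1 0 := by
    simpa using ((hasDerivAt_id (0 : ℝ)).mul_const u.2.1).const_add x.2.1
  have d3 : HasDerivAt (fun t : ℝ => (x + t • u).2.2) u.2.2 0 := by
    simpa using ((hasDerivAt_id (0 : ℝ)).mul_const u.2.2).const_add x.2.2
  have dl : HasDerivAt (fun t : ℝ => √(conformalFactor κ (x + t • u).1 (x + t • u).2.1))
      (-√(conformalFactor κ x.1 x.2.1) ^ 3 * (κ / 4) * (x.1 * u.1 + x.2.1 * u.2.1)) 0 := by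
    have h1 : HasFDerivAt (fun p : ℝ × ℝ × ℝ => conformalFactor κ p.1 p.2.1) _
      (x + (0 : ℝ) • u) := hasFDerivAt_conformalFactor (one_add_pos_of_pos hκ _ _).ne'
    have h2 := h1.comp_hasDerivAt 0 hline
    have h3 := h2.sqrt (by simpa using hl.ne')
    refine h3.congr_deriv ?_
    simp only [Function.comp_apply, zero_smul, add_zero]
    have hs : √(conformalFactor κ x.1 x.2.1) ^ 2 = conformalFactor κ x.1 x.2.1 :=
      Real.sq_sqrt hl.le
    have hs0 := (Real.sqrt_pos.2 hl).ne'
    simp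
    generalize √(conformalFactor κ x.1 x.2.1) = r at hs hs0
    rw [← hs]
    field_simp
    ring
  have e1 := ((((d3.const_mul (-κ / (4 * τ))).ofReal_comp).mul_const Complex.I).cexp).mul
    dl.ofReal_comp
  have e2 := ((((d3.const_mul (-κ / (4 * τ) + τ)).ofReal_comp).mul_const Complex.I).cexp).mul
    ((dl.const_mul (√κ / 2)).ofReal_comp.mul
      (d1.ofReal_comp.add (d2.ofReal_comp.mul_const Complex.I)))
  refine dX.unique ((e1.prodMk e2).congr_deriv ?_)
  simp only [zero_smul, add_zero, Pi.add_apply, Pi.mul_apply]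
  refine Prod.ext ?_ ?_
  · push_cast; ring
  · push_cast; ring

/-- The chart is isometric: its horizontal part is the Fubini–Study metric, and its vertical part
the connection form of the Hopf fibration. -/
theorem bergerParam_isometric (hκ : 0 < κ) (hτ : τ ≠ 0) (x u : ℝ × ℝ × ℝ) :
    4 / κ * (planeForm (fderiv ℝ (bergerParam κ τ) x u) (fderiv ℝ (bergerParam κ τ) x u)
      + (4 * τ ^ 2 / κ - 1) *
        planeForm (fderiv ℝ (bergerParam κ τ) x u) (mulI (bergerParam κ τ x)) ^ 2)
      = rotMetric κ τ x u u := by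
  have hl := conformalFactor_pos hκ x.1 x.2.1
  have hlm := conformalFactor_mul (one_add_pos_of_pos hκ x.1 x.2.1).ne'
  have hs : √(conformalFactor κ x.1 x.2.1) ^ 2 = conformalFactor κ x.1 x.2.1 :=
    Real.sq_sqrt hl.le
  have hk : (√κ / 2) ^ 2 = κ / 4 := by rw [div_pow, Real.sq_sqrt hκ.le]; norm_num
  have hmulI : mulI (bergerParam κ τ x) =
      (Complex.exp (((-κ / (4 * τ) * x.2.2 : ℝ) : ℂ) * Complex.I)
        * (((√(conformalFactor κ x.1 x.2.1) : ℝ) : ℂ) * Complex.I),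
      Complex.exp ((((-κ / (4 * τ) + τ) * x.2.2 : ℝ) : ℂ) * Complex.I)
        * ((((√κ / 2 * √(conformalFactor κ x.1 x.2.1) : ℝ) : ℂ) * (x.1 + x.2.1 * Complex.I))
          * Complex.I)) := by
    rw [mulI_apply, bergerParam]
    refine Prod.ext ?_ ?_ <;> simp only <;> ring
  have key : planeForm (fderiv ℝ (bergerParam κ τ) x u) (mulI (bergerParam κ τ x)) =
      -κ / (4 * τ) * u.2.2 + conformalFactor κ x.1 x.2.1 * (κ / 4) *
        (x.1 * (u.2.1 + τ * x.1 * u.2.2) - x.2.1 * (u.1 - τ * x.2.1 * u.2.2)) := by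
    rw [hmulI, fderiv_bergerParam hκ, planeForm_phase _ _ (_, _) (_, _), planeForm_apply]
    generalize √(conformalFactor κ x.1 x.2.1) = r at hs
    generalize √κ / 2 = k at hk
    generalize -κ / (4 * τ) = c
    rw [← hs] at hlm ⊢
    generalize hD : -r ^ 3 * (κ / 4) * (x.1 * u.1 + x.2.1 * u.2.1) = D
    simp
    subst hD
    linear_combination (c * u.2.2) * hlm + r ^ 2 * (c * u.2.2 * (x.1 ^ 2 + x.2.1 ^ 2)
      + (x.1 * (u.2.1 + τ * x.1 * u.2.2) - x.2.1 * (u.1 - τ * x.2.1 * u.2.2))) * hk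
  have key2 : planeForm (fderiv ℝ (bergerParam κ τ) x u) (fderiv ℝ (bergerParam κ τ) x u) =
      (κ / 4) * conformalFactor κ x.1 x.2.1 ^ 2 * ((u.1 - τ * x.2.1 * u.2.2) ^ 2
        + (u.2.1 + τ * x.1 * u.2.2) ^ 2) + (-κ / (4 * τ) * u.2.2
        + conformalFactor κ x.1 x.2.1 * (κ / 4) *
        (x.1 * (u.2.1 + τ * x.1 * u.2.2) - x.2.1 * (u.1 - τ * x.2.1 * u.2.2))) ^ 2 := by
    rw [fderiv_bergerParam hκ, planeForm_phase _ _ (_, _) (_, _), planeForm_apply]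
    generalize √(conformalFactor κ x.1 x.2.1) = r at hs
    generalize √κ / 2 = k at hk
    generalize -κ / (4 * τ) = c
    rw [← hs] at hlm ⊢
    generalize hD : -r ^ 3 * (κ / 4) * (x.1 * u.1 + x.2.1 * u.2.1) = D
    simp
    subst hD
    linear_combination (r ^ 4 * (κ / 4) ^ 2 * (x.1 * u.1 + x.2.1 * u.2.1) ^ 2 + c ^ 2 * u.2.2 ^ 2
      - κ / 4 * r ^ 2 * ((u.1 - τ * x.2.1 * u.2.2) ^ 2 + (u.2.1 + τ * x.1 * u.2.2) ^ 2)) * hlm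
      + ((-r ^ 3 * (κ / 4) * (x.1 * u.1 + x.2.1 * u.2.1)) ^ 2 * (x.1 ^ 2 + x.2.1 ^ 2)
        + 2 * (-r ^ 3 * (κ / 4) * (x.1 * u.1 + x.2.1 * u.2.1)) * r * (x.1 * u.1 + x.2.1 * u.2.1)
        + r ^ 2 * ((u.1 - τ * x.2.1 * u.2.2) ^ 2 + (u.2.1 + τ * x.1 * u.2.2) ^ 2
          + 2 * c * u.2.2 * (x.1 * (u.2.1 + τ * x.1 * u.2.2)
            - x.2.1 * (u.1 - τ * x.2.1 * u.2.2))
          + c ^ 2 * u.2.2 ^ 2 * (x.1 ^ 2 + x.2.1 ^ 2))) * hk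
  rw [key, key2, rotMetric_apply]
  have := hκ.ne'
  field_simp
  ring

/-- The Berger sphere has charts of the required form at all points: translate `bergerParam` by the
unitary map `unitaryFrame p`. -/
theorem bergerSphere_isometricChart (hκ : 0 < κ) (hτ : τ ≠ 0) {p : ℂ × ℂ} (hp : planeForm p p = 1) :
    Nonempty (IsometricChart (bergerSphere κ τ) κ τ p) := by
  set c : ℝ := -κ / (4 * τ) with hc
  have hc0 : c ≠ 0 := div_ne_zero (neg_ne_zero.2 hκ.ne') (mul_ne_zero four_ne_zero hτ)
  have hk : (√κ / 2) ^ 2 = κ / 4 := by rw [div_pow, Real.sq_sqrt hκ.le]; norm_num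
  have hk0 : √κ / 2 ≠ 0 := by positivity
  have hkc : ((√κ / 2 : ℝ) : ℂ) ≠ 0 := Complex.ofReal_ne_zero.2 hk0
  let X : ℝ × ℝ × ℝ → ℂ × ℂ := fun x => unitaryFrame p (bergerParam κ τ x)
  let Z : ℂ × ℂ → ℝ := fun a => Complex.arg a.1 / c
  let W : ℂ × ℂ → ℂ := fun a =>
    a.2 / (((√κ / 2 : ℝ) : ℂ) * a.1) * Complex.exp (((-τ * Z a : ℝ) : ℂ) * Complex.I)
  let Y₀ : ℂ × ℂ → ℝ × ℝ × ℝ := fun a => ((W a).re, (W a).im, Z a)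
  let Y : ℂ × ℂ → ℝ × ℝ × ℝ := fun q => Y₀ (unitaryFrameInv p q)
  let S : Set (ℝ × ℝ × ℝ) := {x | c * x.2.2 ∈ Set.Ioo (-Real.pi) Real.pi}
  let O₀ : Set (ℂ × ℂ) := {a | a.1 ∈ Complex.slitPlane}
  let O : Set (ℂ × ℂ) := {q | (unitaryFrameInv p q).1 ∈ Complex.slitPlane}
  have hX : ContDiff ℝ ∞ X := (unitaryFrame p).contDiff.comp (contDiff_bergerParam hκ)
  have hXd : ∀ x u, fderiv ℝ X x u = unitaryFrame p (fderiv ℝ (bergerParam κ τ) x u) := by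
    intro x u
    have h := (unitaryFrame p).hasFDerivAt.comp x
      ((contDiff_bergerParam (τ := τ) hκ).differentiable (by simp) x).hasFDerivAt
    have h' : HasFDerivAt X _ x := h
    rw [h'.fderiv]; rfl
  have hS : IsOpen S := isOpen_Ioo.preimage (by fun_prop)
  have hO : IsOpen O := Complex.isOpen_slitPlane.preimage (by fun_prop)
  have hZ : ContDiffOn ℝ ∞ Z O₀ := by
    intro a ha
    have h1 : ContDiffAt ℝ ∞ (fun a : ℂ × ℂ => (Complex.log a.1).im) a :=
      Complex.imCLM.contDiff.contDiffAt.comp a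
        (((Complex.contDiffAt_log ha).restrict_scalars ℝ).comp a contDiffAt_fst)
    have h2 : ContDiffAt ℝ ∞ Z a := by simpa only [Complex.log_im] using h1.div_const c
    exact h2.contDiffWithinAt
  have hY₀ : ContDiffOn ℝ ∞ Y₀ O₀ := by
    have hW : ContDiffOn ℝ ∞ W O₀ := by
      have h1 : ContDiffOn ℝ ∞ (fun a : ℂ × ℂ => (((√κ / 2 : ℝ) : ℂ) * a.1)⁻¹) O₀ :=
        (contDiff_const.mul contDiff_fst).contDiffOn.inv fun a ha =>
          mul_ne_zero hkc (Complex.slitPlane_ne_zero ha)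
      have h2 : ContDiffOn ℝ ∞ (fun a : ℂ × ℂ => a.2) O₀ := contDiff_snd.contDiffOn
      refine ContDiffOn.mul (h2.mul h1) ?_
      exact ((Complex.ofRealCLM.contDiff.comp_contDiffOn (contDiffOn_const.mul hZ)).mul
        contDiffOn_const).cexp
    exact (Complex.reCLM.contDiff.comp_contDiffOn hW).prodMk
      ((Complex.imCLM.contDiff.comp_contDiffOn hW).prodMk hZ)
  have hY : ContDiffOn ℝ ∞ Y O :=
    hY₀.comp (unitaryFrameInv p).contDiff.contDiffOn fun q hq => hq
  -- the chart at `(1, 0)` is inverted by `Y₀`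
  have hsource : ∀ x ∈ S, planeForm (bergerParam κ τ x) (bergerParam κ τ x) = 1 ∧
      (bergerParam κ τ x).1 ∈ Complex.slitPlane ∧ Y₀ (bergerParam κ τ x) = x := by
    intro x hx
    have hl := conformalFactor_pos hκ x.1 x.2.1
    have hlm := conformalFactor_mul (one_add_pos_of_pos hκ x.1 x.2.1).ne'
    have hs : √(conformalFactor κ x.1 x.2.1) ^ 2 = conformalFactor κ x.1 x.2.1 :=
      Real.sq_sqrt hl.le
    have hs0 : 0 < √(conformalFactor κ x.1 x.2.1) := Real.sqrt_pos.2 hl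
    have harg : Complex.arg (bergerParam κ τ x).1 = c * x.2.2 := by
      rw [bergerParam, mul_comm]
      rw [Complex.arg_real_mul _ hs0, Complex.exp_mul_I]
      exact Complex.arg_cos_add_sin_mul_I ⟨hx.1, hx.2.le⟩
    have hne : (bergerParam κ τ x).1 ≠ 0 :=
      mul_ne_zero (Complex.exp_ne_zero _) (Complex.ofReal_ne_zero.2 hs0.ne')
    have hZx : Z (bergerParam κ τ x) = x.2.2 := by
      change Complex.arg (bergerParam κ τ x).1 / c = x.2.2
      rw [harg, mul_div_cancel_left₀ _ hc0]
    have hWx : W (bergerParam κ τ x) = x.1 + x.2.1 * Complex.I := by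
      change (bergerParam κ τ x).2 / (((√κ / 2 : ℝ) : ℂ) * (bergerParam κ τ x).1)
        * Complex.exp (((-τ * Z (bergerParam κ τ x) : ℝ) : ℂ) * Complex.I) = _
      rw [hZx]
      have e : Complex.exp ((((-κ / (4 * τ) + τ) * x.2.2 : ℝ) : ℂ) * Complex.I)
          * Complex.exp (((-τ * x.2.2 : ℝ) : ℂ) * Complex.I)
          = Complex.exp (((-κ / (4 * τ) * x.2.2 : ℝ) : ℂ) * Complex.I) := by
        rw [← Complex.exp_add]; congr 1; push_cast; ring
      rw [div_mul_eq_mul_div, div_eq_iff (mul_ne_zero hkc hne), bergerParam]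
      simp only
      rw [← e]
      push_cast
      ring
    refine ⟨?_, ?_, ?_⟩
    · rw [bergerParam, planeForm_phase _ _ (_, _) (_, _), planeForm_apply]
      generalize √(conformalFactor κ x.1 x.2.1) = r at hs
      generalize √κ / 2 = k at hk
      rw [← hs] at hlm
      simp
      linear_combination hlm + r ^ 2 * (x.1 ^ 2 + x.2.1 ^ 2) * hk
    · rw [Complex.mem_slitPlane_iff_arg, harg]
      exact ⟨hx.2.ne, hne⟩
    · change ((W (bergerParam κ τ x)).re, (W (bergerParam κ τ x)).im, Z (bergerParam κ τ x)) = x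
      rw [hWx, hZx]
      simp
  have htarget : ∀ a : ℂ × ℂ, planeForm a a = 1 → a.1 ∈ Complex.slitPlane →
      Y₀ a ∈ S ∧ bergerParam κ τ (Y₀ a) = a := by
    intro a ha hsl
    have hcZ : c * Z a = Complex.arg a.1 := mul_div_cancel₀ _ hc0
    have ha0 := Complex.slitPlane_ne_zero hsl
    have hn0 : 0 < ‖a.1‖ := norm_pos_iff.2 ha0
    have hWn : ‖W a‖ ^ 2 * (κ / 4) * ‖a.1‖ ^ 2 = ‖a.2‖ ^ 2 := by
      change ‖a.2 / (((√κ / 2 : ℝ) : ℂ) * a.1)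
        * Complex.exp (((-τ * Z a : ℝ) : ℂ) * Complex.I)‖ ^ 2 * (κ / 4) * ‖a.1‖ ^ 2 = _
      rw [norm_mul, Complex.norm_exp_ofReal_mul_I, norm_div, norm_mul, Complex.norm_real, ← hk,
        Real.norm_of_nonneg (by positivity)]
      field_simp
    have hWn' : ‖W a‖ ^ 2 = (W a).re ^ 2 + (W a).im ^ 2 := by
      rw [Complex.sq_norm, Complex.normSq_apply]; ring
    have hlm : conformalFactor κ (W a).re (W a).im = ‖a.1‖ ^ 2 := by
      have h1 := conformalFactor_mul (one_add_pos_of_pos hκ (W a).re (W a).im).ne'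
      have h2 : ‖a.1‖ ^ 2 * (1 + κ / 4 * ((W a).re ^ 2 + (W a).im ^ 2)) = 1 := by
        rw [planeForm_self_eq] at ha
        rw [← hWn']
        linear_combination hWn + ha
      exact mul_right_cancel₀ (one_add_pos_of_pos hκ (W a).re (W a).im).ne' (h1.trans h2.symm)
    refine ⟨?_, ?_⟩
    · change c * Z a ∈ Set.Ioo (-Real.pi) Real.pi
      rw [hcZ]
      exact ⟨Complex.neg_pi_lt_arg _,
        lt_of_le_of_ne (Complex.arg_le_pi _) (Complex.mem_slitPlane_iff_arg.1 hsl).1⟩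
    · have hr : √(conformalFactor κ (Y₀ a).1 (Y₀ a).2.1) = ‖a.1‖ := by
        change √(conformalFactor κ (W a).re (W a).im) = ‖a.1‖
        rw [hlm, Real.sqrt_sq hn0.le]
      have hphase : Complex.exp (((-κ / (4 * τ) * (Y₀ a).2.2 : ℝ) : ℂ) * Complex.I)
          * ((‖a.1‖ : ℝ) : ℂ) = a.1 := by
        change Complex.exp (((c * Z a : ℝ) : ℂ) * Complex.I) * _ = _
        rw [hcZ, mul_comm, Complex.norm_mul_exp_arg_mul_I]
      have hWa : ((Y₀ a).1 : ℂ) + (Y₀ a).2.1 * Complex.I = W a := Complex.re_add_im (W a)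
      rw [bergerParam, hr]
      refine Prod.ext hphase ?_
      simp only
      rw [hWa]
      have e : Complex.exp ((((-κ / (4 * τ) + τ) * (Y₀ a).2.2 : ℝ) : ℂ) * Complex.I)
          * Complex.exp (((-τ * Z a : ℝ) : ℂ) * Complex.I)
          = Complex.exp (((-κ / (4 * τ) * (Y₀ a).2.2 : ℝ) : ℂ) * Complex.I) := by
        change Complex.exp ((((-κ / (4 * τ) + τ) * Z a : ℝ) : ℂ) * Complex.I) * _
          = Complex.exp (((-κ / (4 * τ) * Z a : ℝ) : ℂ) * Complex.I)
        rw [← Complex.exp_add]; congr 1; push_cast; ring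
      calc _ = a.2 / (((√κ / 2 : ℝ) : ℂ) * a.1) * ((√κ / 2 : ℝ) : ℂ)
            * ((Complex.exp ((((-κ / (4 * τ) + τ) * (Y₀ a).2.2 : ℝ) : ℂ) * Complex.I)
              * Complex.exp (((-τ * Z a : ℝ) : ℂ) * Complex.I)) * ((‖a.1‖ : ℝ) : ℂ)) := by
            simp only [W]; push_cast; ring
        _ = a.2 := by
            rw [e, hphase]
            field_simp
  have hb0 : bergerParam κ τ 0 = (1, 0) := by
    simp [bergerParam, conformalFactor]
  have hX0 : X 0 = p := by
    change unitaryFrame p (bergerParam κ τ 0) = p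
    rw [hb0, unitaryFrame_apply]; simp
  refine ⟨{ toFun := X, invFun := Y, source := S, target := O
            isOpen_source := hS, isOpen_target := hO
            zero_mem := by
              change c * 0 ∈ Set.Ioo (-Real.pi) Real.pi
              rw [mul_zero]; exact ⟨neg_lt_zero.2 Real.pi_pos, Real.pi_pos⟩
            map_zero := hX0
            contDiffOn_toFun := hX.contDiffOn
            contDiffOn_invFun := hY
            map_source := ?_
            left_inv := ?_
            map_target := ?_
            isometric := ?_
            vertical := ⟨-1, ?_⟩ }⟩
  · intro x hx
    refine ⟨mem_bergerSphere.2 ?_, ?_⟩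
    · change planeForm (unitaryFrame p (bergerParam κ τ x)) (unitaryFrame p (bergerParam κ τ x)) = 1
      rw [planeForm_unitaryFrame hp]
      exact (hsource x hx).1
    · change (unitaryFrameInv p (unitaryFrame p (bergerParam κ τ x))).1 ∈ Complex.slitPlane
      rw [unitaryFrameInv_unitaryFrame hp]
      exact (hsource x hx).2.1
  · intro x hx
    change Y₀ (unitaryFrameInv p (unitaryFrame p (bergerParam κ τ x))) = x
    rw [unitaryFrameInv_unitaryFrame hp]
    exact (hsource x hx).2.2
  · intro (q : ℂ × ℂ) hq hqO
    have h1 : planeForm (unitaryFrameInv p q) (unitaryFrameInv p q) = 1 := by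
      rw [← planeForm_unitaryFrame hp, unitaryFrame_unitaryFrameInv hp]
      exact mem_bergerSphere.1 hq
    obtain ⟨h2, h3⟩ := htarget _ h1 hqO
    refine ⟨h2, ?_⟩
    change unitaryFrame p (bergerParam κ τ (Y₀ (unitaryFrameInv p q))) = q
    rw [h3, unitaryFrame_unitaryFrameInv hp]
  · intro x _ u
    rw [← bergerParam_isometric hκ hτ x u]
    refine (bergerSphere_metric_eq hκ.ne' hτ (X x) _ _).trans ?_
    change 4 / κ * (planeForm (fderiv ℝ X x u) (fderiv ℝ X x u) + (4 * τ ^ 2 / κ - 1) *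
      (planeForm (fderiv ℝ X x u) (mulI (X x)) * planeForm (fderiv ℝ X x u) (mulI (X x)))) = _
    rw [hXd]
    change 4 / κ * (_ + (4 * τ ^ 2 / κ - 1) *
      (planeForm _ (mulI (unitaryFrame p (bergerParam κ τ x)))
        * planeForm _ (mulI (unitaryFrame p (bergerParam κ τ x))))) = _
    rw [← unitaryFrame_mulI, planeForm_unitaryFrame hp, planeForm_unitaryFrame hp, ← sq]
  · change fderiv ℝ X 0 (0, 0, 1) = (-1 : ℝ) • hopfField κ τ p
    rw [hXd, fderiv_bergerParam hκ, hopfField, unitaryFrame_apply]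
    have e : ((-κ / (4 * τ) : ℝ) : ℂ) = -((κ / (4 * τ) : ℝ) : ℂ) := by push_cast; ring
    refine Prod.ext ?_ ?_
    · simp [conformalFactor]
      ring
    · simp [conformalFactor]
      ring

end BergerCharts

/-! ### Isometries of the Cartan model -/

section CartanIsometries

open Complex (normSq)

open ComplexConjugate

/-- The Möbius transformation `w ↦ (a w + b) / (ā - k b̄ w)`, for `|a|² + k |b|² = 1` an isometry of
`(1 + k |w|²)⁻² |dw|²`. -/
noncomputable def mobius (k : ℝ) (a b w : ℂ) : ℂ := (a * w + b) / (conj a - k * conj b * w)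

/-- The primitive of `Im (dζ / (1 - kζ))` that vanishes at `0`, given by the principal branch of the
logarithm. -/
noncomputable def primitiveLog (k : ℝ) (ζ : ℂ) : ℝ :=
  if k = 0 then ζ.im else -(1 / k) * (Complex.log (1 - k * ζ)).im

variable {k : ℝ} {a b w : ℂ}

theorem normSq_mobius_aux (hab : normSq a + k * normSq b = 1) :
    normSq (conj a - k * conj b * w) + k * normSq (a * w + b) = 1 + k * normSq w := by
  simp only [Complex.normSq_apply, Complex.sub_re, Complex.sub_im, Complex.add_re, Complex.add_im,
    Complex.mul_re, Complex.mul_im, Complex.conj_re, Complex.conj_im, Complex.ofReal_re,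
    Complex.ofReal_im] at hab ⊢
  linear_combination (1 + k * (w.re * w.re + w.im * w.im)) * hab

theorem mobius_den_ne_zero (hk : k ≤ 0) (hab : normSq a + k * normSq b = 1)
    (hw : 0 < 1 + k * normSq w) : conj a - k * conj b * w ≠ 0 := by
  intro h
  have e := normSq_mobius_aux (w := w) hab
  rw [h, map_zero] at e
  nlinarith [mul_nonneg (neg_nonneg.2 hk) (Complex.normSq_nonneg (a * w + b))]

theorem one_le_normSq (hk : k ≤ 0) (hab : normSq a + k * normSq b = 1) : 1 ≤ normSq a := by
  nlinarith [mul_nonneg (neg_nonneg.2 hk) (Complex.normSq_nonneg b)]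

theorem ne_zero_of_normSq (hk : k ≤ 0) (hab : normSq a + k * normSq b = 1) : a ≠ 0 := by
  intro h
  have := one_le_normSq hk hab
  rw [h, map_zero] at this
  linarith

theorem one_add_normSq_mobius (hk : k ≤ 0) (hab : normSq a + k * normSq b = 1)
    (hw : 0 < 1 + k * normSq w) :
    (1 + k * normSq (mobius k a b w)) * normSq (conj a - k * conj b * w) = 1 + k * normSq w := by
  have hd : normSq (conj a - k * conj b * w) ≠ 0 :=
    (map_ne_zero _).2 (mobius_den_ne_zero hk hab hw)
  rw [mobius, map_div₀, ← normSq_mobius_aux hab, add_mul, one_mul,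
    mul_assoc k, div_mul_cancel₀ _ hd]

theorem one_add_normSq_mobius_pos (hk : k ≤ 0) (hab : normSq a + k * normSq b = 1)
    (hw : 0 < 1 + k * normSq w) : 0 < 1 + k * normSq (mobius k a b w) := by
  have h := one_add_normSq_mobius hk hab hw
  rw [← h] at hw
  exact pos_of_mul_pos_left hw (Complex.normSq_nonneg _)

/-- Möbius transformations compose like the matrices with rows `(a, b)` and `(-k b̄, ā)`. -/
theorem mobius_mobius {a' b' : ℂ} (hk : k ≤ 0) (hab : normSq a + k * normSq b = 1)
    (hw : 0 < 1 + k * normSq w) :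
    mobius k a' b' (mobius k a b w)
      = mobius k (a' * a - k * b' * conj b) (a' * b + b' * conj a) w := by
  have hd := mobius_den_ne_zero hk hab hw
  have e : ∀ p q r s : ℂ, (p * ((a * w + b) / (conj a - k * conj b * w)) + q)
      / (r - s * ((a * w + b) / (conj a - k * conj b * w)))
      = (p * (a * w + b) + q * (conj a - k * conj b * w))
        / (r * (conj a - k * conj b * w) - s * (a * w + b)) := by
    intro p q r s
    generalize conj a - k * conj b * w = d at hd
    rw [← mul_div_mul_right _ _ hd]
    congr 1 <;> field_simp
  rw [mobius, mobius, e, mobius]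
  simp only [map_add, map_sub, map_mul, Complex.conj_conj, Complex.conj_ofReal]
  congr 1 <;> ring

theorem mobius_inverse (hk : k ≤ 0) (hab : normSq a + k * normSq b = 1)
    (hw : 0 < 1 + k * normSq w) : mobius k (conj a) (-b) (mobius k a b w) = w := by
  rw [mobius_mobius hk hab hw, mobius]
  have h : conj a * a - k * -b * conj b = 1 := by
    have h1 := Complex.normSq_eq_conj_mul_self (z := a)
    have h2 := Complex.normSq_eq_conj_mul_self (z := b)
    have h3 : (normSq a : ℂ) + k * normSq b = 1 := by exact_mod_cast hab
    linear_combination h3 - h1 - k * h2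
  have h0 : conj a * b + -b * conj a = 0 := by ring
  rw [h, h0]
  simp

theorem hasDerivAt_re {f : ℝ → ℂ} {f' : ℂ} {s : ℝ} (hf : HasDerivAt f f' s) :
    HasDerivAt (fun s => (f s).re) f'.re s := Complex.reCLM.hasFDerivAt.comp_hasDerivAt s hf

theorem hasDerivAt_im {f : ℝ → ℂ} {f' : ℂ} {s : ℝ} (hf : HasDerivAt f f' s) :
    HasDerivAt (fun s => (f s).im) f'.im s := Complex.imCLM.hasFDerivAt.comp_hasDerivAt s hf

theorem hasDerivAt_mobius {f : ℝ → ℂ} {f' : ℂ} {s : ℝ} (hk : k ≤ 0)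
    (hab : normSq a + k * normSq b = 1) (hw : 0 < 1 + k * normSq (f s)) (hf : HasDerivAt f f' s) :
    HasDerivAt (fun s => mobius k a b (f s)) (f' / (conj a - k * conj b * f s) ^ 2) s := by
  have hd := mobius_den_ne_zero hk hab hw
  refine (((hf.const_mul a).add_const b).fun_div ((hf.const_mul (k * conj b)).const_sub (conj a))
    hd).congr_deriv ?_
  congr 1
  have h1 := Complex.normSq_eq_conj_mul_self (z := a)
  have h2 := Complex.normSq_eq_conj_mul_self (z := b)
  have h3 : (normSq a : ℂ) + k * normSq b = 1 := by exact_mod_cast hab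
  linear_combination f' * (h3 - h1 - k * h2)

theorem hasDerivAt_primitiveLog {f : ℝ → ℂ} {f' : ℂ} {s : ℝ}
    (hs : 1 - k * f s ∈ Complex.slitPlane) (hf : HasDerivAt f f' s) :
    HasDerivAt (fun s => primitiveLog k (f s)) (f' / (1 - k * f s)).im s := by
  unfold primitiveLog
  split_ifs with hk
  · subst hk
    simpa using hasDerivAt_im hf
  · have h := ((hf.const_mul (k : ℂ)).const_sub 1).clog_real hs
    refine ((hasDerivAt_im h).const_mul (-(1 / k))).congr_deriv ?_
    have e : -(k * f') / (1 - k * f s) = ((-k : ℝ) : ℂ) * (f' / (1 - k * f s)) := by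
      push_cast; ring
    rw [e, Complex.im_ofReal_mul]
    field_simp

theorem contDiffAt_primitiveLog {E : Type*} [NormedAddCommGroup E] [NormedSpace ℝ E] {f : E → ℂ}
    {x : E} (hs : 1 - k * f x ∈ Complex.slitPlane) (hf : ContDiffAt ℝ ∞ f x) :
    ContDiffAt ℝ ∞ (fun x => primitiveLog k (f x)) x := by
  unfold primitiveLog
  split_ifs with hk
  · exact Complex.imCLM.contDiff.contDiffAt.comp x hf
  · have h : ContDiffAt ℝ ∞ (fun x => Complex.log (1 - k * f x)) x :=
      ContDiffAt.comp (f := fun x => 1 - k * f x) (g := Complex.log) x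
        ((Complex.contDiffAt_log hs).restrict_scalars ℝ)
        (contDiffAt_const.sub (contDiffAt_const.mul hf))
    exact contDiffAt_const.mul (Complex.imCLM.contDiff.contDiffAt.comp x h)

/-- As `k ≤ 0`, the domain is mapped to `|kζ| < 1`, so that the logarithm stays off its cut. -/
theorem one_sub_mem_slitPlane (hk : k ≤ 0) (hab : normSq a + k * normSq b = 1)
    (hw : 0 < 1 + k * normSq w) : 1 - k * (conj b * w / conj a) ∈ Complex.slitPlane := by
  refine Complex.mem_slitPlane_iff.2 (Or.inl ?_)
  have ha : 0 < normSq a := by linarith [one_le_normSq hk hab]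
  set ξ := (k : ℂ) * (conj b * w / conj a) with hξ
  have h : normSq ξ < 1 := by
    rw [hξ, map_mul, map_div₀, map_mul, Complex.normSq_conj, Complex.normSq_conj,
      Complex.normSq_ofReal, mul_div_assoc', div_lt_one ha]
    have h1 := one_le_normSq hk hab
    nlinarith [mul_nonneg (sub_nonneg.2 h1) hw.le]
  rw [Complex.normSq_apply] at h
  simp only [Complex.sub_re, Complex.one_re]
  nlinarith [sq_nonneg ξ.im, sq_nonneg (ξ.re - 1)]

/-- The projection `(x, y, z) ↦ x + iy`. -/
noncomputable def baseCLM : ℝ × ℝ × ℝ →L[ℝ] ℂ :=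
  coordX.smulRight (1 : ℂ) + coordY.smulRight Complex.I

@[simp] theorem baseCLM_re (p : ℝ × ℝ × ℝ) : (baseCLM p).re = p.1 := by simp [baseCLM]
@[simp] theorem baseCLM_im (p : ℝ × ℝ × ℝ) : (baseCLM p).im = p.2.1 := by simp [baseCLM]

theorem baseCLM_mk (ζ : ℂ) (z : ℝ) : baseCLM (ζ.re, ζ.im, z) = ζ := Complex.ext (by simp) (by simp)

variable {κ τ : ℝ}

theorem mem_cartanModel {p : ℝ × ℝ × ℝ} :
    p ∈ (cartanModel κ τ).carrier ↔ 0 < 1 + κ / 4 * normSq (baseCLM p) := by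
  rw [Complex.normSq_apply, baseCLM_re, baseCLM_im, ← sq, ← sq]
  exact one_div_pos (G₀ := ℝ)

theorem isOpen_cartanModel : IsOpen (cartanModel κ τ).carrier := by
  have h : IsOpen {p : ℝ × ℝ × ℝ | 0 < 1 + κ / 4 * normSq (baseCLM p)} :=
    isOpen_lt continuous_const
      (continuous_const.add (continuous_const.mul
        (Complex.continuous_normSq.comp baseCLM.continuous)))
  have e : (cartanModel κ τ).carrier = {p : ℝ × ℝ × ℝ | 0 < 1 + κ / 4 * normSq (baseCLM p)} :=
    Set.ext fun p => mem_cartanModel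
  exact e ▸ h

theorem conformalFactor_eq_inv (p : ℝ × ℝ × ℝ) :
    conformalFactor κ p.1 p.2.1 = (1 + κ / 4 * normSq (baseCLM p))⁻¹ := by
  rw [Complex.normSq_apply, baseCLM_re, baseCLM_im, ← sq, ← sq, conformalFactor, one_div]

theorem cartanModel_metric_self (p v : ℝ × ℝ × ℝ) : (cartanModel κ τ).metric p v v =
    (1 + κ / 4 * normSq (baseCLM p))⁻¹ ^ 2 * normSq (baseCLM v)
      + (v.2.2 - (1 + κ / 4 * normSq (baseCLM p))⁻¹ * τ
        * (conj (baseCLM p) * baseCLM v).im) ^ 2 := by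
  rw [← conformalFactor_eq_inv]
  change conformalFactor κ p.1 p.2.1 ^ 2 * (v.1 * v.1 + v.2.1 * v.2.1)
      + cartanForm κ τ p v * cartanForm κ τ p v = _
  simp [cartanForm, Complex.normSq_apply]
  ring

/-- The isometry of the Cartan model covering the Möbius transformation of `a`, `b`, followed by
the vertical translation by `c`. -/
noncomputable def cartanMove (κ τ : ℝ) (a b : ℂ) (c : ℝ) (p : ℝ × ℝ × ℝ) : ℝ × ℝ × ℝ :=
  ((mobius (κ / 4) a b (baseCLM p)).re, (mobius (κ / 4) a b (baseCLM p)).im,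
    p.2.2 + (c + τ * primitiveLog (κ / 4) (conj b * baseCLM p / conj a)))

theorem baseCLM_cartanMove (c : ℝ) (p : ℝ × ℝ × ℝ) :
    baseCLM (cartanMove κ τ a b c p) = mobius (κ / 4) a b (baseCLM p) := baseCLM_mk _ _

theorem cartanMove_mem (hκ : κ ≤ 0) (hab : normSq a + κ / 4 * normSq b = 1) (c : ℝ)
    {p : ℝ × ℝ × ℝ} (hp : p ∈ (cartanModel κ τ).carrier) :
    cartanMove κ τ a b c p ∈ (cartanModel κ τ).carrier := by
  refine mem_cartanModel.2 ?_
  rw [baseCLM_cartanMove]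
  exact one_add_normSq_mobius_pos (by linarith) hab (mem_cartanModel.1 hp)

theorem contDiffAt_cartanMove {E : Type*} [NormedAddCommGroup E] [NormedSpace ℝ E]
    {A B : E → ℂ} {c : E → ℝ} {p : E → ℝ × ℝ × ℝ} {x : E} (hκ : κ ≤ 0)
    (hab : normSq (A x) + κ / 4 * normSq (B x) = 1) (hpx : p x ∈ (cartanModel κ τ).carrier)
    (hA : ContDiffAt ℝ ∞ A x) (hB : ContDiffAt ℝ ∞ B x) (hc : ContDiffAt ℝ ∞ c x)
    (hp : ContDiffAt ℝ ∞ p x) :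
    ContDiffAt ℝ ∞ (fun x => cartanMove κ τ (A x) (B x) (c x) (p x)) x := by
  have hk : κ / 4 ≤ 0 := by linarith
  have hw := mem_cartanModel.1 hpx
  have hb : ContDiffAt ℝ ∞ (fun x => baseCLM (p x)) x := baseCLM.contDiff.contDiffAt.comp x hp
  have hconj : ∀ {f : E → ℂ}, ContDiffAt ℝ ∞ f x → ContDiffAt ℝ ∞ (fun x => conj (f x)) x :=
    fun hf => Complex.conjCLE.contDiff.contDiffAt.comp x hf
  have hm : ContDiffAt ℝ ∞ (fun x => mobius (κ / 4) (A x) (B x) (baseCLM (p x))) x := by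
    have h1 : ContDiffAt ℝ ∞
        (fun x => (conj (A x) - (κ / 4 : ℝ) * conj (B x) * baseCLM (p x))⁻¹) x :=
      ((hconj hA).sub ((contDiffAt_const.mul (hconj hB)).mul hb)).inv
        (mobius_den_ne_zero hk hab hw)
    exact ((hA.mul hb).add hB).mul h1
  have ha : conj (A x) ≠ 0 := (map_ne_zero _).2 (ne_zero_of_normSq hk hab)
  have hL : ContDiffAt ℝ ∞
      (fun x => primitiveLog (κ / 4) (conj (B x) * baseCLM (p x) / conj (A x))) x :=
    contDiffAt_primitiveLog (one_sub_mem_slitPlane hk hab hw)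
      (((hconj hB).mul hb).mul ((hconj hA).inv ha))
  exact (Complex.reCLM.contDiff.contDiffAt.comp x hm).prodMk
    ((Complex.imCLM.contDiff.contDiffAt.comp x hm).prodMk
      (hp.snd.snd.add (hc.add (contDiffAt_const.mul hL))))

theorem hasDerivAt_cartanMove (hκ : κ ≤ 0) (hab : normSq a + κ / 4 * normSq b = 1) (c : ℝ)
    {p : ℝ → ℝ × ℝ × ℝ} {p' : ℝ × ℝ × ℝ} {s : ℝ} (hps : p s ∈ (cartanModel κ τ).carrier)
    (hp : HasDerivAt p p' s) : HasDerivAt (fun s => cartanMove κ τ a b c (p s))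
      ((baseCLM p' / (conj a - (κ / 4 : ℝ) * conj b * baseCLM (p s)) ^ 2).re,
        (baseCLM p' / (conj a - (κ / 4 : ℝ) * conj b * baseCLM (p s)) ^ 2).im,
        p'.2.2 + τ * (conj b * baseCLM p' / (conj a - (κ / 4 : ℝ) * conj b * baseCLM (p s))).im)
      s := by
  have hk : κ / 4 ≤ 0 := by linarith
  have hw := mem_cartanModel.1 hps
  have hb : HasDerivAt (fun s => baseCLM (p s)) (baseCLM p') s :=
    baseCLM.hasFDerivAt.comp_hasDerivAt s hp
  have hz : HasDerivAt (fun s => (p s).2.2) p'.2.2 s := coordZ.hasFDerivAt.comp_hasDerivAt s hp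
  have hm := hasDerivAt_mobius (f := fun s => baseCLM (p s)) hk hab hw hb
  have ha : conj a ≠ 0 := (map_ne_zero _).2 (ne_zero_of_normSq hk hab)
  have hL := hasDerivAt_primitiveLog (f := fun s => conj b * baseCLM (p s) / conj a)
    (one_sub_mem_slitPlane hk hab hw)
    ((hb.const_mul (conj b)).div_const (conj a))
  refine ((hasDerivAt_re hm).prodMk ((hasDerivAt_im hm).prodMk
      (hz.add ((hL.const_mul τ).const_add c)))).congr_deriv ?_
  have e : conj b * baseCLM p' / conj a / (1 - (κ / 4 : ℝ) * (conj b * baseCLM (p s) / conj a))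
      = conj b * baseCLM p' / (conj a - (κ / 4 : ℝ) * conj b * baseCLM (p s)) := by
    rw [div_div]
    congr 1
    field_simp
  rw [e]

/-- The correction `τ Im(b̄ dw / (ā - k b̄ w))` of the vertical coordinate makes up for the change
of the connection form under the Möbius transformation. -/
theorem cartanMove_metric (hκ : κ ≤ 0) (hab : normSq a + κ / 4 * normSq b = 1) (c : ℝ)
    {p : ℝ × ℝ × ℝ} (hp : p ∈ (cartanModel κ τ).carrier) (u : ℝ × ℝ × ℝ) :
    (cartanModel κ τ).metric (cartanMove κ τ a b c p)
      ((baseCLM u / (conj a - (κ / 4 : ℝ) * conj b * baseCLM p) ^ 2).re,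
        (baseCLM u / (conj a - (κ / 4 : ℝ) * conj b * baseCLM p) ^ 2).im,
        u.2.2 + τ * (conj b * baseCLM u / (conj a - (κ / 4 : ℝ) * conj b * baseCLM p)).im)
      ((baseCLM u / (conj a - (κ / 4 : ℝ) * conj b * baseCLM p) ^ 2).re,
        (baseCLM u / (conj a - (κ / 4 : ℝ) * conj b * baseCLM p) ^ 2).im,
        u.2.2 + τ * (conj b * baseCLM u / (conj a - (κ / 4 : ℝ) * conj b * baseCLM p)).im)
      = (cartanModel κ τ).metric p u u := by
  have hk : κ / 4 ≤ 0 := by linarith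
  have hw := mem_cartanModel.1 hp
  refine (cartanModel_metric_self _ _).trans ((?_ : _ = _).trans (cartanModel_metric_self _ _).symm)
  rw [baseCLM_cartanMove, baseCLM_mk]
  have hd := mobius_den_ne_zero hk hab hw
  have hm := one_add_normSq_mobius hk hab hw
  have hm0 := one_add_normSq_mobius_pos hk hab hw
  generalize hW : baseCLM p = W at *
  generalize baseCLM u = U
  generalize κ / 4 = k at *
  set d := conj a - (k : ℂ) * conj b * W with hd'
  have hd2 : normSq d ≠ 0 := (map_ne_zero _).2 hd
  have e1 : (1 + k * normSq (mobius k a b W))⁻¹ = (1 + k * normSq W)⁻¹ * normSq d := by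
    rw [← hm]; field_simp
  have e2 : (((1 + k * normSq W)⁻¹ * normSq d : ℝ) : ℂ)
      * (conj (mobius k a b W) * (U / d ^ 2)) - conj b * U / d
      = (((1 + k * normSq W)⁻¹ : ℝ) : ℂ) * (conj W * U) := by
    have hd3 : conj d ≠ 0 := (map_ne_zero _).2 hd
    have hw' : (1 + k * normSq W : ℂ) ≠ 0 := by exact_mod_cast hw.ne'
    rw [mobius, ← hd', map_div₀]
    push_cast
    rw [Complex.normSq_eq_conj_mul_self (z := d)]
    field_simp
    rw [Complex.normSq_eq_conj_mul_self (z := W), hd']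
    simp only [map_add, map_mul]
    ring
  have e3 : (1 + k * normSq W)⁻¹ * normSq d * τ * (conj (mobius k a b W) * (U / d ^ 2)).im
      - τ * (conj b * U / d).im = (1 + k * normSq W)⁻¹ * τ * (conj W * U).im := by
    have := congrArg Complex.im e2
    rw [Complex.sub_im, Complex.im_ofReal_mul, Complex.im_ofReal_mul] at this
    linear_combination τ * this
  rw [e1, map_div₀, map_pow]
  simp only
  rw [← e3]
  field_simp
  ring

end CartanIsometries

/-! ### Charts of the Cartan model -/

section CartanCharts

open Complex (normSq)

open ComplexConjugate

/-- The change of coordinates `(W, z) ↦ (exp(iτz) W, z)`. -/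
noncomputable def verticalTwist (τ : ℝ) (x : ℝ × ℝ × ℝ) : ℝ × ℝ × ℝ :=
  ((Complex.exp (((τ * x.2.2 : ℝ) : ℂ) * Complex.I) * baseCLM x).re,
    (Complex.exp (((τ * x.2.2 : ℝ) : ℂ) * Complex.I) * baseCLM x).im, x.2.2)

theorem baseCLM_verticalTwist (τ : ℝ) (x : ℝ × ℝ × ℝ) : baseCLM (verticalTwist τ x) =
    Complex.exp (((τ * x.2.2 : ℝ) : ℂ) * Complex.I) * baseCLM x := baseCLM_mk _ _

theorem normSq_exp_ofReal_mul_I (θ : ℝ) : normSq (Complex.exp ((θ : ℂ) * Complex.I)) = 1 := by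
  rw [← Complex.sq_norm, Complex.norm_exp_ofReal_mul_I, one_pow]

theorem ext_baseCLM {x y : ℝ × ℝ × ℝ} (h : baseCLM x = baseCLM y) (hz : x.2.2 = y.2.2) : x = y := by
  refine Prod.ext ?_ (Prod.ext ?_ hz)
  · simpa using congrArg Complex.re h
  · simpa using congrArg Complex.im h

theorem verticalTwist_neg (τ : ℝ) (x : ℝ × ℝ × ℝ) :
    verticalTwist (-τ) (verticalTwist τ x) = x := by
  refine ext_baseCLM ?_ rfl
  rw [baseCLM_verticalTwist, baseCLM_verticalTwist, ← mul_assoc, ← Complex.exp_add]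
  have e : (((-τ * (verticalTwist τ x).2.2 : ℝ) : ℂ) * Complex.I
      + ((τ * x.2.2 : ℝ) : ℂ) * Complex.I) = 0 := by
    change (((-τ * x.2.2 : ℝ) : ℂ) * Complex.I + ((τ * x.2.2 : ℝ) : ℂ) * Complex.I) = 0
    push_cast; ring
  rw [e, Complex.exp_zero, one_mul]

theorem contDiff_verticalTwist (τ : ℝ) : ContDiff ℝ ∞ (verticalTwist τ) := by
  have h1 : ContDiff ℝ ∞ fun x : ℝ × ℝ × ℝ =>
      Complex.exp (((τ * x.2.2 : ℝ) : ℂ) * Complex.I) * baseCLM x :=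
    (((Complex.ofRealCLM.contDiff.comp (f := fun x : ℝ × ℝ × ℝ => τ * x.2.2)
      (by fun_prop)).mul contDiff_const).cexp).mul baseCLM.contDiff
  exact (Complex.reCLM.contDiff.comp h1).prodMk
    ((Complex.imCLM.contDiff.comp h1).prodMk (by fun_prop))

variable {κ τ : ℝ}

theorem verticalTwist_mem_iff (σ : ℝ) {x : ℝ × ℝ × ℝ} :
    verticalTwist σ x ∈ (cartanModel κ τ).carrier ↔ x ∈ (cartanModel κ τ).carrier := by
  refine mem_cartanModel.trans (Iff.trans ?_ mem_cartanModel.symm)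
  rw [baseCLM_verticalTwist, map_mul, normSq_exp_ofReal_mul_I, one_mul]

/-- The derivative of `verticalTwist τ` at `x`. -/
noncomputable def verticalTwistDeriv (τ : ℝ) (x u : ℝ × ℝ × ℝ) : ℝ × ℝ × ℝ :=
  ((Complex.exp (((τ * x.2.2 : ℝ) : ℂ) * Complex.I)
      * (baseCLM u + ((τ * u.2.2 : ℝ) : ℂ) * Complex.I * baseCLM x)).re,
    (Complex.exp (((τ * x.2.2 : ℝ) : ℂ) * Complex.I)
      * (baseCLM u + ((τ * u.2.2 : ℝ) : ℂ) * Complex.I * baseCLM x)).im, u.2.2)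

theorem hasDerivAt_verticalTwist (τ : ℝ) {p : ℝ → ℝ × ℝ × ℝ} {u : ℝ × ℝ × ℝ} {s : ℝ}
    (hp : HasDerivAt p u s) : HasDerivAt (fun s => verticalTwist τ (p s))
      (verticalTwistDeriv τ (p s) u) s := by
  have hb : HasDerivAt (fun s => baseCLM (p s)) (baseCLM u) s :=
    baseCLM.hasFDerivAt.comp_hasDerivAt s hp
  have hz : HasDerivAt (fun s => (p s).2.2) u.2.2 s := coordZ.hasFDerivAt.comp_hasDerivAt s hp
  have h := ((((hz.const_mul τ).ofReal_comp).mul_const Complex.I).cexp).fun_mul hb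
  refine ((hasDerivAt_re h).prodMk ((hasDerivAt_im h).prodMk hz)).congr_deriv ?_
  have e : ∀ E U V W : ℂ, E * (V * Complex.I) * W + E * U = E * (U + V * Complex.I * W) := by
    intro E U V W; ring
  rw [e]
  rfl

/-- In the twisted coordinates the metric of the Cartan model is `rotMetric`. -/
theorem verticalTwist_metric (x u : ℝ × ℝ × ℝ) :
    (cartanModel κ τ).metric (verticalTwist τ x) (verticalTwistDeriv τ x u)
      (verticalTwistDeriv τ x u) = rotMetric κ τ x u u := by
  refine (cartanModel_metric_self _ _).trans ?_
  have e1 : baseCLM (verticalTwistDeriv τ x u) = Complex.exp (((τ * x.2.2 : ℝ) : ℂ) * Complex.I)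
      * (baseCLM u + ((τ * u.2.2 : ℝ) : ℂ) * Complex.I * baseCLM x) := baseCLM_mk _ _
  have e2 : conj (baseCLM (verticalTwist τ x)) * baseCLM (verticalTwistDeriv τ x u)
      = conj (baseCLM x) * (baseCLM u + ((τ * u.2.2 : ℝ) : ℂ) * Complex.I * baseCLM x) := by
    have h := Complex.normSq_eq_conj_mul_self (z := Complex.exp (((τ * x.2.2 : ℝ) : ℂ) * Complex.I))
    rw [normSq_exp_ofReal_mul_I, Complex.ofReal_one] at h
    rw [baseCLM_verticalTwist, e1, map_mul]
    linear_combination -(conj (baseCLM x)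
      * (baseCLM u + ((τ * u.2.2 : ℝ) : ℂ) * Complex.I * baseCLM x)) * h
  rw [e2, e1, baseCLM_verticalTwist, map_mul, map_mul, normSq_exp_ofReal_mul_I, one_mul, one_mul,
    ← conformalFactor_eq_inv, rotMetric_apply]
  change _ + (u.2.2 - _) ^ 2 = _
  simp [Complex.normSq_apply]
  ring

theorem primitiveLog_zero (k : ℝ) : primitiveLog k 0 = 0 := by simp [primitiveLog]

/-- The Cartan model has charts of the required form at all points: move the chart
`verticalTwist τ` at the origin by an isometry of the model. -/
theorem cartanModel_isometricChart (hκ : κ ≤ 0) {p : ℝ × ℝ × ℝ}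
    (hp : p ∈ (cartanModel κ τ).carrier) :
    Nonempty (IsometricChart (cartanModel κ τ) κ τ p) := by
  have hk : κ / 4 ≤ 0 := by linarith
  have hw := mem_cartanModel.1 hp
  set ρ : ℝ := (√(1 + κ / 4 * normSq (baseCLM p)))⁻¹ with hρ
  have hρ0 : 0 < ρ := inv_pos.2 (Real.sqrt_pos.2 hw)
  have hρ2 : ρ ^ 2 * (1 + κ / 4 * normSq (baseCLM p)) = 1 := by
    rw [hρ, inv_pow, Real.sq_sqrt hw.le]; exact inv_mul_cancel₀ hw.ne'
  set a : ℂ := (ρ : ℂ) with ha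
  set b : ℂ := ρ * baseCLM p with hb
  have ha0 : a ≠ 0 := Complex.ofReal_ne_zero.2 hρ0.ne'
  have hab : normSq a + κ / 4 * normSq b = 1 := by
    rw [ha, hb, map_mul, Complex.normSq_ofReal]; linear_combination hρ2
  have hab' : normSq (conj a) + κ / 4 * normSq (-b) = 1 := by
    rw [Complex.normSq_conj, Complex.normSq_neg]; exact hab
  let X : ℝ × ℝ × ℝ → ℝ × ℝ × ℝ := fun x => cartanMove κ τ a b p.2.2 (verticalTwist τ x)
  let m : ℝ × ℝ × ℝ → ℂ := fun q => mobius (κ / 4) (conj a) (-b) (baseCLM q)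
  let Y₀ : ℝ × ℝ × ℝ → ℝ × ℝ × ℝ := fun q =>
    ((m q).re, (m q).im, q.2.2 - (p.2.2 + τ * primitiveLog (κ / 4) (conj b * m q / conj a)))
  let Y : ℝ × ℝ × ℝ → ℝ × ℝ × ℝ := fun q => verticalTwist (-τ) (Y₀ q)
  let S : Set (ℝ × ℝ × ℝ) := (cartanModel κ τ).carrier
  have hS : IsOpen S := isOpen_cartanModel
  have hbY : ∀ q, baseCLM (Y₀ q) = m q := fun q => baseCLM_mk _ _
  have hmS : ∀ q ∈ S, 0 < 1 + κ / 4 * normSq (m q) := fun q hq =>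
    one_add_normSq_mobius_pos hk hab' (mem_cartanModel.1 hq)
  have hYS : ∀ q ∈ S, Y₀ q ∈ S := fun q hq => by
    refine mem_cartanModel.2 ?_
    rw [hbY]; exact hmS q hq
  have hX : ContDiffOn ℝ ∞ X S := fun x hx =>
    (contDiffAt_cartanMove (A := fun _ => a) (B := fun _ => b) (c := fun _ => p.2.2) hκ hab
      ((verticalTwist_mem_iff τ).2 hx) contDiffAt_const contDiffAt_const contDiffAt_const
      (contDiff_verticalTwist τ).contDiffAt).contDiffWithinAt
  have hY : ContDiffOn ℝ ∞ Y S := by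
    refine (contDiff_verticalTwist (-τ)).comp_contDiffOn fun q hq => ContDiffAt.contDiffWithinAt ?_
    have h1 : ContDiffAt ℝ ∞ (fun q => cartanMove κ τ (conj a) (-b) 0 q) q :=
      contDiffAt_cartanMove (A := fun _ => conj a) (B := fun _ => -b) (c := fun _ => 0) hκ hab'
        hq contDiffAt_const contDiffAt_const contDiffAt_const contDiffAt_id
    have h2 : ContDiffAt ℝ ∞ m q := by
      have h3 : m = fun q => baseCLM (cartanMove κ τ (conj a) (-b) 0 q) :=
        funext fun q => (baseCLM_cartanMove _ _).symm
      rw [h3]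
      exact baseCLM.contDiff.contDiffAt.comp q h1
    have h4 : ContDiffAt ℝ ∞ (fun q => primitiveLog (κ / 4) (conj b * m q / conj a)) q :=
      contDiffAt_primitiveLog (one_sub_mem_slitPlane hk hab (hmS q hq))
        ((contDiffAt_const.mul h2).mul contDiffAt_const)
    exact (Complex.reCLM.contDiff.contDiffAt.comp q h2).prodMk
      ((Complex.imCLM.contDiff.contDiffAt.comp q h2).prodMk
        (contDiffAt_id.snd.snd.sub (contDiffAt_const.add (contDiffAt_const.mul h4))))
  have hXd : ∀ x ∈ S, ∀ u, fderiv ℝ X x u =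
      ((baseCLM (verticalTwistDeriv τ x u)
        / (conj a - (κ / 4 : ℝ) * conj b * baseCLM (verticalTwist τ x)) ^ 2).re,
      (baseCLM (verticalTwistDeriv τ x u)
        / (conj a - (κ / 4 : ℝ) * conj b * baseCLM (verticalTwist τ x)) ^ 2).im,
      u.2.2 + τ * (conj b * baseCLM (verticalTwistDeriv τ x u)
        / (conj a - (κ / 4 : ℝ) * conj b * baseCLM (verticalTwist τ x))).im) := by
    intro x hx u
    have hline : HasDerivAt (fun t : ℝ => x + t • u) u 0 := by
      simpa using ((hasDerivAt_id (0 : ℝ)).smul_const u).const_add x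
    have hx0 : x + (0 : ℝ) • u = x := by rw [zero_smul, add_zero]
    have hXx : HasFDerivAt X (fderiv ℝ X x) (x + (0 : ℝ) • u) := by
      rw [hx0]
      exact (((hX x hx).contDiffAt (hS.mem_nhds hx)).differentiableAt (by simp)).hasFDerivAt
    have d1 := hXx.comp_hasDerivAt 0 hline
    have d2 := hasDerivAt_cartanMove (p := fun t : ℝ => verticalTwist τ (x + t • u)) hκ hab p.2.2
      (by simp only [hx0]; exact (verticalTwist_mem_iff τ).2 hx) (hasDerivAt_verticalTwist τ hline)
    have e := d1.unique d2
    simp only [hx0] at e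
    exact e
  refine ⟨{ toFun := X, invFun := Y, source := S, target := S
            isOpen_source := hS, isOpen_target := hS
            zero_mem := mem_cartanModel.2 (by simp)
            map_zero := ?_
            contDiffOn_toFun := hX
            contDiffOn_invFun := hY
            map_source := ?_
            left_inv := ?_
            map_target := ?_
            isometric := ?_
            vertical := ⟨1, ?_⟩ }⟩
  · have e0 : verticalTwist τ 0 = 0 := by simp [verticalTwist]
    refine ext_baseCLM ?_ ?_
    · change baseCLM (cartanMove κ τ a b p.2.2 (verticalTwist τ 0)) = _
      rw [e0, baseCLM_cartanMove, mobius, map_zero, mul_zero, mul_zero, zero_add, sub_zero, ha, hb,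
        Complex.conj_ofReal]
      exact mul_div_cancel_left₀ _ ha0
    · change (verticalTwist τ 0).2.2 + (p.2.2 + τ * primitiveLog (κ / 4)
        (conj b * baseCLM (verticalTwist τ 0) / conj a)) = p.2.2
      rw [e0, map_zero, mul_zero, zero_div, primitiveLog_zero]
      simp
  · intro x hx
    have := cartanMove_mem hκ hab p.2.2 ((verticalTwist_mem_iff τ).2 hx)
    exact ⟨this, this⟩
  · intro x hx
    have hx' := (verticalTwist_mem_iff τ).2 hx
    have h1 : m (X x) = baseCLM (verticalTwist τ x) := by
      change mobius (κ / 4) (conj a) (-b)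
        (baseCLM (cartanMove κ τ a b p.2.2 (verticalTwist τ x))) = _
      rw [baseCLM_cartanMove, mobius_inverse hk hab (mem_cartanModel.1 hx')]
    have h2 : Y₀ (X x) = verticalTwist τ x := by
      refine ext_baseCLM ((hbY _).trans h1) ?_
      change (X x).2.2 - (p.2.2 + τ * primitiveLog (κ / 4) (conj b * m (X x) / conj a)) = _
      rw [h1]
      exact add_sub_cancel_right _ _
    change verticalTwist (-τ) (Y₀ (X x)) = x
    rw [h2, verticalTwist_neg]
  · intro (q : ℝ × ℝ × ℝ) hq _
    refine ⟨(verticalTwist_mem_iff (-τ)).2 (hYS q hq), ?_⟩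
    change cartanMove κ τ a b p.2.2 (verticalTwist τ (verticalTwist (-τ) (Y₀ q))) = q
    have e : verticalTwist τ (verticalTwist (-τ) (Y₀ q)) = Y₀ q := by
      simpa using verticalTwist_neg (-τ) (Y₀ q)
    rw [e]
    refine ext_baseCLM ?_ ?_
    · rw [baseCLM_cartanMove, hbY]
      simpa using mobius_inverse hk hab' (mem_cartanModel.1 hq)
    · change (q.2.2 - (p.2.2 + τ * primitiveLog (κ / 4) (conj b * m q / conj a)))
        + (p.2.2 + τ * primitiveLog (κ / 4) (conj b * baseCLM (Y₀ q) / conj a)) = q.2.2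
      rw [hbY]
      exact sub_add_cancel _ _
  · intro x hx u
    rw [← verticalTwist_metric]
    refine Eq.trans ?_ (cartanMove_metric hκ hab p.2.2 ((verticalTwist_mem_iff τ).2 hx)
      (verticalTwistDeriv τ x u))
    change (cartanModel κ τ).metric (X x) (fderiv ℝ X x u) (fderiv ℝ X x u) = _
    rw [hXd x hx u]
    rfl
  · change fderiv ℝ X 0 (0, 0, 1) = (1 : ℝ) • ((0, 0, 1) : ℝ × ℝ × ℝ)
    rw [hXd 0 (mem_cartanModel.2 (by simp))]
    have e : verticalTwistDeriv τ 0 (0, 0, 1) = (0, 0, 1) := by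
      simp [verticalTwistDeriv, baseCLM]
    have e' : baseCLM (0, 0, 1) = 0 := Complex.ext (by simp) (by simp)
    rw [e, e']
    simp

theorem cartanModel_preconnectedSpace (hκ : κ ≤ 0) :
    PreconnectedSpace (cartanModel κ τ).carrier := by
  refine isPreconnected_iff_preconnectedSpace.1 ?_
  have h : StarConvex ℝ (0 : ℝ × ℝ × ℝ) (cartanModel κ τ).carrier := by
    refine starConvex_zero_iff.2 fun x hx t ht0 ht1 => mem_cartanModel.2 ?_
    have h1 := mem_cartanModel.1 hx
    rw [map_smul, Complex.real_smul, map_mul, Complex.normSq_ofReal]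
    have h2 := Complex.normSq_nonneg (baseCLM x)
    nlinarith [mul_nonneg (mul_nonneg (neg_nonneg.2 hκ) h2) (by nlinarith : 0 ≤ 1 - t * t)]
  exact (h.isPathConnected
    (mem_cartanModel.2 (by simp))).isConnected.isPreconnected

end CartanCharts

/-! ### Killing flows of the Cartan model -/

section CartanFlows

open Complex (normSq)

open ComplexConjugate

/-- The solutions of `y'' = ν y` with initial values `(1, 0)` and `(0, 1)`. -/
theorem exists_generalized_cos_sin (ν : ℝ) : ∃ C S : ℝ → ℝ, ContDiff ℝ ∞ C ∧ ContDiff ℝ ∞ S ∧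
    (∀ t, HasDerivAt C (ν * S t) t) ∧ (∀ t, HasDerivAt S (C t) t) ∧ C 0 = 1 ∧ S 0 = 0 ∧
    (∀ t, C t ^ 2 - ν * S t ^ 2 = 1) ∧
    (∀ s t, C (s + t) = C s * C t + ν * (S s * S t)) ∧
    ∀ s t, S (s + t) = S s * C t + C s * S t := by
  rcases lt_trichotomy ν 0 with h | rfl | h
  · obtain ⟨m, hm, rfl⟩ : ∃ m : ℝ, 0 < m ∧ ν = -m ^ 2 :=
      ⟨√(-ν), Real.sqrt_pos.2 (by linarith), by rw [Real.sq_sqrt (by linarith)]; ring⟩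
    have hl : ∀ t : ℝ, HasDerivAt (fun t => m * t) m t := fun t => by
      simpa using (hasDerivAt_id t).const_mul m
    refine ⟨fun t => Real.cos (m * t), fun t => Real.sin (m * t) / m, by fun_prop, by fun_prop,
      fun t => ?_, fun t => ?_, by simp, by simp, fun t => ?_, fun s t => ?_, fun s t => ?_⟩
    · exact (hl t).cos.congr_deriv (by field_simp)
    · exact ((hl t).sin.div_const m).congr_deriv (by field_simp)
    · have := Real.sin_sq_add_cos_sq (m * t)
      field_simp
      linarith
    · simp only [mul_add, Real.cos_add]; field_simp; ring
    · simp only [mul_add, Real.sin_add]; field_simp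
  · exact ⟨fun _ => 1, fun t => t, by fun_prop, by fun_prop,
      fun t => by simpa using hasDerivAt_const t (1 : ℝ), fun t => hasDerivAt_id t, rfl, rfl,
      fun t => by simp, fun s t => by simp, fun s t => by simp⟩
  · obtain ⟨m, hm, rfl⟩ : ∃ m : ℝ, 0 < m ∧ ν = m ^ 2 :=
      ⟨√ν, Real.sqrt_pos.2 h, (Real.sq_sqrt h.le).symm⟩
    have hl : ∀ t : ℝ, HasDerivAt (fun t => m * t) m t := fun t => by
      simpa using (hasDerivAt_id t).const_mul m
    refine ⟨fun t => Real.cosh (m * t), fun t => Real.sinh (m * t) / m, by fun_prop, by fun_prop,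
      fun t => ?_, fun t => ?_, by simp, by simp, fun t => ?_, fun s t => ?_, fun s t => ?_⟩
    · exact (hl t).cosh.congr_deriv (by field_simp)
    · exact ((hl t).sinh.div_const m).congr_deriv (by field_simp)
    · have := Real.cosh_sq_sub_sinh_sq (m * t)
      field_simp
      linarith
    · simp only [mul_add, Real.cosh_add]; field_simp
    · simp only [mul_add, Real.sinh_add]; field_simp

theorem exists_smooth_primitive {g : ℝ → ℝ} (hg : ContDiff ℝ ∞ g) :
    ∃ G : ℝ → ℝ, ContDiff ℝ ∞ G ∧ G 0 = 0 ∧ ∀ t, HasDerivAt G (g t) t := by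
  have h : ∀ t, HasDerivAt (fun t => ∫ x in (0 : ℝ)..t, g x) (g t) t := fun t =>
    (hg.continuous).integral_hasStrictDerivAt 0 t |>.hasDerivAt
  refine ⟨fun t => ∫ x in (0 : ℝ)..t, g x, contDiff_infty_iff_deriv.2
    ⟨fun t => (h t).differentiableAt, ?_⟩, by simp, h⟩
  rwa [funext fun t => (h t).deriv]

theorem eq_of_hasDerivAt_eq {F : Type*} [NormedAddCommGroup F] [NormedSpace ℝ F] {f g f' : ℝ → F}
    (hf : ∀ t, HasDerivAt f (f' t) t) (hg : ∀ t, HasDerivAt g (f' t) t) (h0 : f 0 = g 0) (t : ℝ) :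
    f t = g t := by
  have h : ∀ t, HasDerivAt (fun t => f t - g t) 0 t := fun t =>
    ((hf t).fun_sub (hg t)).congr_deriv (sub_self _)
  have := is_const_of_deriv_eq_zero (fun t => (h t).differentiableAt) (fun t => (h t).deriv) t 0
  rwa [h0, sub_self, sub_eq_zero] at this

variable {κ τ : ℝ}

theorem mobius_one_zero (k : ℝ) (w : ℂ) : mobius k 1 0 w = w := by simp [mobius]

/-- The Killing field `w' = β + 2iα w + k β̄ w²`, `z' = v + τ Im(β̄ w)` of the Cartan model, where
`k = κ/4`, generates a `1`-parameter group of isometries, which moves any integral curve along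
itself. -/
theorem cartanModel_exists_oneParameterGroup_of_integralCurve (hκ : κ ≤ 0) (α v : ℝ) (β : ℂ)
    {f : ℝ → ℝ × ℝ × ℝ} (hf : ∀ t, f t ∈ (cartanModel κ τ).carrier)
    (hw : ∀ t, HasDerivAt (fun t => baseCLM (f t))
      (β + 2 * Complex.I * α * baseCLM (f t)
        + (κ / 4 : ℝ) * conj β * baseCLM (f t) ^ 2) t)
    (hz : ∀ t, HasDerivAt (fun t => (f t).2.2)
      (v + τ * (conj β * baseCLM (f t)).im) t) :
    ∃ T : ℝ → Equiv.Perm (cartanModel κ τ).carrier,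
      (cartanModel κ τ).IsOneParameterGroup T ∧
        ∀ t s, T t ⟨f s, hf s⟩ = ⟨f (t + s), hf (t + s)⟩ := by
  have hk : κ / 4 ≤ 0 := by linarith
  set k := κ / 4 with hkdef
  obtain ⟨C, S, hC, hS, dC, dS, C0, S0, hCS, addC, addS⟩ :=
    exists_generalized_cos_sin (-(α ^ 2 + k * normSq β))
  -- `(A, B)` is the first row of `exp (t M)` for `M` with rows `(iα, β)` and `(-k β̄, -iα)`
  let A : ℝ → ℂ := fun t => C t + Complex.I * α * S t
  let B : ℝ → ℂ := fun t => β * S t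
  have hA : ContDiff ℝ ∞ A := (Complex.ofRealCLM.contDiff.comp hC).add
    (contDiff_const.mul (Complex.ofRealCLM.contDiff.comp hS))
  have hB : ContDiff ℝ ∞ B := contDiff_const.mul (Complex.ofRealCLM.contDiff.comp hS)
  have hnA : ∀ t, normSq (A t) = C t ^ 2 + α ^ 2 * S t ^ 2 := fun t => by
    simp [A, Complex.normSq_apply]; ring
  have hnB : ∀ t, normSq (B t) = normSq β * S t ^ 2 := fun t => by
    simp [B, ← sq]
  have hab : ∀ t, normSq (A t) + k * normSq (B t) = 1 := fun t => by
    rw [hnA, hnB]; linear_combination hCS t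
  have hab' : ∀ t, normSq (conj (A t)) + k * normSq (-B t) = 1 := fun t => by
    rw [Complex.normSq_conj, Complex.normSq_neg, hab]
  have hcA : ∀ t, conj (A t) = C t - Complex.I * α * S t := fun t => by simp [A]; ring
  have hcB : ∀ t, conj (B t) = conj β * S t := fun t => by simp [B]
  have hββ : (normSq β : ℂ) = conj β * β := Complex.normSq_eq_conj_mul_self
  have hpos : ∀ t, C t ^ 2 + α ^ 2 * S t ^ 2 ≠ 0 := fun t => by
    have := one_le_normSq hk (hab t)
    rw [hnA] at this
    linarith
  -- `G` accounts for the argument of `A t`, which is divided out in `cartanMove`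
  obtain ⟨G, hG, G0, dG⟩ := exists_smooth_primitive
    (g := fun t => S t ^ 2 / (C t ^ 2 + α ^ 2 * S t ^ 2))
    ((hS.pow 2).div ((hC.pow 2).add (contDiff_const.mul (hS.pow 2))) hpos)
  let c : ℝ → ℝ := fun t => v * t + τ * normSq β * α * G t
  have hc : ContDiff ℝ ∞ c := by fun_prop
  let Φ : ℝ → ℝ × ℝ × ℝ → ℝ × ℝ × ℝ := fun t p => cartanMove κ τ (A t) (B t) (c t) p
  have hbΦ : ∀ t p, baseCLM (Φ t p) = mobius k (A t) (B t) (baseCLM p) := fun t p =>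
    baseCLM_cartanMove _ _
  have hA0 : A 0 = 1 := by simp [A, C0, S0]
  have hB0 : B 0 = 0 := by simp [B, S0]
  have hc0 : c 0 = 0 := by simp [c, G0]
  have hΦ0 : ∀ p, Φ 0 p = p := fun p => by
    refine ext_baseCLM ?_ ?_
    · rw [hbΦ, hA0, hB0, mobius_one_zero]
    · change p.2.2 + (c 0 + τ * primitiveLog k (conj (B 0) * baseCLM p / conj (A 0))) = p.2.2
      rw [hB0, hc0, map_zero, zero_mul, zero_div, primitiveLog_zero]
      simp
  have hmem : ∀ t, ∀ p : ℝ × ℝ × ℝ, p ∈ (cartanModel κ τ).carrier →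
      Φ t p ∈ (cartanModel κ τ).carrier :=
    fun t p hp => cartanMove_mem hκ (hab t) (c t) hp
  have dC' : ∀ t, HasDerivAt (fun t => (C t : ℂ)) ((-(α ^ 2 + k * normSq β) * S t : ℝ) : ℂ) t :=
    fun t => (dC t).ofReal_comp
  have dS' : ∀ t, HasDerivAt (fun t => (S t : ℂ)) (C t : ℂ) t := fun t => (dS t).ofReal_comp
  have hCS' : ∀ t, (C t : ℂ) ^ 2 + (α ^ 2 + k * (conj β * β)) * (S t : ℂ) ^ 2 = 1 := fun t => by
    rw [← hββ]; exact_mod_cast (by linear_combination hCS t :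
      C t ^ 2 + (α ^ 2 + k * normSq β) * S t ^ 2 = 1)
  -- the vertical coordinate satisfies the equation of the flow
  have dz : ∀ p : ℝ × ℝ × ℝ, p ∈ (cartanModel κ τ).carrier → ∀ t, HasDerivAt (fun t => (Φ t p).2.2)
      (v + τ * (conj β * mobius k (A t) (B t) (baseCLM p)).im) t := by
    intro p hp t
    have hp' := mem_cartanModel.1 hp
    have hd := mobius_den_ne_zero hk (hab t) hp'
    have ha : conj (A t) ≠ 0 := (map_ne_zero _).2 (ne_zero_of_normSq hk (hab t))
    have dζ : HasDerivAt (fun t => conj (B t) * baseCLM p / conj (A t))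
        (conj β * baseCLM p / conj (A t) ^ 2) t := by
      have h1 : HasDerivAt (fun t => conj (B t) * baseCLM p) (conj β * C t * baseCLM p) t := by
        simp only [hcB]
        exact ((dS' t).const_mul (conj β)).mul_const _
      have h2 : HasDerivAt (fun t => conj (A t))
          (((-(α ^ 2 + k * normSq β) * S t : ℝ) : ℂ) - Complex.I * α * C t) t := by
        simp only [hcA]
        exact (dC' t).sub ((dS' t).const_mul _)
      refine (h1.fun_div h2 ha).congr_deriv ?_
      congr 1
      rw [hcA, hcB]
      push_cast
      rw [hββ]
      linear_combination (conj β * baseCLM p) * hCS' t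
    have hL := hasDerivAt_primitiveLog
      (f := fun t => conj (B t) * baseCLM p / conj (A t)) (one_sub_mem_slitPlane hk (hab t) hp') dζ
    have hcd : HasDerivAt c (v + τ * normSq β * α * (S t ^ 2 / (C t ^ 2 + α ^ 2 * S t ^ 2))) t := by
      simpa using ((hasDerivAt_id t).const_mul v).fun_add ((dG t).const_mul (τ * normSq β * α))
    refine ((hcd.add (hL.const_mul τ)).const_add p.2.2).congr_deriv ?_
    have e1 : conj β * baseCLM p / conj (A t) ^ 2 / (1 - k * (conj (B t) * baseCLM p / conj (A t)))
        = conj β * baseCLM p / (conj (A t) * (conj (A t) - k * conj (B t) * baseCLM p)) := by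
      rw [div_div]
      congr 1
      field_simp
    have e2 : conj β * mobius k (A t) (B t) (baseCLM p)
        - conj β * baseCLM p / (conj (A t) * (conj (A t) - k * conj (B t) * baseCLM p))
        = ((normSq β * S t / (C t ^ 2 + α ^ 2 * S t ^ 2) : ℝ) : ℂ) * A t := by
      have h1 : (((C t ^ 2 + α ^ 2 * S t ^ 2 : ℝ) : ℂ)) = conj (A t) * A t := by
        rw [← hnA]; exact Complex.normSq_eq_conj_mul_self
      have h2 : ((normSq β * S t / (C t ^ 2 + α ^ 2 * S t ^ 2) : ℝ) : ℂ) * A t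
          = conj β * β * S t / conj (A t) := by
        have hA' : A t ≠ 0 := ne_zero_of_normSq hk (hab t)
        rw [Complex.ofReal_div, h1, Complex.ofReal_mul, hββ]
        field_simp
      have h3 : conj (A t) * A t + k * (conj (B t) * B t) = 1 := by
        have := hab t
        rw [← Complex.normSq_eq_conj_mul_self, ← Complex.normSq_eq_conj_mul_self]
        exact_mod_cast this
      rw [h2, mobius]
      generalize hden : conj (A t) - k * conj (B t) * baseCLM p = d at hd
      field_simp
      rw [← hden]
      linear_combination (conj β * baseCLM p) * h3
    rw [e1]
    have e3 := congrArg Complex.im e2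
    rw [Complex.sub_im, Complex.im_ofReal_mul] at e3
    have e4 : (A t).im = α * S t := by simp [A]
    rw [e4] at e3
    linear_combination -τ * e3
  have hadd : ∀ s t, ∀ p : ℝ × ℝ × ℝ, p ∈ (cartanModel κ τ).carrier →
      Φ (s + t) p = Φ s (Φ t p) := by
    intro s t p hp
    have hp' := mem_cartanModel.1 hp
    have hmob : ∀ s t, mobius k (A (s + t)) (B (s + t)) (baseCLM p)
        = mobius k (A s) (B s) (mobius k (A t) (B t) (baseCLM p)) := by
      intro s t
      rw [mobius_mobius hk (hab t) hp']
      congr 1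
      · rw [hcB]
        simp only [A, B, addC, addS]
        push_cast
        rw [hββ]
        linear_combination (-(α ^ 2 * S s * S t) : ℂ) * Complex.I_sq
      · rw [hcA]
        simp only [A, B, addS]
        push_cast
        ring
    refine ext_baseCLM ?_ ?_
    · rw [hbΦ, hbΦ, hbΦ, hmob]
    · refine eq_of_hasDerivAt_eq (f := fun s => (Φ (s + t) p).2.2)
        (g := fun s => (Φ s (Φ t p)).2.2) (fun s => (dz p hp (s + t)).comp_add_const s t)
        (fun s => (dz _ (hmem t p hp) s).congr_deriv ?_) ?_ s
      · rw [hbΦ, hmob]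
      · rw [zero_add, hΦ0]
  obtain ⟨T, hT, hTΦ⟩ := exists_oneParameterGroup_of_flow (M := cartanModel κ τ) (Φ := Φ)
    (U := (cartanModel κ τ).carrier) isOpen_cartanModel subset_rfl
    (fun x hx => (contDiffAt_cartanMove (A := fun x : ℝ × (ℝ × ℝ × ℝ) => A x.1)
      (B := fun x : ℝ × (ℝ × ℝ × ℝ) => B x.1) (c := fun x : ℝ × (ℝ × ℝ × ℝ) => c x.1)
      (p := fun x : ℝ × (ℝ × ℝ × ℝ) => x.2) hκ (hab _) hx.2
      (hA.comp contDiff_fst).contDiffAt (hB.comp contDiff_fst).contDiffAt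
      (hc.comp contDiff_fst).contDiffAt contDiffAt_snd).contDiffWithinAt)
    hmem (fun p _ => hΦ0 p) hadd
    (fun t g hg hgm s => ⟨_, hasDerivAt_cartanMove hκ (hab t) (c t) (hgm s)
      (hg.differentiable (by simp) s).hasDerivAt, cartanMove_metric hκ (hab t) (c t) (hgm s) _⟩)
  refine ⟨T, hT, fun t s => Subtype.ext ((hTΦ t ⟨f s, hf s⟩).trans ?_)⟩
  have hfm : ∀ t, 0 < 1 + k * normSq (baseCLM (f t)) := fun t =>
    mem_cartanModel.1 (hf t)
  -- pulling the integral curve back by the flow gives a constant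
  have hbase : ∀ t, baseCLM (f (t + s))
      = mobius k (A t) (B t) (baseCLM (f s)) := by
    intro t
    have hconst : mobius k (conj (A t)) (-B t) (baseCLM (f (t + s)))
        = baseCLM (f s) := by
      refine eq_of_hasDerivAt_eq
        (f := fun t => mobius k (conj (A t)) (-B t) (baseCLM (f (t + s))))
        (g := fun _ => baseCLM (f s)) (f' := fun _ => 0) (fun t => ?_)
        (fun t => hasDerivAt_const _ _) ?_ t
      · have hd := mobius_den_ne_zero hk (hab' t) (hfm (t + s))
        have du := (hw (t + s)).comp_add_const t s
        generalize hU : (fun t => baseCLM (f (t + s))) = U at du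
        have hUt : ∀ t, baseCLM (f (t + s)) = U t := fun t => by rw [← hU]
        simp only [mobius, Complex.conj_conj] at hd ⊢
        simp only [hUt, map_neg, hcB, hcA] at hd du ⊢
        have hAt : ∀ t, A t = C t + Complex.I * α * S t := fun _ => rfl
        simp only [hAt, B] at hd ⊢
        have dA := (dC' t).fun_add ((dS' t).const_mul (Complex.I * α))
        have dA' := (dC' t).fun_sub ((dS' t).const_mul (Complex.I * α))
        have dB := ((dS' t).const_mul β).fun_neg
        have dB' := (((dS' t).const_mul (conj β)).fun_neg).const_mul (k : ℂ)
        refine (((dA'.fun_mul du).fun_add dB).fun_div (dA.fun_sub (dB'.fun_mul du))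
          hd).congr_deriv ?_
        refine div_eq_zero_iff.2 (Or.inl ?_)
        push_cast
        rw [hββ]
        generalize U t = u
        generalize (C t : ℂ) = x
        generalize (S t : ℂ) = y
        generalize conj β = β'
        generalize (k : ℂ) = k
        generalize (α : ℂ) = α
        linear_combination (-(α ^ 2 * y * u) * (x + Complex.I * α * y + k * (β' * y) * u)
          + α ^ 2 * y * ((x - Complex.I * α * y) * u - β * y)) * Complex.I_sq
      · simp only [hA0, hB0, map_one, neg_zero, zero_add, mobius_one_zero]
    have := mobius_inverse hk (hab' t) (hfm (t + s))
    rw [Complex.conj_conj, neg_neg, hconst] at this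
    exact this.symm
  refine ext_baseCLM ?_ ?_
  · rw [hbΦ]; exact (hbase t).symm
  · refine eq_of_hasDerivAt_eq (f := fun t => (Φ t (f s)).2.2)
      (g := fun t => (f (t + s)).2.2) (dz _ (hf s))
      (fun t => ((hz (t + s)).comp_add_const t s).congr_deriv (by rw [hbase])) ?_ t
    rw [hΦ0, zero_add]

end CartanFlows

/-! ### Geodesics of the Cartan model -/

section CartanGeodesics

variable {κ τ : ℝ}

theorem one_add_pos_of_mem_cartanModel {p : ℝ × ℝ × ℝ} (hp : p ∈ (cartanModel κ τ).carrier) :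
    0 < 1 + κ / 4 * (p.1 ^ 2 + p.2.1 ^ 2) := one_div_pos (G₀ := ℝ) |>.1 hp

theorem fderiv_cartanModel_metric {p : ℝ × ℝ × ℝ} (hp : p ∈ (cartanModel κ τ).carrier)
    (v u : ℝ × ℝ × ℝ) :
    fderiv ℝ (fun p : ℝ × ℝ × ℝ => ((cartanModel κ τ).metric p v v : ℝ)) p u =
      2 * conformalFactor κ p.1 p.2.1
        * (-(conformalFactor κ p.1 p.2.1 ^ 2 * (κ / 2)) * (p.1 * u.1 + p.2.1 * u.2.1))
        * (v.1 ^ 2 + v.2.1 ^ 2)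
      + 2 * (v.2.2 + conformalFactor κ p.1 p.2.1 * τ * (p.2.1 * v.1 - p.1 * v.2.1)) * τ
        * (-(conformalFactor κ p.1 p.2.1 ^ 2 * (κ / 2)) * (p.1 * u.1 + p.2.1 * u.2.1)
            * (p.2.1 * v.1 - p.1 * v.2.1)
          + conformalFactor κ p.1 p.2.1 * (u.2.1 * v.1 - u.1 * v.2.1)) := by
  have dl : HasFDerivAt (fun p : ℝ × ℝ × ℝ => conformalFactor κ p.1 p.2.1) _ p :=
    hasFDerivAt_conformalFactor (one_add_pos_of_mem_cartanModel hp).ne'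
  have hx : HasFDerivAt (fun p : ℝ × ℝ × ℝ => p.1) coordX p := coordX.hasFDerivAt
  have hy : HasFDerivAt (fun p : ℝ × ℝ × ℝ => p.2.1) coordY p := coordY.hasFDerivAt
  have dc := ((dl.mul_const τ).fun_mul ((hy.mul_const v.1).fun_sub (hx.mul_const v.2.1))).const_add
    v.2.2
  have d := ((dl.pow 2).mul_const (v.1 * v.1 + v.2.1 * v.2.1)).fun_add (dc.fun_mul dc)
  have d' : HasFDerivAt (fun p : ℝ × ℝ × ℝ => ((cartanModel κ τ).metric p v v : ℝ)) _ p := d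
  rw [d'.fderiv]
  simp
  ring

theorem cartanModel_isTangent {p : ℝ × ℝ × ℝ} (hp : p ∈ (cartanModel κ τ).carrier)
    (w : ℝ × ℝ × ℝ) : (cartanModel κ τ).IsTangent ⟨p, hp⟩ w := by
  obtain ⟨c, hc, hc0, hd, hm⟩ := exists_smooth_curve_of_isOpen isOpen_cartanModel hp w
  exact ⟨fun t => ⟨c t, hm t⟩, hc, Subtype.ext hc0, hd.deriv⟩

/-- A geodesic of the Cartan model is an integral curve of a Killing field: the coefficients of
the field are the constants of motion that the geodesic has by Noether's theorem, the momenta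
`η`, `Q` and `P = (P₁, P₂)` of the vertical translations, of the rotations around the `z`-axis and
of the fields covering the transvections of the base at the origin. -/
theorem cartanModel_exists_integralCurve {f : ℝ → ℝ × ℝ × ℝ}
    (hf : ∀ t, f t ∈ (cartanModel κ τ).carrier)
    (hγ : (cartanModel κ τ).IsGeodesic fun t => ⟨f t, hf t⟩) : ∃ (α v : ℝ) (β : ℂ),
    (∀ t, HasDerivAt (fun t => baseCLM (f t)) (β + 2 * Complex.I * α * baseCLM (f t)
        + (κ / 4 : ℝ) * starRingEnd ℂ β * baseCLM (f t) ^ 2) t) ∧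
    ∀ t, HasDerivAt (fun t => (f t).2.2) (v + τ * (starRingEnd ℂ β * baseCLM (f t)).im) t := by
  have hfs : ContDiff ℝ ∞ f := hγ.1
  have hfs' : ContDiff ℝ ∞ (deriv f) := (contDiff_infty_iff_deriv.1 hfs).2
  let l : ℝ → ℝ := fun t => conformalFactor κ (f t).1 (f t).2.1
  let η : ℝ → ℝ := fun t => (deriv f t).2.2
    + l t * τ * ((f t).2.1 * (deriv f t).1 - (f t).1 * (deriv f t).2.1)
  have hEL : ∀ (t : ℝ) (w : ℝ × ℝ × ℝ),
      deriv (fun s => l s ^ 2 * ((deriv f s).1 * w.1 + (deriv f s).2.1 * w.2.1)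
        + η s * (w.2.2 + l s * τ * ((f s).2.1 * w.1 - (f s).1 * w.2.1))) t = 1 / 2 *
      (2 * l t * (-(l t ^ 2 * (κ / 2)) * ((f t).1 * w.1 + (f t).2.1 * w.2.1))
          * ((deriv f t).1 ^ 2 + (deriv f t).2.1 ^ 2)
        + 2 * η t * τ * (-(l t ^ 2 * (κ / 2)) * ((f t).1 * w.1 + (f t).2.1 * w.2.1)
            * ((f t).2.1 * (deriv f t).1 - (f t).1 * (deriv f t).2.1)
          + l t * (w.2.1 * (deriv f t).1 - w.1 * (deriv f t).2.1))) := fun t w =>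
    (hγ.2 t w (cartanModel_isTangent (hf t) w)).trans
      (congrArg (1 / 2 * ·) (fderiv_cartanModel_metric (hf t) (deriv f t) w))
  have df : ∀ t, HasDerivAt f (deriv f t) t := fun t =>
    (hfs.differentiable (by simp) t).hasDerivAt
  have dx : ∀ t, HasDerivAt (fun t => (f t).1) (deriv f t).1 t := fun t =>
    coordX.hasFDerivAt.comp_hasDerivAt t (df t)
  have dy : ∀ t, HasDerivAt (fun t => (f t).2.1) (deriv f t).2.1 t := fun t =>
    coordY.hasFDerivAt.comp_hasDerivAt t (df t)
  have dz : ∀ t, HasDerivAt (fun t => (f t).2.2) (deriv f t).2.2 t := fun t =>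
    coordZ.hasFDerivAt.comp_hasDerivAt t (df t)
  have hlc : ∀ t, DifferentiableAt ℝ l t := fun t =>
    ((hasFDerivAt_conformalFactor (one_add_pos_of_mem_cartanModel (hf t)).ne').comp_hasDerivAt
      (f := f) t (df t)).differentiableAt
  have hl : ∀ t, l t * (1 + κ / 4 * ((f t).1 ^ 2 + (f t).2.1 ^ 2)) = 1 := fun t =>
    conformalFactor_mul (one_add_pos_of_mem_cartanModel (hf t)).ne'
  have cx : ∀ t, DifferentiableAt ℝ (fun t => (f t).1) t := fun t => (dx t).differentiableAt
  have cy : ∀ t, DifferentiableAt ℝ (fun t => (f t).2.1) t := fun t => (dy t).differentiableAt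
  have cx' : ∀ t, DifferentiableAt ℝ (fun t => (deriv f t).1) t := fun t =>
    (hfs'.fst.differentiable (by simp) t)
  have cy' : ∀ t, DifferentiableAt ℝ (fun t => (deriv f t).2.1) t := fun t =>
    (hfs'.snd.fst.differentiable (by simp) t)
  have cz' : ∀ t, DifferentiableAt ℝ (fun t => (deriv f t).2.2) t := fun t =>
    (hfs'.snd.snd.differentiable (by simp) t)
  have cη : ∀ t, DifferentiableAt ℝ η t := fun t => by
    have := cx t; have := cy t; have := cx' t; have := cy' t; have := cz' t; have := hlc t
    fun_prop
  have dη : ∀ t, HasDerivAt η 0 t := fun t => by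
    refine (cη t).hasDerivAt.congr_deriv ?_
    simpa using hEL t (0, 0, 1)
  let p₁ : ℝ → ℝ := fun t => l t ^ 2 * (deriv f t).1 + η t * (l t * τ * (f t).2.1)
  let p₂ : ℝ → ℝ := fun t => l t ^ 2 * (deriv f t).2.1 - η t * (l t * τ * (f t).1)
  have dp₁ : ∀ t, HasDerivAt p₁ (-(l t ^ 3 * (κ / 2)) * (f t).1
        * ((deriv f t).1 ^ 2 + (deriv f t).2.1 ^ 2)
      + η t * τ * (-(l t ^ 2 * (κ / 2)) * (f t).1
        * ((f t).2.1 * (deriv f t).1 - (f t).1 * (deriv f t).2.1) - l t * (deriv f t).2.1)) t := by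
    intro t
    have hd : DifferentiableAt ℝ p₁ t := by
      have := cy t; have := cx' t; have := cη t; have := hlc t
      fun_prop
    refine hd.hasDerivAt.congr_deriv ?_
    have h := hEL t (1, 0, 0)
    have e : (fun s => l s ^ 2 * ((deriv f s).1 * (1, (0 : ℝ), (0 : ℝ)).1
        + (deriv f s).2.1 * ((1 : ℝ), (0 : ℝ), (0 : ℝ)).2.1)
        + η s * (((1 : ℝ), (0 : ℝ), (0 : ℝ)).2.2 + l s * τ * ((f s).2.1 * (1, (0 : ℝ), (0 : ℝ)).1
          - (f s).1 * ((1 : ℝ), (0 : ℝ), (0 : ℝ)).2.1))) = p₁ := by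
      funext s; simp [p₁]
    rw [e] at h
    rw [h]
    ring
  have dp₂ : ∀ t, HasDerivAt p₂ (-(l t ^ 3 * (κ / 2)) * (f t).2.1
        * ((deriv f t).1 ^ 2 + (deriv f t).2.1 ^ 2)
      + η t * τ * (-(l t ^ 2 * (κ / 2)) * (f t).2.1
        * ((f t).2.1 * (deriv f t).1 - (f t).1 * (deriv f t).2.1) + l t * (deriv f t).1)) t := by
    intro t
    have hd : DifferentiableAt ℝ p₂ t := by
      have := cx t; have := cy' t; have := cη t; have := hlc t
      fun_prop
    refine hd.hasDerivAt.congr_deriv ?_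
    have h := hEL t (0, 1, 0)
    have e : (fun s => l s ^ 2 * ((deriv f s).1 * ((0 : ℝ), (1 : ℝ), (0 : ℝ)).1
        + (deriv f s).2.1 * ((0 : ℝ), (1 : ℝ), (0 : ℝ)).2.1)
        + η s * (((0 : ℝ), (1 : ℝ), (0 : ℝ)).2.2 + l s * τ
          * ((f s).2.1 * ((0 : ℝ), (1 : ℝ), (0 : ℝ)).1
            - (f s).1 * ((0 : ℝ), (1 : ℝ), (0 : ℝ)).2.1))) = p₂ := by
      funext s; simp [p₂]; ring
    rw [e] at h
    rw [h]
    ring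
  let Q : ℝ → ℝ := fun t => (f t).1 * p₂ t - (f t).2.1 * p₁ t
  let P₁ : ℝ → ℝ := fun t => p₁ t + κ / 4 * (((f t).1 ^ 2 - (f t).2.1 ^ 2) * p₁ t
    + 2 * ((f t).1 * (f t).2.1) * p₂ t) + τ * (η t * (f t).2.1)
  let P₂ : ℝ → ℝ := fun t => p₂ t + κ / 4 * (2 * ((f t).1 * (f t).2.1) * p₁ t
    - ((f t).1 ^ 2 - (f t).2.1 ^ 2) * p₂ t) - τ * (η t * (f t).1)
  have dQ : ∀ t, HasDerivAt Q 0 t := fun t => by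
    refine (((dx t).fun_mul (dp₂ t)).fun_sub ((dy t).fun_mul (dp₁ t))).congr_deriv ?_
    simp only [p₁, p₂]
    ring
  have dP₁ : ∀ t, HasDerivAt P₁ 0 t := fun t => by
    refine (((dp₁ t).fun_add ((((((dx t).fun_pow 2).fun_sub ((dy t).fun_pow 2)).fun_mul
      (dp₁ t)).fun_add ((((dx t).fun_mul (dy t)).const_mul 2).fun_mul (dp₂ t))).const_mul
      (κ / 4))).fun_add (((dη t).fun_mul (dy t)).const_mul τ)).congr_deriv ?_
    simp only [p₁, p₂]
    linear_combination (-(κ / 2) * l t * (f t).1 * (l t * ((deriv f t).1 ^ 2 + (deriv f t).2.1 ^ 2)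
      - η t * τ * ((f t).1 * (deriv f t).2.1 - (f t).2.1 * (deriv f t).1))
      - η t * τ * (deriv f t).2.1) * hl t
  have dP₂ : ∀ t, HasDerivAt P₂ 0 t := fun t => by
    refine (((dp₂ t).fun_add (((((dx t).fun_mul (dy t)).const_mul 2).fun_mul (dp₁ t)).fun_sub
      ((((dx t).fun_pow 2).fun_sub ((dy t).fun_pow 2)).fun_mul (dp₂ t)) |>.const_mul
      (κ / 4))).fun_sub (((dη t).fun_mul (dx t)).const_mul τ)).congr_deriv ?_
    simp only [p₁, p₂]
    linear_combination (-(κ / 2) * l t * (f t).2.1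
      * (l t * ((deriv f t).1 ^ 2 + (deriv f t).2.1 ^ 2)
      - η t * τ * ((f t).1 * (deriv f t).2.1 - (f t).2.1 * (deriv f t).1))
      + η t * τ * (deriv f t).1) * hl t
  have hconst : ∀ {g : ℝ → ℝ}, (∀ t, HasDerivAt g 0 t) → ∀ t, g 0 = g t := fun {g} hg t =>
    (eq_of_hasDerivAt_eq hg (fun t => hasDerivAt_const t (g 0)) rfl t).symm
  refine ⟨2 * (κ / 4) * Q 0 + τ * η 0, η 0 + 2 * τ * Q 0, ⟨P₁ 0, P₂ 0⟩, fun t => ?_, fun t => ?_⟩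
  · refine (baseCLM.hasFDerivAt.comp_hasDerivAt t (df t)).congr_deriv ?_
    rw [hconst dQ t, hconst dη t, hconst dP₁ t, hconst dP₂ t]
    refine Complex.ext ?_ ?_
    · simp [P₁, P₂, Q, p₁, p₂, pow_two]
      linear_combination -((deriv f t).1 * (l t * (1 + κ / 4 * ((f t).1 ^ 2 + (f t).2.1 ^ 2)) + 1)
        + η t * τ * (f t).2.1 * (1 + κ / 4 * ((f t).1 ^ 2 + (f t).2.1 ^ 2))) * hl t
    · simp [P₁, P₂, Q, p₁, p₂, pow_two]
      linear_combination -((deriv f t).2.1 * (l t * (1 + κ / 4 * ((f t).1 ^ 2 + (f t).2.1 ^ 2)) + 1)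
        - η t * τ * (f t).1 * (1 + κ / 4 * ((f t).1 ^ 2 + (f t).2.1 ^ 2))) * hl t
  · refine (dz t).congr_deriv ?_
    rw [hconst dQ t, hconst dη t, hconst dP₁ t, hconst dP₂ t]
    simp [P₁, P₂, Q, p₁, p₂]
    have hη : η t = (deriv f t).2.2
      + l t * τ * ((f t).2.1 * (deriv f t).1 - (f t).1 * (deriv f t).2.1) := rfl
    linear_combination -hη - (τ * l t * ((f t).1 * (deriv f t).2.1 - (f t).2.1 * (deriv f t).1)
      - η t * τ ^ 2 * ((f t).1 ^ 2 + (f t).2.1 ^ 2)) * hl t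

end CartanGeodesics

/-! ### Unique existence of the `1`-parameter group -/

theorem cartanModel_exists_oneParameterGroup {κ τ : ℝ} (hκ : κ ≤ 0)
    {γ : ℝ → (cartanModel κ τ).carrier} (hγ : (cartanModel κ τ).IsGeodesic γ) :
    ∃ T : ℝ → Equiv.Perm (cartanModel κ τ).carrier,
      (cartanModel κ τ).IsOneParameterGroup T ∧ ∀ t s, T t (γ s) = γ (t + s) := by
  obtain ⟨α, v, β, hw, hz⟩ := cartanModel_exists_integralCurve (f := fun t => (γ t).1)
    (fun t => (γ t).2) hγ
  exact cartanModel_exists_oneParameterGroup_of_integralCurve hκ α v β (fun t => (γ t).2) hw hz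

/-- Existence of the `1`-parameter group is enough for unique existence, by
`isometryHom_unique`. -/
theorem existsUnique_of_exists {M : SpaceData} {κ τ : ℝ} (hκτ : κ - 4 * τ ^ 2 ≠ 0)
    (hM : PreconnectedSpace M.carrier)
    (hchart : ∀ p : M.carrier, Nonempty (IsometricChart M κ τ p))
    {γ : ℝ → M.carrier} (hγ : M.IsGeodesic γ) (hnv : ¬ M.IsVertical γ)
    (hex : ∃ T : ℝ → Equiv.Perm M.carrier, M.IsOneParameterGroup T ∧
      ∀ t s, T t (γ s) = γ (t + s)) :
    ∃ T : ℝ → Equiv.Perm M.carrier, M.IsOneParameterGroup T ∧ (∀ t s : ℝ, T t (γ s) = γ (t + s)) ∧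
      ∀ S : ℝ → Equiv.Perm M.carrier, M.IsIsometryHom S →
        (∀ t s : ℝ, S t (γ s) = γ (t + s)) → S = T := by
  obtain ⟨T, hT, hTγ⟩ := hex
  exact ⟨T, hT, hTγ, fun S hS hSγ => isometryHom_unique hκτ hchart hγ.1 hnv hS hT.1 hSγ hTγ⟩

end EKappaTau

/-- For `κ ≠ 4τ²` and every non-vertical geodesic `γ` of `𝔼(κ, τ)` there is a unique
`1`-parameter group of isometries `T_t` with `T_t(γ(s)) = γ(t + s)`; uniqueness holds even among
all homomorphisms from `ℝ` to the isometry group, without any regularity in `t`. -/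
theorem mainTheorem12 (κ τ : ℝ) (hκτ : κ - 4 * τ ^ 2 ≠ 0)
    (γ : ℝ → (EKappaTau.space κ τ).carrier)
    (hγ : (EKappaTau.space κ τ).IsGeodesic γ)
    (hnv : ¬ (EKappaTau.space κ τ).IsVertical γ) :
    ∃ T : ℝ → Equiv.Perm (EKappaTau.space κ τ).carrier,
      (EKappaTau.space κ τ).IsOneParameterGroup T ∧
      (∀ t s : ℝ, T t (γ s) = γ (t + s)) ∧
      ∀ S : ℝ → Equiv.Perm (EKappaTau.space κ τ).carrier,
        (EKappaTau.space κ τ).IsIsometryHom S →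
        (∀ t s : ℝ, S t (γ s) = γ (t + s)) → S = T := by
  rcases le_or_gt κ 0 with hκ | hκ
  · have h : EKappaTau.space κ τ = EKappaTau.cartanModel κ τ := if_pos hκ
    generalize EKappaTau.space κ τ = M at *
    subst h
    exact EKappaTau.existsUnique_of_exists hκτ (EKappaTau.cartanModel_preconnectedSpace hκ)
      (fun p => EKappaTau.cartanModel_isometricChart hκ p.2) hγ hnv
      (EKappaTau.cartanModel_exists_oneParameterGroup hκ hγ)
  · by_cases hτ : τ = 0
    · have h : EKappaTau.space κ τ = EKappaTau.sphereProduct κ :=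
        (if_neg hκ.not_ge).trans (if_pos hτ)
      generalize EKappaTau.space κ τ = M at *
      subst h hτ
      exact EKappaTau.existsUnique_of_exists hκτ (EKappaTau.sphereProduct_preconnectedSpace hκ)
        (fun p => EKappaTau.sphereProduct_isometricChart hκ p) hγ hnv
        (EKappaTau.sphereProduct_exists_oneParameterGroup hκ hγ)
    · have h : EKappaTau.space κ τ = EKappaTau.bergerSphere κ τ :=
        (if_neg hκ.not_ge).trans (if_neg hτ)
      generalize EKappaTau.space κ τ = M at *
      subst h
      exact EKappaTau.existsUnique_of_exists hκτ EKappaTau.bergerSphere_preconnectedSpace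
        (fun p => EKappaTau.bergerSphere_isometricChart hκ hτ (EKappaTau.mem_bergerSphere.1 p.2))
        hγ hnv (EKappaTau.bergerSphere_exists_oneParameterGroup hκ hτ hγ)
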